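/- Let $d=1$, $T>0$, $\lambda>0$, $p\in\mathbb{N}=\{0,1,2,\dots\}$, $k=\max(2,p+1)$, and let $B,W,K$ be real constants. There are constants $C>0$ and $\delta>0$, depending only on $T,\lambda,p,B,W,K$, such that the following holds. **Data.** Let $\gamma:\mathbb{R}\to[0,\infty)$ be integrable with $\int\gamma(e)\,de=\lambda$, and put $\rho=\gamma/\lambda$. Let $\varphi\in C_b^k(\mathbb{R})$ and $f\in C_b^k([0,T]\times\mathbb{R}^2)$, with all derivatives of order $0,\dots,k$ bounded by $B$. On a filtered probability space let $\mu(de,dt)$ be a Poisson random measure on $\mathbb{R}\times(0,T]$ with compensator $\gamma(e)\,de\,dt$, whose restriction to times $\le t$ is $\mathcal{F}_t$-measurable and whose restriction to times $>t$ is independent of $\mathcal{F}_t$; let $\tilde\mu(de,dt)=\mu(de,dt)-\gamma(e)\,de\,dt$. For $(t,x)\in[0,T]\times\mathbb{R}$ let $(Y^{t,x},U^{t,x})\in S^2\times L^2(\tilde\mu)$ (with $Y^{t,x}$ adapted and càdlàg, $U^{t,x}$ predictable) be the solution on $[t,T]$ of the BSDE $$X_s=x+\int_t^s\!\int e\,\mu(de,dr),\qquad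 Y_s=\varphi(X_T)+\int_s^T f(r,X_r,Y_r)\,dr-\int_s^T\!\int U_r(e)\,\tilde\mu(de,dr),$$ and write $Y_t(x)=\mathbb{E}[Y^{t,x}_t]$. **Scheme.** Let $N\ge1$, $\Delta t=T/N$, $t_n=n\Delta t$, $\Delta x>0$, $x_i=x_0+i\Delta x$ $(i\in\mathbb{Z})$. For a mesh function $v$ let $I_pv(x)$ be the value at $x$ of the polynomial of degree $\le p$ that interpolates $v$ at $p+1$ mesh points closest to $x$ (ties broken arbitrarily). Let $(\tilde w_j,\tilde a_j)_{j=1}^Q$, $Q\ge1$, be a one-dimensional quadrature rule, and for a function $\psi$ put $$\mathcal{Q}_m\psi(x)=\sum_{q_1,\dots,q_m=1}^{Q}\Big(\prod_{l=1}^m\tilde w_{q_l}\Big)\psi\Big(x+\sum_{l=1}^m\tilde a_{q_l}\Big),\qquad \widehat{\mathbb{E}}_M[\psi](x)=\sum_{m=0}^{M}e^{-\lambda\Delta t}\frac{(\lambda\Delta t)^m}{m!}\,\mathcal{Q}_m\psi(x),$$ with $\mathcal{Q}_0\psi=\psi$. Given $M_y,M_f\in\mathbb{N}$, let $(Y^i_{n,p})_{0\le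 n\le N,\,i\in\mathbb{Z}}$ satisfy $Y^i_{N,p}=\varphi(x_i)$ and, for $n=N-1,\dots,0$ and $Y_{n+1,p}:=I_p\big((Y^j_{n+1,p})_j\big)$, $$Y^i_{n,p}=\widehat{\mathbb{E}}_{M_y}[Y_{n+1,p}](x_i)+\tfrac{\Delta t}{2}\,\widehat{\mathbb{E}}_{M_f}\big[f(t_{n+1},\cdot,Y_{n+1,p}(\cdot))\big](x_i)+\tfrac{\Delta t}{2}\,f(t_n,x_i,Y^i_{n,p}).$$ **Assumption on the quadrature.** $\sum_j|\tilde w_j|\le W$, and for some $r>0$ and all $0\le n<N$, $i\in\mathbb{Z}$, $$\Big|\int_{\mathbb{R}^m}\psi\Big(x_i+\sum_{l=1}^m e_l\Big)\prod_{l=1}^m\rho(e_l)\,de_1\cdots de_m-\mathcal{Q}_m\psi(x_i)\Big|\le K\,Q^{-r}$$ both for $\psi=Y_{t_{n+1}}(\cdot)$, $1\le m\le M_y$, and for $\psi=f(t_{n+1},\cdot,Y_{t_{n+1}}(\cdot))$, $1\le m\le M_f$. **Conclusion.** If $\Delta t<\delta$, then for all $0\le n\le N$ the error $e_n^i=Y^{t_n,x_i}_{t_n}-Y^i_{n,p}$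 satisfies, almost surely, $$\sup_{i\in\mathbb{Z}}|e_n^i|\le C\left[(\Delta t)^2+(\lambda\Delta t)^{M_y}+(\lambda\Delta t)^{M_f+1}+Q^{-r}+(\Delta x)^{p+1}\right].$$ -/

import Mathlib

open MeasureTheory ProbabilityTheory Filter Set
open scoped NNReal ENNReal Topology

noncomputable section

namespace JumpBSDE

/-- `ψ` belongs to the class `C_b^k(D)`, and `ψ` and all its derivatives of order at most `k` are
bounded on `D` by `B`. -/
def IsCb {E : Type*} [NormedAddCommGroup E] [NormedSpace ℝ E]
    (k : ℕ) (B : ℝ) (D : Set E) (ψ : E → ℝ) : Prop :=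
  ContDiffOn ℝ k ψ D ∧ ∀ j ≤ k, ∀ x ∈ D, ‖iteratedFDerivWithin ℝ j ψ D x‖ ≤ B

/-- The jump measure `λ(de) = γ(e) de`. The point `e = 0` is a null set, so integrals over
`E = ℝ \ {0}` and over `ℝ` agree. -/
def jumpMeasure (γ : ℝ → ℝ) : Measure ℝ :=
  (volume : Measure ℝ).withDensity fun e => ENNReal.ofReal (γ e)

/-- The compensator `λ(de) dt` on `(0,T] × ℝ`, as a measure in the variable `(t, e)`. -/
def compensator (γ : ℝ → ℝ) (T : ℝ) : Measure (ℝ × ℝ) :=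
  ((volume : Measure ℝ).restrict (Ioc 0 T)).prod (jumpMeasure γ)

/-- `μ` is a Poisson random measure on `S` with intensity measure `ν`. -/
structure IsPoissonRandomMeasure {Ω S : Type*} [MeasurableSpace Ω] [MeasurableSpace S]
    (P : Measure Ω) (ν : Measure S) (μ : Ω → Measure S) : Prop where
  measurable : Measurable μ
  poisson : ∀ A : Set S, MeasurableSet A → ν A ≠ ∞ →
    P.map (fun ω => μ ω A) = (poissonMeasure (ν A).toNNReal).map (fun k : ℕ => (k : ℝ≥0∞))
  indep : ∀ (m : ℕ) (A : Fin m → Set S), (∀ i, MeasurableSet (A i)) →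
    Pairwise (fun i j => Disjoint (A i) (A j)) → iIndepFun (fun i ω => μ ω (A i)) P

/-- The random measure `μ` of time-mark pairs is compatible with the filtration: its restriction
to times up to `t` is known at time `t`, and its restriction to later times is independent of the
information available at time `t`. The (augmented) filtration generated by a Poisson random measure
has this property. -/
structure IsCompatible {Ω : Type*} [mΩ : MeasurableSpace Ω]
    (P : Measure Ω) (ℱ : Filtration ℝ≥0 mΩ) (μ : Ω → Measure (ℝ × ℝ)) : Prop where
  adapted : ∀ t : ℝ≥0, Measurable[ℱ t] fun ω => (μ ω).restrict (Iic (t : ℝ) ×ˢ univ)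
  indep : ∀ t : ℝ≥0, Indep (ℱ t)
    (MeasurableSpace.comap (fun ω => (μ ω).restrict (Ioi (t : ℝ) ×ˢ univ)) inferInstance) P

/-- The forward process started at `(t, x)`: `X_s = x + ∫_t^s ∫_E e μ(de,dr)`. -/
def forward {Ω : Type*} (μ : Ω → Measure (ℝ × ℝ)) (t x s : ℝ) (ω : Ω) : ℝ :=
  x + ∫ z in Ioc t s ×ˢ univ, z.2 ∂(μ ω)

/-- The integral `∫_s^T ∫_E U_r(e) (μ(de,dr) - λ(de) dr)` against the compensated measure. As the
jump measure is finite, it is the difference of two Lebesgue integrals. -/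
def compensatedIntegral {Ω : Type*} (γ : ℝ → ℝ) (T : ℝ) (μ : Ω → Measure (ℝ × ℝ))
    (U : ℝ → Ω → ℝ → ℝ) (s : ℝ) (ω : Ω) : ℝ :=
  (∫ z in Ioc s T ×ˢ univ, U z.1 ω z.2 ∂(μ ω))
    - ∫ r in Ioc s T, ∫ e, U r ω e ∂(jumpMeasure γ)

/-- `(Y, U)` is a solution in `S² × L²(μ̃)` of the BSDE with jumps on `[t, T]`, with forward process
started at `X_t = x`:
`Y_s = φ(X_T) + ∫_s^T f(r, X_r, Y_r) dr - ∫_s^T ∫_E U_r(e) μ̃(de,dr)`. -/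
structure IsBSDESolution {Ω : Type*} [mΩ : MeasurableSpace Ω]
    (P : Measure Ω) (ℱ : Filtration ℝ≥0 mΩ) (μ : Ω → Measure (ℝ × ℝ))
    (γ : ℝ → ℝ) (T : ℝ) (φ : ℝ → ℝ) (f : ℝ × ℝ × ℝ → ℝ) (t x : ℝ)
    (Y : ℝ → Ω → ℝ) (U : ℝ → Ω → ℝ → ℝ) : Prop where
  adapted : ∀ s : ℝ≥0, (s : ℝ) ∈ Icc t T → Measurable[ℱ s] (Y s)
  right_continuous : ∀ᵐ ω ∂P, ∀ s ∈ Ico t T, ContinuousWithinAt (fun r => Y r ω) (Ici s) s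
  left_limits : ∀ᵐ ω ∂P, ∀ s ∈ Ioc t T, ∃ l : ℝ, Tendsto (fun r => Y r ω) (𝓝[<] s) (𝓝 l)
  sup_sq_lt_top : ∫⁻ ω, (⨆ s ∈ Icc t T, ‖Y s ω‖ₑ) ^ 2 ∂P < ∞
  predictable :
    Measurable[MeasurableSpace.prod ℱ.predictable (borel ℝ)]
      fun q : (ℝ≥0 × Ω) × ℝ => U (q.1.1 : ℝ) q.1.2 q.2
  sq_lt_top :
    ∫⁻ ω, ∫⁻ r in Ioc t T, ∫⁻ e, ‖U r ω e‖ₑ ^ 2 ∂(jumpMeasure γ) ∂volume ∂P < ∞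
  equation : ∀ᵐ ω ∂P, ∀ s ∈ Icc t T,
    Y s ω = φ (forward μ t x T ω) + (∫ r in Ioc s T, f (r, forward μ t x r ω, Y r ω))
      - compensatedIntegral γ T μ U s ω

/-- The exact solution as a function of the starting point, `Y_t(x) = E_t^x[Y_t]`, where `Y t x` is
the solution of the BSDE started at `X_t = x`. -/
def value {Ω : Type*} [MeasurableSpace Ω] (P : Measure Ω) (Y : ℝ → ℝ → ℝ → Ω → ℝ) (t x : ℝ) : ℝ :=
  ∫ ω, Y t x t ω ∂P

/-- The `n`-th point of the uniform time mesh with step `dt`. -/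
def tgrid (dt : ℝ) (n : ℕ) : ℝ := n * dt

/-- The `i`-th point of the uniform spatial mesh with step `dx` and origin `x₀`. -/
def xgrid (x₀ dx : ℝ) (i : ℤ) : ℝ := x₀ + i * dx

/-- `S x` consists of `p + 1` mesh points (given by their indices) that are closest to `x`;
ties may be broken in any way. -/
def IsNearestStencil (x₀ dx : ℝ) (p : ℕ) (S : ℝ → Finset ℤ) : Prop :=
  ∀ x, (S x).card = p + 1 ∧
    ∀ j ∈ S x, ∀ l ∉ S x, |x - xgrid x₀ dx j| ≤ |x - xgrid x₀ dx l|

/-- Piecewise Lagrange interpolation of the mesh function `v`: at `x`, the value of the polynomial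
interpolating `v` at the mesh points of the stencil `S x`. -/
def interp (x₀ dx : ℝ) (S : ℝ → Finset ℤ) (v : ℤ → ℝ) (x : ℝ) : ℝ :=
  (Lagrange.interpolate (S x) (xgrid x₀ dx) v).eval x

/-- Tensor product of the one-dimensional rule with weights `w` and points `a`, applied to
`(e_1, …, e_m) ↦ ψ(x + e_1 + ⋯ + e_m)`. For `m = 0` this is `ψ x`. -/
def tensorQuad {Q : ℕ} (w a : Fin Q → ℝ) (ψ : ℝ → ℝ) (m : ℕ) (x : ℝ) : ℝ :=
  ∑ q : Fin m → Fin Q, (∏ k, w (q k)) * ψ (x + ∑ k, a (q k))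

/-- The expectation over `m` jumps,
`∫ ⋯ ∫ ψ(x + e_1 + ⋯ + e_m) ρ(e_1) ⋯ ρ(e_m) de_1 ⋯ de_m` with `ρ = γ / λ`. -/
def jumpIntegral (lam : ℝ) (γ : ℝ → ℝ) (ψ : ℝ → ℝ) (m : ℕ) (x : ℝ) : ℝ :=
  ∫ e : Fin m → ℝ, ψ (x + ∑ k, e k) * ∏ k, (γ (e k) / lam)

/-- The approximate expectation `Ê_{t_n,M}^x[ψ]`, with at most `M` jumps and quadrature. -/
def approxExp {Q : ℕ} (lam dt : ℝ) (w a : Fin Q → ℝ) (M : ℕ) (ψ : ℝ → ℝ) (x : ℝ) : ℝ :=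
  ∑ m ∈ Finset.range (M + 1),
    Real.exp (-(lam * dt)) * (lam * dt) ^ m / (m.factorial : ℝ) * tensorQuad w a ψ m x

/-- The mesh function `y n i` solves the fully discrete `θ`-scheme with `N` time steps. -/
structure IsFullyDiscreteSolution {Q : ℕ} (θ lam : ℝ) (φ : ℝ → ℝ) (f : ℝ × ℝ × ℝ → ℝ)
    (N : ℕ) (dt x₀ dx : ℝ) (S : ℝ → Finset ℤ) (w a : Fin Q → ℝ) (My Mf : ℕ)
    (y : ℕ → ℤ → ℝ) : Prop where
  terminal : ∀ i, y N i = φ (xgrid x₀ dx i)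
  step : ∀ n < N, ∀ i,
    y n i = approxExp lam dt w a My (interp x₀ dx S (y (n + 1))) (xgrid x₀ dx i)
      + (1 - θ) * dt * approxExp lam dt w a Mf
          (fun x => f (tgrid dt (n + 1), x, interp x₀ dx S (y (n + 1)) x)) (xgrid x₀ dx i)
      + θ * dt * f (tgrid dt n, xgrid x₀ dx i, y n i)

/-- The tensor-product rule integrates `x ↦ ψ n x` over up to `M` jumps with error at most
`K Q^{-r}`, at all mesh points and for all time levels `n + 1`, `n < N`. -/
def QuadratureError {Q : ℕ} (lam : ℝ) (γ : ℝ → ℝ) (N : ℕ) (x₀ dx : ℝ) (w a : Fin Q → ℝ)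
    (K r : ℝ) (M : ℕ) (ψ : ℕ → ℝ → ℝ) : Prop :=
  ∀ n < N, ∀ i : ℤ, ∀ m ∈ Finset.Icc 1 M,
    |jumpIntegral lam γ (ψ (n + 1)) m (xgrid x₀ dx i)
      - tensorQuad w a (ψ (n + 1)) m (xgrid x₀ dx i)| ≤ K * (Q : ℝ) ^ (-r)

end JumpBSDE

end

open scoped BoundedContinuousFunction
noncomputable section

set_option linter.unusedSectionVars false

/-! Because the jump measure has finite mass, the generator `L ψ = ∫ (ψ(· + e) - ψ) γ(e) de` is a
bounded operator on bounded continuous functions. The value function is therefore the solution `v`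
of an ordinary differential equation in a Banach space, `v' = -(L v + F(t, v))` with `v T = φ`,
where `F` is the superposition operator of `f`. All error analysis is done for `v`; probability
enters only through the identity `Y_t = v t x` almost surely.

Time step. Duhamel's formula gives `v(t) = e^{hL} v(t+h) + ∫ e^{(s-t)L} F(s, v(s)) ds`, and the
scheme applies the trapezoidal rule to the integral. Its local error is `O(h^3)` as soon as the
integrand deviates from its chords by `O(h^2)`. This almost affine property is inherited from the
bounded second derivatives of `f` and is stable under products and compositions, so `F` never has to
be differentiated (`norm_trapezoid_sub_le`).

Expectation. `e^{hL}` is the Poisson mixture over the number of jumps. Cutting it after `M` jumps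
costs `(λh)^{M+1}`. In the `Y` term one power of `h` is lost by summing over the steps; in the `f`
term the prefactor `h/2` makes up for it. This explains the exponents `My` and `Mf + 1`.

Stability. Interpolation is exact at mesh points, so the zero-jump term transmits the nodal error
with factor at most one. The terms with a jump, which carry the Lebesgue constant, the weights and
the interpolation error, have a factor `λh` (`abs_evol_gen_sub_approxExp_le`). The error thus obeys
a recursion with amplification `1 + ch`, and a discrete Gronwall argument finishes
(`exists_scheme_error_bound`).

Interpolation. The bound `(Δx)^{p+1}` requires control of `p + 1` space derivatives of `v`. Explicit
Euler iterates for `v` have derivatives bounded independently of the step size, satisfy the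
interpolation estimate, and converge uniformly to `v`; the estimate survives the limit
(`exists_interp_error_bound`).

Identification. The compensated integral is orthogonal to the past and the forward process is Markov
with semigroup `e^{hL}`. Hence `Y_s - v(s, X_s)` is the conditional expectation of the integrated
difference of the generators, and Gronwall's inequality in `L¹` makes it vanish
(`IsBSDESolution.ae_eq`). -/

namespace JumpBSDE

/-! ### The uniformly continuous group generated by a bounded operator -/

section Evolution

variable {E : Type*} [NormedAddCommGroup E] [NormedSpace ℝ E] [CompleteSpace E]

/-- The operator `exp (h L)`. -/
def evol (L : E →L[ℝ] E) (h : ℝ) : E →L[ℝ] E := NormedSpace.exp (h • L)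

lemma evol_zero (L : E →L[ℝ] E) : evol L 0 = 1 := by
  simp [evol, NormedSpace.exp_zero]

lemma evol_add (L : E →L[ℝ] E) (s t : ℝ) : evol L (s + t) = evol L s * evol L t := by
  let : NormedAlgebra ℚ (E →L[ℝ] E) := NormedAlgebra.restrictScalars ℚ ℝ _
  rw [evol, add_smul]
  exact NormedSpace.exp_add_of_commute (((Commute.refl L).smul_left s).smul_right t)

lemma hasDerivAt_evol (L : E →L[ℝ] E) (h : ℝ) : HasDerivAt (evol L) (evol L h * L) h :=
  hasDerivAt_exp_smul_const (𝕂 := ℝ) L h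

lemma hasDerivAt_evol' (L : E →L[ℝ] E) (h : ℝ) : HasDerivAt (evol L) (L * evol L h) h :=
  hasDerivAt_exp_smul_const' (𝕂 := ℝ) L h

lemma evol_mul_neg (L : E →L[ℝ] E) (h : ℝ) : evol L h * evol L (-h) = 1 := by
  rw [← evol_add, add_neg_cancel, evol_zero]

lemma hasSum_evol (L : E →L[ℝ] E) (h : ℝ) :
    HasSum (fun m : ℕ => ((m.factorial : ℝ)⁻¹ * h ^ m) • L ^ m) (evol L h) := by
  have := NormedSpace.exp_series_hasSum_exp' (𝕂 := ℝ) (h • L)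
  refine this.congr_fun fun m => ?_
  rw [smul_pow, smul_smul]

lemma norm_pow_apply_le (L : E →L[ℝ] E) (m : ℕ) (x : E) : ‖(L ^ m) x‖ ≤ ‖L‖ ^ m * ‖x‖ := by
  induction m with
  | zero => simp
  | succ m ih =>
    rw [pow_succ' L]
    calc ‖L ((L ^ m) x)‖ ≤ ‖L‖ * ‖(L ^ m) x‖ := L.le_opNorm _
      _ ≤ ‖L‖ * (‖L‖ ^ m * ‖x‖) := by gcongr
      _ = ‖L‖ ^ (m + 1) * ‖x‖ := by ring

lemma hasSum_real_exp (a : ℝ) : HasSum (fun m : ℕ => (m.factorial : ℝ)⁻¹ * a ^ m) (Real.exp a) := by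
  have := NormedSpace.exp_series_hasSum_exp' (𝕂 := ℝ) a
  rwa [← Real.exp_eq_exp_ℝ] at this

lemma norm_evol_apply_le (L : E →L[ℝ] E) (h : ℝ) (x : E) :
    ‖evol L h x‖ ≤ Real.exp (|h| * ‖L‖) * ‖x‖ := by
  have h1 : HasSum (fun m : ℕ => ((m.factorial : ℝ)⁻¹ * h ^ m) • (L ^ m) x) (evol L h x) :=
    (hasSum_evol L h).mapL (ContinuousLinearMap.apply ℝ E x)
  have h2 := (hasSum_real_exp (|h| * ‖L‖)).mul_right ‖x‖
  refine h1.norm_le_of_bounded h2 fun m => ?_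
  rw [norm_smul, norm_mul, norm_inv, norm_pow, Real.norm_natCast, Real.norm_eq_abs, mul_pow,
    mul_assoc, mul_assoc, mul_assoc]
  gcongr
  exact norm_pow_apply_le L m x

lemma norm_evol_le (L : E →L[ℝ] E) (h : ℝ) : ‖evol L h‖ ≤ Real.exp (|h| * ‖L‖) :=
  ContinuousLinearMap.opNorm_le_bound _ (Real.exp_nonneg _) (norm_evol_apply_le L h)

end Evolution

/-! ### Almost affine functions -/

section AlmostAffine

variable {E F : Type*} [NormedAddCommGroup E] [NormedSpace ℝ E]
  [NormedAddCommGroup F] [NormedSpace ℝ F]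

/-- A function with a Lipschitz derivative deviates from its linear interpolation between two points
by at most a multiple of their squared distance. -/
lemma norm_sub_lineMap_le_of_lipschitz_fderivWithin {f : E → F} {D : E → E →L[ℝ] F} {s : Set E}
    {C : ℝ} (hC : 0 ≤ C) (hs : Convex ℝ s) (hf : ∀ x ∈ s, HasFDerivWithinAt f (D x) s x)
    (hD : ∀ x ∈ s, ∀ y ∈ s, ‖D x - D y‖ ≤ C * ‖x - y‖)
    {a b : E} (ha : a ∈ s) (hb : b ∈ s) {θ : ℝ} (hθ : θ ∈ Icc (0 : ℝ) 1) :
    ‖f ((1 - θ) • a + θ • b) - ((1 - θ) • f a + θ • f b)‖ ≤ C * ‖b - a‖ ^ 2 := by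
  obtain ⟨h0, h1⟩ := hθ
  set m := (1 - θ) • a + θ • b with hm
  have hms : m ∈ s := hs ha hb (by linarith) h0 (by ring)
  -- The linearisation at the intermediate point `m` is accurate to second order at both endpoints.
  -- In the convex combination of the two estimates the terms `D m (a - m)` and `D m (b - m)`
  -- cancel.
  have key : ∀ y ∈ s, ‖y - m‖ ≤ ‖b - a‖ → ‖f y - f m - D m (y - m)‖ ≤ C * ‖b - a‖ ^ 2 := by
    intro y hy hle
    have hseg : segment ℝ m y ⊆ s := hs.segment_subset hms hy
    have := Convex.norm_image_sub_le_of_norm_hasFDerivWithin_le' (f := f) (f' := D) (φ := D m)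
      (s := segment ℝ m y) (x := m) (y := y) (C := C * ‖y - m‖)
      (fun x hx => (hf x (hseg hx)).mono hseg)
      (fun x hx => (hD x (hseg hx) m hms).trans
        (by gcongr; simpa [norm_sub_rev] using norm_sub_le_of_mem_segment hx))
      (convex_segment _ _) (left_mem_segment ℝ _ _) (right_mem_segment ℝ _ _)
    calc _ ≤ C * ‖y - m‖ * ‖y - m‖ := this
      _ ≤ C * ‖b - a‖ * ‖b - a‖ := by gcongr
      _ = _ := by ring
  have ea : a - m = (-θ) • (b - a) := by rw [hm]; module
  have eb : b - m = (1 - θ) • (b - a) := by rw [hm]; module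
  have ka := key a ha (by
    rw [ea, norm_smul, norm_neg, Real.norm_of_nonneg h0]
    exact mul_le_of_le_one_left (norm_nonneg _) h1)
  have kb := key b hb (by
    rw [eb, norm_smul, Real.norm_of_nonneg (by linarith)]
    exact mul_le_of_le_one_left (norm_nonneg _) (by linarith))
  have e : f m - ((1 - θ) • f a + θ • f b)
      = -((1 - θ) • (f a - f m - D m (a - m)) + θ • (f b - f m - D m (b - m))) := by
    rw [ea, eb, map_smul, map_smul]; module
  rw [e, norm_neg]
  calc _ ≤ (1 - θ) * (C * ‖b - a‖ ^ 2) + θ * (C * ‖b - a‖ ^ 2) := by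
        refine (norm_add_le _ _).trans (add_le_add ?_ ?_)
        · rw [norm_smul, Real.norm_of_nonneg (by linarith)]; gcongr
        · rw [norm_smul, Real.norm_of_nonneg h0]; gcongr
    _ = _ := by ring

lemma norm_sub_lineMap_le_of_lipschitz_derivWithin {f f' : ℝ → F} {s : Set ℝ}
    {C : ℝ} (hC : 0 ≤ C) (hs : Convex ℝ s) (hf : ∀ x ∈ s, HasDerivWithinAt f (f' x) s x)
    (hD : ∀ x ∈ s, ∀ y ∈ s, ‖f' x - f' y‖ ≤ C * |x - y|)
    {a b : ℝ} (ha : a ∈ s) (hb : b ∈ s) {θ : ℝ} (hθ : θ ∈ Icc (0 : ℝ) 1) :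
    ‖f ((1 - θ) * a + θ * b) - ((1 - θ) • f a + θ • f b)‖ ≤ C * (b - a) ^ 2 := by
  have := norm_sub_lineMap_le_of_lipschitz_fderivWithin (f := f)
    (D := fun x => ContinuousLinearMap.toSpanSingleton ℝ (f' x)) hC hs
    (fun x hx => (hf x hx).hasFDerivWithinAt)
    (fun x hx y hy => by
      have e : ContinuousLinearMap.toSpanSingleton ℝ (f' x) - ContinuousLinearMap.toSpanSingleton ℝ (f' y)
          = ContinuousLinearMap.toSpanSingleton ℝ (f' x - f' y) := by ext; simp
      rw [e, ContinuousLinearMap.norm_toSpanSingleton]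
      exact hD x hx y hy) ha hb hθ
  simpa using this

end AlmostAffine

/-- A discrete Gronwall inequality. -/
lemma discrete_gronwall {a : ℕ → ℝ} {c h b : ℝ} {n : ℕ} (hc : 0 ≤ c) (hh : 0 ≤ h) (hb : 0 ≤ b)
    (h0 : 0 ≤ a 0) (ha : ∀ k < n, a (k + 1) ≤ (1 + c * h) * a k + h * b) :
    ∀ k ≤ n, a k ≤ Real.exp (c * (k * h)) * (a 0 + k * h * b) := by
  intro k
  induction k with
  | zero => intro _; simp
  | succ k ih =>
    intro hk
    have h1 := ih (by omega)
    have h2 : 1 + c * h ≤ Real.exp (c * h) := by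
      have := Real.add_one_le_exp (c * h); linarith
    have h3 : 1 ≤ Real.exp (c * ((k + 1 : ℕ) * h)) := Real.one_le_exp (by positivity)
    calc a (k + 1) ≤ (1 + c * h) * a k + h * b := ha k (by omega)
      _ ≤ (1 + c * h) * (Real.exp (c * (k * h)) * (a 0 + k * h * b)) + h * b := by gcongr
      _ ≤ Real.exp (c * h) * (Real.exp (c * (k * h)) * (a 0 + k * h * b))
          + Real.exp (c * ((k + 1 : ℕ) * h)) * (h * b) := by
        exact add_le_add (by gcongr) (le_mul_of_one_le_left (by positivity) h3)
      _ = _ := by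
        rw [← mul_assoc, ← Real.exp_add]
        have : c * h + c * (k * h) = c * ((k + 1 : ℕ) * h) := by push_cast; ring
        rw [this]; push_cast; ring

/-! ### Semilinear backward evolution equations -/

section Backward

variable {E : Type*} [NormedAddCommGroup E] [NormedSpace ℝ E] [CompleteSpace E]

/-- The nonlinearity of a semilinear evolution equation: bounded, Lipschitz, and almost affine. -/
structure IsNonlinearity (T B : ℝ) (F : ℝ → E → E) : Prop where
  norm_le : ∀ t ∈ Icc 0 T, ∀ ψ, ‖F t ψ‖ ≤ B
  lipschitz : ∀ s ∈ Icc 0 T, ∀ t ∈ Icc 0 T, ∀ ψ χ, ‖F s ψ - F t χ‖ ≤ B * (|s - t| + ‖ψ - χ‖)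
  affine : ∀ s ∈ Icc 0 T, ∀ t ∈ Icc 0 T, ∀ ψ χ, ∀ θ ∈ Icc (0 : ℝ) 1,
    ‖F ((1 - θ) * s + θ * t) ((1 - θ) • ψ + θ • χ) - ((1 - θ) • F s ψ + θ • F t χ)‖
      ≤ B * (|t - s| + ‖χ - ψ‖) ^ 2

/-- `v` solves `v' = -(L v + F t v)` on `[0, T]` with `v T = φ`, and is bounded by `R`. -/
structure IsBackwardSolution (T : ℝ) (L : E →L[ℝ] E) (F : ℝ → E → E) (φ : E) (R : ℝ)
    (v : ℝ → E) : Prop where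
  terminal : v T = φ
  deriv : ∀ t ∈ Icc 0 T, HasDerivWithinAt v (-(L (v t) + F t (v t))) (Icc 0 T) t
  norm_le : ∀ t ∈ Icc 0 T, ‖v t‖ ≤ R

/-- In the interaction picture `v t = evol L (T - t) (w t)` the linear term disappears. What remains
is an equation for `w` with a globally bounded and Lipschitz right-hand side, solvable on all of
`[0, T]` at once. Negative times of `evol` are available because `L` is bounded. -/
lemma exists_isBackwardSolution {T B Λ : ℝ} (hT : 0 ≤ T) {L : E →L[ℝ] E} (hL : ‖L‖ ≤ Λ)
    {F : ℝ → E → E} (hF : IsNonlinearity T B F) {φ : E} (hφ : ‖φ‖ ≤ B) :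
    ∃ v, IsBackwardSolution T L F φ
      (Real.exp (T * Λ) * (B + T * (Real.exp (T * Λ) * B))) v := by
  have hB : 0 ≤ B := (norm_nonneg _).trans hφ
  have hΛ : 0 ≤ Λ := (norm_nonneg _).trans hL
  set M := Real.exp (T * Λ) with hM
  have hM0 : 0 < M := Real.exp_pos _
  have hS : ∀ s, |s| ≤ T → ∀ x, ‖evol L s x‖ ≤ M * ‖x‖ := fun s hs x =>
    (norm_evol_apply_le L s x).trans (by rw [hM]; gcongr)
  set H : ℝ → E → E := fun t w => -(evol L (-(T - t)) (F t (evol L (T - t) w))) with hH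
  have habs : ∀ t ∈ Icc 0 T, |T - t| ≤ T := fun t ht => by
    rw [abs_of_nonneg (by linarith [ht.2])]; linarith [ht.1]
  have habs' : ∀ t ∈ Icc 0 T, |-(T - t)| ≤ T := fun t ht => by rw [abs_neg]; exact habs t ht
  have hHle : ∀ t ∈ Icc 0 T, ∀ w, ‖H t w‖ ≤ M * B := fun t ht w => by
    rw [hH]; simp only [norm_neg]
    exact (hS _ (habs' t ht) _).trans (by gcongr; exact hF.norm_le t ht _)
  have hcont : Continuous (evol L) :=
    continuous_iff_continuousAt.2 fun h => (hasDerivAt_evol L h).continuousAt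
  have hTm : T ∈ Icc 0 T := ⟨hT, le_rfl⟩
  -- A curve of speed at most `M * B` moves at most `T * (M * B)` in time `T`, so a ball of this
  -- radius is never left and no continuation of local solutions is needed.
  have hPL : IsPicardLindelof H (tmin := 0) (tmax := T) ⟨T, hTm⟩ φ
      (T * (M * B)).toNNReal 0 (M * B).toNNReal (M * B * M).toNNReal := by
    refine ⟨fun t ht => ?_, fun w _ => ?_, fun t ht w _ => ?_, ?_⟩
    · refine LipschitzWith.lipschitzOnWith (LipschitzWith.of_dist_le_mul fun w w' => ?_)
      rw [Real.coe_toNNReal _ (by positivity), dist_eq_norm, dist_eq_norm, hH]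
      simp only
      rw [neg_sub_neg, ← map_sub, norm_sub_rev w w']
      calc _ ≤ M * ‖F t (evol L (T - t) w') - F t (evol L (T - t) w)‖ := hS _ (habs' t ht) _
        _ ≤ M * (B * (|t - t| + ‖evol L (T - t) w' - evol L (T - t) w‖)) := by
          gcongr; exact hF.lipschitz t ht t ht _ _
        _ ≤ M * (B * (|t - t| + M * ‖w' - w‖)) := by
          rw [← map_sub]; gcongr; exact hS _ (habs t ht) _
        _ = _ := by simp; ring
    · refine (ContinuousOn.clm_apply (hcont.comp (by fun_prop)).continuousOn ?_).neg
      have hev : Continuous fun t => evol L (T - t) w :=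
        (hcont.comp (by fun_prop : Continuous fun t : ℝ => T - t)).clm_apply continuous_const
      intro t ht
      rw [ContinuousWithinAt, tendsto_iff_norm_sub_tendsto_zero]
      have hlim : Tendsto (fun s => B * (|s - t| + ‖evol L (T - s) w - evol L (T - t) w‖))
          (𝓝[Icc 0 T] t) (𝓝 0) := by
        have : Continuous fun s => B * (|s - t| + ‖evol L (T - s) w - evol L (T - t) w‖) := by
          fun_prop
        have := (this.tendsto t).mono_left (nhdsWithin_le_nhds (s := Icc 0 T))
        simpa using this
      exact squeeze_zero' (.of_forall fun _ => norm_nonneg _)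
        (eventually_mem_nhdsWithin.mono fun s hs => hF.lipschitz s hs t ht _ _) hlim
    · rw [Real.coe_toNNReal _ (by positivity)]; exact hHle t ht w
    · rw [Real.coe_toNNReal _ (by positivity), Real.coe_toNNReal _ (by positivity)]
      simp [hT]; rw [mul_comm]
  obtain ⟨w, hwT, hw⟩ := hPL.exists_eq_forall_mem_Icc_hasDerivWithinAt₀
  have hwle : ∀ t ∈ Icc 0 T, ‖w t‖ ≤ B + T * (M * B) := fun t ht => by
    have h1 := Convex.norm_image_sub_le_of_norm_hasDerivWithin_le hw
      (fun t ht => hHle t ht (w t)) (convex_Icc 0 T) hTm ht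
    simp only at hwT
    rw [hwT] at h1
    calc ‖w t‖ = ‖φ + (w t - φ)‖ := by congr 1; abel
      _ ≤ ‖φ‖ + ‖w t - φ‖ := norm_add_le _ _
      _ ≤ B + M * B * ‖t - T‖ := add_le_add hφ h1
      _ ≤ B + M * B * T := by
        gcongr; rw [Real.norm_eq_abs, abs_sub_comm]; exact habs t ht
      _ = _ := by ring
  refine ⟨fun t => evol L (T - t) (w t), ?_, fun t ht => ?_, fun t ht => ?_⟩
  · simp only at hwT ⊢
    rw [sub_self, evol_zero, hwT]; rfl
  · have h1 : HasDerivWithinAt (fun t => evol L (T - t)) ((-1 : ℝ) • (L * evol L (T - t)))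
        (Icc 0 T) t :=
      ((hasDerivAt_evol' L (T - t)).scomp t ((hasDerivAt_id t).const_sub T)).hasDerivWithinAt
    have h2 := h1.clm_apply (hw t ht)
    convert h2 using 1
    have h3 : evol L (T - t) (evol L (-(T - t)) (F t (evol L (T - t) (w t))))
        = F t (evol L (T - t) (w t)) := by
      rw [← mul_apply_eq_comp, evol_mul_neg]; rfl
    rw [hH]
    simp only [map_neg, h3]
    simp [add_comm]
  · exact (hS _ (habs t ht) _).trans (by gcongr; exact hwle t ht)

namespace IsBackwardSolution

variable {T B Λ R : ℝ} {L : E →L[ℝ] E} {F : ℝ → E → E} {φ : E} {v : ℝ → E}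

lemma norm_deriv_le (hv : IsBackwardSolution T L F φ R v) (hL : ‖L‖ ≤ Λ)
    (hF : IsNonlinearity T B F) {t : ℝ} (ht : t ∈ Icc 0 T) :
    ‖-(L (v t) + F t (v t))‖ ≤ Λ * R + B := by
  have hΛ : 0 ≤ Λ := (norm_nonneg _).trans hL
  rw [norm_neg]
  refine (norm_add_le _ _).trans (add_le_add ((L.le_opNorm _).trans ?_) (hF.norm_le t ht _))
  gcongr
  exact hv.norm_le t ht

lemma norm_apply_sub_le (hv : IsBackwardSolution T L F φ R v) (hL : ‖L‖ ≤ Λ)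
    (hF : IsNonlinearity T B F) {s t : ℝ} (hs : s ∈ Icc 0 T) (ht : t ∈ Icc 0 T) :
    ‖v s - v t‖ ≤ (Λ * R + B) * |s - t| :=
  Convex.norm_image_sub_le_of_norm_hasDerivWithin_le hv.deriv
    (fun _ hx => hv.norm_deriv_le hL hF hx) (convex_Icc 0 T) ht hs

lemma norm_nonlinearity_sub_le (hv : IsBackwardSolution T L F φ R v) (hL : ‖L‖ ≤ Λ)
    (hF : IsNonlinearity T B F) (hB : 0 ≤ B) {s t : ℝ} (hs : s ∈ Icc 0 T) (ht : t ∈ Icc 0 T) :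
    ‖F s (v s) - F t (v t)‖ ≤ B * (1 + (Λ * R + B)) * |s - t| := by
  calc _ ≤ B * (|s - t| + ‖v s - v t‖) := hF.lipschitz s hs t ht _ _
    _ ≤ B * (|s - t| + (Λ * R + B) * |s - t|) := by gcongr; exact hv.norm_apply_sub_le hL hF hs ht
    _ = _ := by ring

/-- A Lipschitz bound for `v'` replaces a bound on a second time derivative, which need not exist.
-/
lemma norm_deriv_sub_le (hv : IsBackwardSolution T L F φ R v) (hL : ‖L‖ ≤ Λ)
    (hF : IsNonlinearity T B F) (hB : 0 ≤ B) {s t : ℝ} (hs : s ∈ Icc 0 T) (ht : t ∈ Icc 0 T) :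
    ‖-(L (v s) + F s (v s)) - -(L (v t) + F t (v t))‖
      ≤ (Λ * (Λ * R + B) + B * (1 + (Λ * R + B))) * |s - t| := by
  have hΛ : 0 ≤ Λ := (norm_nonneg _).trans hL
  have e : -(L (v s) + F s (v s)) - -(L (v t) + F t (v t))
      = -(L (v s - v t) + (F s (v s) - F t (v t))) := by rw [map_sub]; abel
  rw [e, norm_neg, add_mul]
  refine (norm_add_le _ _).trans
    (add_le_add ((L.le_opNorm _).trans ?_) (hv.norm_nonlinearity_sub_le hL hF hB hs ht))
  rw [mul_assoc]
  exact mul_le_mul hL (hv.norm_apply_sub_le hL hF hs ht) (norm_nonneg _) hΛ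

/-- The local error of the explicit Euler method. -/
lemma norm_euler_sub_le (hv : IsBackwardSolution T L F φ R v) (hL : ‖L‖ ≤ Λ)
    (hF : IsNonlinearity T B F) (hB : 0 ≤ B) (hR : 0 ≤ R)
    {s t : ℝ} (hs : s ∈ Icc 0 T) (ht : t ∈ Icc 0 T) (hst : s ≤ t) :
    ‖v s - (v t + (t - s) • (L (v t) + F t (v t)))‖
      ≤ (Λ * (Λ * R + B) + B * (1 + (Λ * R + B))) * (t - s) ^ 2 := by
  have hΛ : 0 ≤ Λ := (norm_nonneg _).trans hL
  have hsub : Icc s t ⊆ Icc 0 T := Icc_subset_Icc hs.1 ht.2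
  have h1 : ∀ r ∈ Icc s t, HasDerivWithinAt
      (fun r => v r - (r - t) • (-(L (v t) + F t (v t))))
      (-(L (v r) + F r (v r)) - -(L (v t) + F t (v t))) (Icc s t) r := fun r hr => by
    have h2 := (((hasDerivAt_id r).sub_const t).smul_const
      (-(L (v t) + F t (v t)))).hasDerivWithinAt (s := Icc s t)
    rw [one_smul] at h2
    exact ((hv.deriv r (hsub hr)).mono hsub).sub h2
  have h3 := Convex.norm_image_sub_le_of_norm_hasDerivWithin_le h1
    (C := (Λ * (Λ * R + B) + B * (1 + (Λ * R + B))) * (t - s))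
    (fun r hr => (hv.norm_deriv_sub_le hL hF hB (hsub hr) ht).trans (by
      gcongr
      rw [abs_sub_comm, abs_of_nonneg (by linarith [hr.2])]; linarith [hr.1]))
    (convex_Icc s t) (right_mem_Icc.2 hst) (left_mem_Icc.2 hst)
  rw [Real.norm_eq_abs, abs_sub_comm, abs_of_nonneg (by linarith)] at h3
  calc _ = ‖(v s - (s - t) • (-(L (v t) + F t (v t))))
        - (v t - (t - t) • (-(L (v t) + F t (v t))))‖ := by congr 1; module
    _ ≤ _ := h3
    _ = _ := by ring

end IsBackwardSolution
end Backward

/-! ### Local error of the trapezoidal rule and convergence of the Euler method -/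

section Backward

variable {E : Type*} [NormedAddCommGroup E] [NormedSpace ℝ E] [CompleteSpace E]

/-- The iterates of the explicit Euler method with step `h`, backward in time from `t + n h` to
`t`. -/
def eulerIter (L : E →L[ℝ] E) (F : ℝ → E → E) (t₁ h : ℝ) (φ : E) : ℕ → E
  | 0 => φ
  | k + 1 => eulerIter L F t₁ h φ k + h • (L (eulerIter L F t₁ h φ k)
      + F (t₁ - k * h) (eulerIter L F t₁ h φ k))

/-- A product of almost affine factors is almost affine. Its deviation from the chord is `S` applied
to the deviation of `g`, plus the deviation of `S` applied to the chord of `g`, minus `θ(1-θ)(S₁ -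
S₀)(g₁ - g₀)`; in the last term two first-order increments multiply. -/
lemma norm_mul_lineMap_sub_le {S₀ S₁ S : E →L[ℝ] E} {g₀ g₁ g : E} {M B a b c d θ : ℝ}
    (hθ : θ ∈ Icc (0 : ℝ) 1) (hS : ‖S‖ ≤ M)
    (h0 : ‖g₀‖ ≤ B) (h1 : ‖g₁‖ ≤ B) (ha : ‖S₁ - S₀‖ ≤ a) (hb : ‖g₁ - g₀‖ ≤ b)
    (hc : ‖S - ((1 - θ) • S₀ + θ • S₁)‖ ≤ c) (hd : ‖g - ((1 - θ) • g₀ + θ • g₁)‖ ≤ d) :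
    ‖S g - ((1 - θ) • S₀ g₀ + θ • S₁ g₁)‖ ≤ M * d + c * B + a * b := by
  obtain ⟨hθ0, hθ1⟩ := hθ
  have e : S g - ((1 - θ) • S₀ g₀ + θ • S₁ g₁)
      = S (g - ((1 - θ) • g₀ + θ • g₁))
        + (S - ((1 - θ) • S₀ + θ • S₁)) ((1 - θ) • g₀ + θ • g₁)
        - (θ * (1 - θ)) • (S₁ - S₀) (g₁ - g₀) := by
    simp only [map_sub, map_add, map_smul, sub_apply, add_apply, smul_apply]
    module
  have hM : 0 ≤ M := (norm_nonneg _).trans hS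
  have hc0 : 0 ≤ c := (norm_nonneg _).trans hc
  have ha0 : 0 ≤ a := (norm_nonneg _).trans ha
  have hb0 : 0 ≤ b := (norm_nonneg _).trans hb
  rw [e]
  refine (norm_sub_le _ _).trans (add_le_add ((norm_add_le _ _).trans (add_le_add ?_ ?_)) ?_)
  · exact (S.le_opNorm _).trans (by gcongr)
  · refine (ContinuousLinearMap.le_opNorm _ _).trans ?_
    gcongr
    calc _ ≤ (1 - θ) * B + θ * B := by
          refine (norm_add_le _ _).trans (add_le_add ?_ ?_)
          · rw [norm_smul, Real.norm_of_nonneg (by linarith)]; gcongr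
          · rw [norm_smul, Real.norm_of_nonneg hθ0]; gcongr
      _ = B := by ring
  · rw [norm_smul, Real.norm_of_nonneg (mul_nonneg hθ0 (by linarith))]
    calc _ ≤ 1 * (‖S₁ - S₀‖ * ‖g₁ - g₀‖) := by
          gcongr
          · exact mul_le_one₀ hθ1 (by linarith) (by linarith)
          · exact ContinuousLinearMap.le_opNorm _ _
      _ ≤ a * b := by rw [one_mul]; gcongr

namespace IsBackwardSolution

variable {T B Λ R : ℝ} {L : E →L[ℝ] E} {F : ℝ → E → E} {φ : E} {v : ℝ → E}

/-- First `v` at the intermediate time is replaced by its chord, at second-order cost since `v'` is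
Lipschitz; then the almost affine property of `F` applies to the chord. -/
lemma norm_nonlinearity_lineMap_le (hv : IsBackwardSolution T L F φ R v) (hL : ‖L‖ ≤ Λ)
    (hF : IsNonlinearity T B F) (hB : 0 ≤ B) (hR : 0 ≤ R) {a b : ℝ} (ha : a ∈ Icc 0 T)
    (hb : b ∈ Icc 0 T) {θ : ℝ} (hθ : θ ∈ Icc (0 : ℝ) 1) :
    ‖F ((1 - θ) * a + θ * b) (v ((1 - θ) * a + θ * b))
        - ((1 - θ) • F a (v a) + θ • F b (v b))‖
      ≤ (B * (Λ * (Λ * R + B) + B * (1 + (Λ * R + B))) + B * (1 + (Λ * R + B)) ^ 2)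
        * (b - a) ^ 2 := by
  have hΛ : 0 ≤ Λ := (norm_nonneg _).trans hL
  have hm : (1 - θ) * a + θ * b ∈ Icc 0 T :=
    convex_Icc 0 T ha hb (by linarith [hθ.2]) hθ.1 (by ring)
  have h1 := hF.lipschitz _ hm _ hm (v ((1 - θ) * a + θ * b)) ((1 - θ) • v a + θ • v b)
  have h2 := hF.affine a ha b hb (v a) (v b) θ hθ
  have h3 := norm_sub_lineMap_le_of_lipschitz_derivWithin (by positivity) (convex_Icc 0 T) hv.deriv
    (fun x hx y hy => hv.norm_deriv_sub_le hL hF hB hx hy) ha hb hθ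
  have h4 := hv.norm_apply_sub_le hL hF hb ha
  rw [sub_self, abs_zero, zero_add] at h1
  calc _ = ‖(F ((1 - θ) * a + θ * b) (v ((1 - θ) * a + θ * b))
          - F ((1 - θ) * a + θ * b) ((1 - θ) • v a + θ • v b))
          + (F ((1 - θ) * a + θ * b) ((1 - θ) • v a + θ • v b)
            - ((1 - θ) • F a (v a) + θ • F b (v b)))‖ := by congr 1; abel
    _ ≤ _ := norm_add_le _ _
    _ ≤ B * ((Λ * (Λ * R + B) + B * (1 + (Λ * R + B))) * (b - a) ^ 2)
        + B * (|b - a| + (Λ * R + B) * |b - a|) ^ 2 := by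
      refine add_le_add (h1.trans (by gcongr)) (h2.trans (by gcongr))
    _ = _ := by
      have : (|b - a| + (Λ * R + B) * |b - a|) ^ 2 = (1 + (Λ * R + B)) ^ 2 * (b - a) ^ 2 := by
        rw [← sq_abs (b - a)]; ring
      rw [this]; ring

/-- The local error of the trapezoidal rule. -/
lemma norm_trapezoid_sub_le (hv : IsBackwardSolution T L F φ R v) (hL : ‖L‖ ≤ Λ)
    (hF : IsNonlinearity T B F) (hB : 0 ≤ B) (hR : 0 ≤ R) {a h : ℝ} (hh : 0 < h)
    (ha : a ∈ Icc 0 T) (hb : a + h ∈ Icc 0 T) :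
    ‖v a - (evol L h (v (a + h)) + (h / 2) • evol L h (F (a + h) (v (a + h)))
        + (h / 2) • F a (v a))‖
      ≤ (Real.exp (T * Λ) * (B * (Λ * (Λ * R + B) + B * (1 + (Λ * R + B)))
            + B * (1 + (Λ * R + B)) ^ 2) + Real.exp (T * Λ) * Λ * Λ * B
          + Real.exp (T * Λ) * Λ * (B * (1 + (Λ * R + B)))) * h ^ 3 := by
  have hΛ : 0 ≤ Λ := (norm_nonneg _).trans hL
  set M := Real.exp (T * Λ) with hM
  have hM0 : 0 < M := Real.exp_pos _
  set b := a + h with hbdef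
  have hsub : Icc a b ⊆ Icc 0 T := Icc_subset_Icc ha.1 hb.2
  have hS : ∀ s ∈ Icc a b, ‖evol L (s - a)‖ ≤ M := fun s hs => by
    refine (norm_evol_le L _).trans ?_
    rw [hM, abs_of_nonneg (by linarith [hs.1])]
    have := (hsub hs).2
    have hT : 0 ≤ T := ha.1.trans ha.2
    gcongr
    linarith [ha.1]
  have hSd : ∀ s ∈ Icc a b, HasDerivWithinAt (fun s => evol L (s - a)) (evol L (s - a) * L)
      (Icc a b) s := fun s _ => by
    have := ((hasDerivAt_evol L (s - a)).scomp s ((hasDerivAt_id s).sub_const a))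
    rw [one_smul] at this
    exact this.hasDerivWithinAt
  have hSd_le : ∀ s ∈ Icc a b, ‖evol L (s - a) * L‖ ≤ M * Λ := fun s hs =>
    (norm_mul_le _ _).trans (by gcongr; exact hS s hs)
  have hS_lip : ∀ s ∈ Icc a b, ∀ r ∈ Icc a b,
      ‖evol L (s - a) - evol L (r - a)‖ ≤ M * Λ * |s - r| := fun s hs r hr =>
    Convex.norm_image_sub_le_of_norm_hasDerivWithin_le hSd hSd_le (convex_Icc a b) hr hs
  have hab : a ≤ b := by linarith
  have haI : a ∈ Icc a b := left_mem_Icc.2 hab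
  have hbI : b ∈ Icc a b := right_mem_Icc.2 hab
  set G : ℝ → E := fun s => F s (v s) with hG
  -- `g` is the integrand of Duhamel's formula on `[a, b]`; the local error is the trapezoidal error
  -- for its integral.
  set g : ℝ → E := fun s => evol L (s - a) (G s) with hg
  have key : ∀ θ ∈ Icc (0 : ℝ) 1,
      ‖g ((1 - θ) * a + θ * b) - ((1 - θ) • g a + θ • g b)‖
        ≤ (M * (B * (Λ * (Λ * R + B) + B * (1 + (Λ * R + B)))
            + B * (1 + (Λ * R + B)) ^ 2) + M * Λ * Λ * B
          + M * Λ * (B * (1 + (Λ * R + B)))) * h ^ 2 := by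
    intro θ hθ
    have hm : (1 - θ) * a + θ * b ∈ Icc a b :=
      convex_Icc a b haI hbI (by linarith [hθ.2]) hθ.1 (by ring)
    have hba : b - a = h := by rw [hbdef]; ring
    have h1 := norm_sub_lineMap_le_of_lipschitz_derivWithin (C := M * Λ * Λ) (by positivity)
      (convex_Icc a b) hSd (fun s hs r hr => by
        rw [← sub_mul]
        calc _ ≤ ‖evol L (s - a) - evol L (r - a)‖ * ‖L‖ := norm_mul_le _ _
          _ ≤ (M * Λ * |s - r|) * Λ := by gcongr; exact hS_lip s hs r hr
          _ = _ := by ring) haI hbI hθ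
    have h2 := hv.norm_nonlinearity_lineMap_le hL hF hB hR ha hb hθ
    have h3 : ‖evol L (b - a) - evol L (a - a)‖ ≤ M * Λ * h :=
      (hS_lip b hbI a haI).trans_eq (by rw [hba, abs_of_pos hh])
    have h4 := hv.norm_nonlinearity_sub_le hL hF hB hb ha
    rw [hba, abs_of_pos hh] at h4
    refine (norm_mul_lineMap_sub_le hθ (hS _ hm) (hF.norm_le a ha _) (hF.norm_le b hb _) h3 h4 h1
      h2).trans_eq ?_
    rw [hba]; ring
  set Cst := M * (B * (Λ * (Λ * R + B) + B * (1 + (Λ * R + B)))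
            + B * (1 + (Λ * R + B)) ^ 2) + M * Λ * Λ * B + M * Λ * (B * (1 + (Λ * R + B)))
  -- The function `evol L (s - a) (v s)` has derivative `-g`. Adding the primitive of the chord of
  -- `g` leaves minus the deviation of `g` from its chord as derivative, while the increment over
  -- `[a, b]` is, up to sign, exactly the local error.
  have hz : ∀ s ∈ Icc a b, HasDerivWithinAt
      (fun s => evol L (s - a) (v s) + ((s - a) • g a + ((s - a) ^ 2 / (2 * h)) • (g b - g a)))
      (-(g s - ((1 - (s - a) / h) • g a + ((s - a) / h) • g b))) (Icc a b) s := fun s hs => by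
    have h1 := (hSd s hs).clm_apply ((hv.deriv s (hsub hs)).mono hsub)
    have h2 := (((hasDerivAt_id s).sub_const a).smul_const (g a)).hasDerivWithinAt (s := Icc a b)
    have h3 : HasDerivAt (fun s => (s - a) ^ 2 / (2 * h)) ((s - a) / h) s := by
      have := (((hasDerivAt_id s).sub_const a).pow 2).div_const (2 * h)
      refine this.congr_deriv ?_
      simp only [id, Nat.cast_ofNat, Nat.add_one_sub_one, pow_one, mul_one]
      field_simp
    have h4 := (h3.smul_const (g b - g a)).hasDerivWithinAt (s := Icc a b)
    refine (h1.add (h2.add h4)).congr_deriv ?_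
    rw [hg, hG]
    simp only [mul_apply_eq_comp, map_neg, map_add]
    module
  have hfin := Convex.norm_image_sub_le_of_norm_hasDerivWithin_le hz (C := Cst * h ^ 2)
    (fun s hs => by
      have h0 : 0 ≤ (s - a) / h := div_nonneg (by linarith [hs.1]) hh.le
      have h1 : (s - a) / h ≤ 1 := (div_le_one hh).2 (by linarith [hs.2])
      have e : (1 - (s - a) / h) * a + ((s - a) / h) * b = s := by rw [hbdef]; field_simp; ring
      have := key _ ⟨h0, h1⟩
      rw [e] at this
      rwa [norm_neg]) (convex_Icc a b) hbI haI
  have e1 : b - a = h := by rw [hbdef]; ring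
  have e2 : a - b = -h := by rw [hbdef]; ring
  have e3 : h ^ 2 / (2 * h) = h / 2 := by field_simp
  rw [e2, norm_neg, Real.norm_of_nonneg hh.le] at hfin
  simp only [hg, hG, sub_self, e1, evol_zero, e3] at hfin
  calc _ = _ := by
        congr 1
        simp only [one_apply_eq_self]
        module
    _ ≤ _ := hfin
    _ = _ := by ring

/-- Convergence of the explicit Euler method. -/
lemma norm_eulerIter_sub_le (hv : IsBackwardSolution T L F φ R v) (hL : ‖L‖ ≤ Λ)
    (hF : IsNonlinearity T B F) (hB : 0 ≤ B) (hR : 0 ≤ R) {h : ℝ} (hh : 0 ≤ h) {n : ℕ}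
    (hn : n * h ≤ T) :
    ∀ k ≤ n, ‖eulerIter L F T h φ k - v (T - k * h)‖
      ≤ Real.exp ((Λ + B) * T) * T * (Λ * (Λ * R + B) + B * (1 + (Λ * R + B))) * h := by
  have hΛ : 0 ≤ Λ := (norm_nonneg _).trans hL
  have hT : 0 ≤ T := le_trans (by positivity) hn
  have hle : ∀ k ≤ n, (k : ℝ) * h ≤ T := fun k hk => le_trans (by gcongr) hn
  set D := Λ * (Λ * R + B) + B * (1 + (Λ * R + B)) with hD
  have hD0 : 0 ≤ D := by positivity
  have hmem : ∀ k ≤ n, T - k * h ∈ Icc 0 T := fun k hk =>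
    ⟨by linarith [hle k hk], by have : 0 ≤ k * h := by positivity
                                linarith⟩
  have hstep : ∀ k < n, ‖eulerIter L F T h φ (k + 1) - v (T - (k + 1 : ℕ) * h)‖
      ≤ (1 + (Λ + B) * h) * ‖eulerIter L F T h φ k - v (T - k * h)‖ + h * (D * h) := by
    intro k hk
    have ht := hmem k hk.le
    have hs := hmem (k + 1) hk
    set t := T - k * h with htdef
    have hst : T - (k + 1 : ℕ) * h ≤ t := by rw [htdef]; push_cast; linarith
    have h1 := hv.norm_euler_sub_le hL hF hB hR hs ht hst
    have e1 : t - (T - (k + 1 : ℕ) * h) = h := by rw [htdef]; push_cast; ring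
    rw [e1] at h1
    have h2 := hF.lipschitz t ht t ht (eulerIter L F T h φ k) (v t)
    rw [sub_self, abs_zero, zero_add] at h2
    set x := eulerIter L F T h φ k
    have e : eulerIter L F T h φ (k + 1) - v (T - (k + 1 : ℕ) * h)
        = (x - v t) + h • L (x - v t) + h • (F t x - F t (v t))
          - (v (T - (k + 1 : ℕ) * h) - (v t + h • (L (v t) + F t (v t)))) := by
      simp only [eulerIter, map_sub]; module
    rw [e]
    calc _ ≤ ‖x - v t‖ + ‖h • L (x - v t)‖ + ‖h • (F t x - F t (v t))‖
          + ‖v (T - (k + 1 : ℕ) * h) - (v t + h • (L (v t) + F t (v t)))‖ := by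
          refine (norm_sub_le _ _).trans ?_
          gcongr
          exact (norm_add_le _ _).trans (by gcongr; exact norm_add_le _ _)
      _ ≤ ‖x - v t‖ + h * (Λ * ‖x - v t‖) + h * (B * ‖x - v t‖) + D * h ^ 2 := by
          rw [norm_smul, norm_smul, Real.norm_of_nonneg hh]
          gcongr
          exact (L.le_opNorm _).trans (by gcongr)
      _ = _ := by ring
  intro k hk
  have := discrete_gronwall (a := fun k => ‖eulerIter L F T h φ k - v (T - k * h)‖)
    (by positivity) hh (by positivity) (norm_nonneg _) hstep k hk
  refine this.trans ?_
  have h0 : ‖eulerIter L F T h φ 0 - v (T - (0 : ℕ) * h)‖ = 0 := by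
    simp [eulerIter, hv.terminal]
  rw [h0, zero_add]
  calc _ ≤ Real.exp ((Λ + B) * T) * (T * (D * h)) := by
        gcongr
        · exact hle k hk
        · exact hle k hk
    _ = _ := by ring

end IsBackwardSolution
end Backward

/-! ### Convolution operators on bounded continuous functions -/

section ShiftAvg

variable (η : Measure ℝ) [IsFiniteMeasure η]

lemma integrable_comp_add (ψ : ℝ →ᵇ ℝ) (x : ℝ) : Integrable (fun e => ψ (x + e)) η :=
  Integrable.of_bound (by fun_prop) ‖ψ‖ (.of_forall fun _ => ψ.norm_coe_le_norm _)

lemma norm_integral_comp_add_le (ψ : ℝ →ᵇ ℝ) (x : ℝ) :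
    ‖∫ e, ψ (x + e) ∂η‖ ≤ η.real univ * ‖ψ‖ := by
  rw [mul_comm]
  exact norm_integral_le_of_norm_le_const (.of_forall fun _ => ψ.norm_coe_le_norm _)

lemma continuous_integral_comp_add (ψ : ℝ →ᵇ ℝ) : Continuous fun x => ∫ e, ψ (x + e) ∂η :=
  continuous_of_dominated (fun _ => by fun_prop)
    (fun _ => .of_forall fun _ => ψ.norm_coe_le_norm _) (integrable_const ‖ψ‖)
    (.of_forall fun _ => by fun_prop)

/-- The operator `ψ ↦ ∫ ψ(· + e) η(de)`. -/
def shiftAvg : (ℝ →ᵇ ℝ) →L[ℝ] (ℝ →ᵇ ℝ) :=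
  LinearMap.mkContinuous
    { toFun := fun ψ => BoundedContinuousFunction.ofNormedAddCommGroup
        (fun x => ∫ e, ψ (x + e) ∂η) (continuous_integral_comp_add η ψ) (η.real univ * ‖ψ‖)
        (norm_integral_comp_add_le η ψ)
      map_add' := fun ψ χ => by
        ext x
        simpa using integral_add (integrable_comp_add η ψ x) (integrable_comp_add η χ x)
      map_smul' := fun c ψ => by
        ext x
        simpa using integral_const_mul c fun e => ψ (x + e) }
    (η.real univ) fun ψ => BoundedContinuousFunction.norm_ofNormedAddCommGroup_le _ (by positivity)
      (norm_integral_comp_add_le η ψ)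

lemma shiftAvg_apply (ψ : ℝ →ᵇ ℝ) (x : ℝ) : shiftAvg η ψ x = ∫ e, ψ (x + e) ∂η := rfl

lemma norm_shiftAvg_le : ‖shiftAvg η‖ ≤ η.real univ :=
  LinearMap.mkContinuous_norm_le _ measureReal_nonneg _

/-- The generator `ψ ↦ ∫ (ψ(· + e) - ψ) η(de)` of the compound Poisson process with jump
measure `η`. -/
def gen : (ℝ →ᵇ ℝ) →L[ℝ] (ℝ →ᵇ ℝ) := shiftAvg η - η.real univ • 1

lemma norm_gen_le : ‖gen η‖ ≤ 2 * η.real univ := by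
  refine ContinuousLinearMap.opNorm_le_bound _ (by positivity) fun ψ => ?_
  have h1 : ‖η.real univ • ψ‖ = η.real univ * ‖ψ‖ := by
    rw [norm_smul, Real.norm_of_nonneg measureReal_nonneg]
  calc ‖shiftAvg η ψ - η.real univ • ψ‖ ≤ ‖shiftAvg η ψ‖ + ‖η.real univ • ψ‖ := norm_sub_le _ _
    _ ≤ η.real univ * ‖ψ‖ + η.real univ * ‖ψ‖ :=
      add_le_add ((shiftAvg η).le_of_opNorm_le (norm_shiftAvg_le η) ψ) h1.le
    _ = _ := by ring

/-- The scalar part of `gen η` commutes with `shiftAvg η`, so it splits off as the factor `exp(-η(ℝ)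
h)`. The remaining exponential series sorts the semigroup by the number of jumps. -/
lemma hasSum_evol_gen_apply (h : ℝ) (ψ : ℝ →ᵇ ℝ) (x : ℝ) :
    HasSum (fun m : ℕ => Real.exp (-(η.real univ * h)) *
      ((m.factorial : ℝ)⁻¹ * h ^ m * (shiftAvg η ^ m) ψ x)) (evol (gen η) h ψ x) := by
  have h1 : evol (gen η) h = Real.exp (-(η.real univ * h)) • evol (shiftAvg η) h := by
    let : NormedAlgebra ℚ ((ℝ →ᵇ ℝ) →L[ℝ] (ℝ →ᵇ ℝ)) := NormedAlgebra.restrictScalars ℚ ℝ _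
    have e : h • gen η = algebraMap ℝ ((ℝ →ᵇ ℝ) →L[ℝ] (ℝ →ᵇ ℝ)) (-(η.real univ * h))
        + h • shiftAvg η := by
      rw [gen, Algebra.algebraMap_eq_smul_one]; module
    rw [evol, e, NormedSpace.exp_add_of_commute (Algebra.commute_algebraMap_left _ _),
      ← NormedSpace.algebraMap_exp_comm, ← Real.exp_eq_exp_ℝ, Algebra.algebraMap_eq_smul_one,
      smul_mul_assoc, one_mul]
    rfl
  have h2 := ((hasSum_evol (shiftAvg η) h).mapL (ContinuousLinearMap.apply ℝ (ℝ →ᵇ ℝ) ψ)).mapL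
    (BoundedContinuousFunction.evalCLM ℝ x)
  rw [h1]
  exact h2.mul_left _

/-- The semigroup of a compound Poisson process, truncated after `M` jumps. -/
lemma abs_evol_gen_sub_sum_le {h : ℝ} (hh : 0 ≤ h) (ψ : ℝ →ᵇ ℝ) (x : ℝ) (M : ℕ) :
    |evol (gen η) h ψ x - ∑ m ∈ Finset.range M, Real.exp (-(η.real univ * h)) *
      ((m.factorial : ℝ)⁻¹ * h ^ m * (shiftAvg η ^ m) ψ x)| ≤ (η.real univ * h) ^ M * ‖ψ‖ := by
  have h1 := (hasSum_nat_add_iff' M).2 (hasSum_evol_gen_apply η h ψ x)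
  -- Since `1/(m+M)! ≤ 1/m!`, the tail is dominated by `(η(ℝ) h)^M` times a full exponential series,
  -- which the Poisson factor normalises to one. No constant depending on `M` appears.
  have h2 := (((hasSum_real_exp (η.real univ * h)).mul_left
    (Real.exp (-(η.real univ * h)))).mul_left ((η.real univ * h) ^ M)).mul_right ‖ψ‖
  rw [← Real.exp_add, neg_add_cancel, Real.exp_zero, mul_one] at h2
  rw [← Real.norm_eq_abs]
  refine h1.norm_le_of_bounded h2 fun m => ?_
  have hb : |(shiftAvg η ^ (m + M)) ψ x| ≤ η.real univ ^ (m + M) * ‖ψ‖ := by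
    refine (BoundedContinuousFunction.norm_coe_le_norm _ x).trans
      ((norm_pow_apply_le (shiftAvg η) (m + M) ψ).trans ?_)
    have := norm_shiftAvg_le η
    gcongr
  rw [norm_mul, norm_mul, Real.norm_of_nonneg (Real.exp_nonneg _),
    Real.norm_of_nonneg (by positivity), Real.norm_eq_abs]
  calc _ ≤ Real.exp (-(η.real univ * h)) * ((m.factorial : ℝ)⁻¹ * h ^ (m + M)
        * (η.real univ ^ (m + M) * ‖ψ‖)) := by
        gcongr
        exact Nat.le_add_right m M
    _ = _ := by rw [mul_pow, mul_pow, pow_add, pow_add]; ring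

end ShiftAvg

/-! ### The jump measure with a density -/

section JumpMeasure

variable {γ : ℝ → ℝ}

lemma isFiniteMeasure_jumpMeasure (hγi : Integrable γ) : IsFiniteMeasure (jumpMeasure γ) :=
  isFiniteMeasure_withDensity_ofReal hγi.2

lemma jumpMeasure_univ (hγ : ∀ e, 0 ≤ γ e) (hγi : Integrable γ) : jumpMeasure γ univ = ENNReal.ofReal (∫ e, γ e) := by
  rw [jumpMeasure, withDensity_apply _ MeasurableSet.univ, setLIntegral_univ,
    ofReal_integral_eq_lintegral_ofReal hγi (.of_forall hγ)]

lemma integral_jumpMeasure (hγ : ∀ e, 0 ≤ γ e) (hγi : Integrable γ) (g : ℝ → ℝ) : ∫ e, g e ∂jumpMeasure γ = ∫ e, γ e * g e := by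
  rw [jumpMeasure, integral_withDensity_eq_integral_toReal_smul₀
    hγi.aemeasurable.ennreal_ofReal (.of_forall fun _ => ENNReal.ofReal_lt_top)]
  simp [ENNReal.toReal_ofReal (hγ _)]

/-- Fubini's theorem, splitting off one jump at a time. It links the operator powers in the series
to the multiple integrals that the quadrature rule approximates. -/
lemma shiftAvg_pow_apply (hγ : ∀ e, 0 ≤ γ e) (hγi : Integrable γ) [IsFiniteMeasure (jumpMeasure γ)] (ψ : ℝ →ᵇ ℝ) (m : ℕ) (x : ℝ) :
    (shiftAvg (jumpMeasure γ) ^ m) ψ x = ∫ e : Fin m → ℝ, ψ (x + ∑ k, e k) * ∏ k, γ (e k) := by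
  induction m generalizing x with
  | zero => simp [integral_unique, Measure.real, volume_pi]
  | succ m ih =>
    have e1 : (shiftAvg (jumpMeasure γ) ^ (m + 1)) ψ x
        = shiftAvg (jumpMeasure γ) ((shiftAvg (jumpMeasure γ) ^ m) ψ) x := by
      rw [pow_succ']; rfl
    rw [e1, shiftAvg_apply, integral_jumpMeasure hγ hγi]
    simp_rw [ih]
    rw [← (volume_preserving_piFinSuccAbove (fun _ : Fin (m + 1) => ℝ) 0).symm.integral_comp'
      (fun e : Fin (m + 1) → ℝ => ψ (x + ∑ k, e k) * ∏ k, γ (e k)), Measure.volume_eq_prod, integral_prod]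
    · refine integral_congr_ae (.of_forall fun e₀ => ?_)
      simp only [MeasurableEquiv.piFinSuccAbove_symm_apply, Fin.insertNthEquiv_zero,
        Fin.sum_univ_succ, Fin.prod_univ_succ]
      simp only [Fin.consEquiv_apply, Fin.cons_zero, Fin.cons_succ]
      rw [← integral_const_mul]
      refine integral_congr_ae (.of_forall fun e => ?_)
      simp only [add_assoc]
      ring
    · have h1 : Integrable (fun e : Fin (m + 1) → ℝ => ∏ k, γ (e k)) :=
        Integrable.fintype_prod (f := fun _ => γ) fun _ => hγi
      have h2 : Integrable (fun e : Fin (m + 1) → ℝ => ψ (x + ∑ k, e k) * ∏ k, γ (e k)) :=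
        h1.bdd_mul (c := ‖ψ‖) (by fun_prop) (.of_forall fun _ => ψ.norm_coe_le_norm _)
      exact (volume_preserving_piFinSuccAbove
        (fun _ : Fin (m + 1) => ℝ) 0).symm.integrable_comp_of_integrable h2

lemma pow_mul_jumpIntegral (hγ : ∀ e, 0 ≤ γ e) (hγi : Integrable γ) [IsFiniteMeasure (jumpMeasure γ)] {lam : ℝ} (hlam : 0 < lam)
    (ψ : ℝ →ᵇ ℝ) (m : ℕ) (x : ℝ) :
    (shiftAvg (jumpMeasure γ) ^ m) ψ x = lam ^ m * jumpIntegral lam γ ψ m x := by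
  rw [shiftAvg_pow_apply hγ hγi, jumpIntegral, ← integral_const_mul]
  refine integral_congr_ae (.of_forall fun e => ?_)
  simp only [Finset.prod_div_distrib, Finset.prod_const, Finset.card_univ, Fintype.card_fin]
  field_simp

end JumpMeasure

/-! ### Functions with bounded derivatives on the slab -/

lemma uniqueDiffOn_slab {T : ℝ} (hT : 0 < T) :
    UniqueDiffOn ℝ (Icc 0 T ×ˢ (univ : Set (ℝ × ℝ))) :=
  (uniqueDiffOn_Icc hT).prod uniqueDiffOn_univ

lemma convex_slab (T : ℝ) : Convex ℝ (Icc 0 T ×ˢ (univ : Set (ℝ × ℝ))) :=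
  (convex_Icc 0 T).prod convex_univ

section Cb

variable {E : Type*} [NormedAddCommGroup E] [NormedSpace ℝ E] {k : ℕ} {B : ℝ} {D : Set E}
  {f : E → ℝ}

lemma IsCb.abs_le (hf : IsCb k B D f) {x : E} (hx : x ∈ D) : |f x| ≤ B := by
  simpa using hf.2 0 (Nat.zero_le _) x hx

lemma IsCb.hasFDerivWithinAt (hf : IsCb k B D f) (hk : 1 ≤ k) {x : E} (hx : x ∈ D) :
    HasFDerivWithinAt f (fderivWithin ℝ f D x) D x :=
  (hf.1.differentiableOn (by exact_mod_cast (by omega : k ≠ 0)) x hx).hasFDerivWithinAt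

lemma IsCb.norm_fderivWithin_le (hf : IsCb k B D f) (hk : 1 ≤ k) (hD : UniqueDiffOn ℝ D) {x : E}
    (hx : x ∈ D) : ‖fderivWithin ℝ f D x‖ ≤ B := by
  rw [← norm_iteratedFDerivWithin_one f (hD x hx)]
  exact hf.2 1 hk x hx

lemma IsCb.norm_sub_le (hf : IsCb k B D f) (hk : 1 ≤ k) (hD : UniqueDiffOn ℝ D)
    (hc : Convex ℝ D) {x y : E} (hx : x ∈ D) (hy : y ∈ D) : |f x - f y| ≤ B * ‖x - y‖ :=
  hc.norm_image_sub_le_of_norm_hasFDerivWithin_le (fun _ hz => hf.hasFDerivWithinAt hk hz)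
    (fun _ hz => hf.norm_fderivWithin_le hk hD hz) hy hx

lemma IsCb.norm_fderivWithin_sub_le (hf : IsCb k B D f) (hk : 2 ≤ k) (hD : UniqueDiffOn ℝ D)
    (hc : Convex ℝ D) {x y : E} (hx : x ∈ D) (hy : y ∈ D) :
    ‖fderivWithin ℝ f D x - fderivWithin ℝ f D y‖ ≤ B * ‖x - y‖ := by
  have h1 : ContDiffOn ℝ 1 (fderivWithin ℝ f D) D :=
    hf.1.fderivWithin hD (by exact_mod_cast (by omega : 1 + 1 ≤ k))
  refine hc.norm_image_sub_le_of_norm_fderivWithin_le (h1.differentiableOn one_ne_zero)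
    (fun z hz => ?_) hy hx
  rw [← norm_iteratedFDerivWithin_one _ (hD z hz), norm_iteratedFDerivWithin_fderivWithin hD hz]
  exact hf.2 2 hk z hz

/-- Lets the bounds for composite functions be applied to the partial derivatives of `f`, with the
same constant `B` and one order less. -/
lemma IsCb.fderivWithin_apply (hf : IsCb (k + 1) B D f) (hD : UniqueDiffOn ℝ D) {c : E}
    (hc : ‖c‖ ≤ 1) : IsCb k B D fun x => fderivWithin ℝ f D x c := by
  have h1 : ContDiffOn ℝ k (fderivWithin ℝ f D) D :=
    hf.1.fderivWithin hD (by exact_mod_cast le_rfl)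
  refine ⟨h1.clm_apply contDiffOn_const, fun j hj x hx => ?_⟩
  calc _ ≤ ‖c‖ * ‖iteratedFDerivWithin ℝ j (fderivWithin ℝ f D) D x‖ :=
        norm_iteratedFDerivWithin_clm_apply_const (h1 x hx) hD hx (by exact_mod_cast hj)
    _ ≤ 1 * B := by
        rw [norm_iteratedFDerivWithin_fderivWithin hD hx]
        gcongr
        exact hf.2 _ (by omega) x hx
    _ = B := one_mul B

end Cb

/-! ### The Nemytskii operator -/

/-- The Nemytskii operator `ψ ↦ f(t, ·, ψ(·))` on bounded continuous functions. -/
lemma exists_nemytskii {T B : ℝ} (hT : 0 < T) {k : ℕ} (hk : 2 ≤ k) {f : ℝ × ℝ × ℝ → ℝ}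
    (hf : IsCb k B (Icc 0 T ×ˢ univ) f) :
    ∃ F : ℝ → (ℝ →ᵇ ℝ) → (ℝ →ᵇ ℝ), IsNonlinearity T B F ∧
      ∀ t ∈ Icc 0 T, ∀ ψ x, F t ψ x = f (t, x, ψ x) := by
  classical
  have hmem : ∀ t ∈ Icc 0 T, ∀ q : ℝ × ℝ, (t, q) ∈ Icc 0 T ×ˢ (univ : Set (ℝ × ℝ)) :=
    fun t ht q => ⟨ht, mem_univ _⟩
  have hB : 0 ≤ B := (abs_nonneg _).trans (hf.abs_le (hmem 0 ⟨le_rfl, hT.le⟩ 0))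
  have hcont : ∀ t ∈ Icc 0 T, ∀ ψ : ℝ →ᵇ ℝ, Continuous fun x => f (t, x, ψ x) :=
    fun t ht ψ => hf.1.continuousOn.comp_continuous (by fun_prop) fun x => hmem t ht _
  -- Nothing is known about `f` outside `[0, T]`, so the operator is set to zero there.
  refine ⟨fun t ψ => if ht : t ∈ Icc 0 T then
    BoundedContinuousFunction.ofNormedAddCommGroup (fun x => f (t, x, ψ x)) (hcont t ht ψ) B
      (fun x => hf.abs_le (hmem t ht _)) else 0, ?_, fun t ht ψ x => by
      simp only [dif_pos ht]; rfl⟩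
  refine ⟨fun t ht ψ => ?_, fun s hs t ht ψ χ => ?_, fun s hs t ht ψ χ θ hθ => ?_⟩
  · rw [dif_pos ht]
    exact BoundedContinuousFunction.norm_ofNormedAddCommGroup_le _ hB _
  · rw [dif_pos hs, dif_pos ht]
    refine (BoundedContinuousFunction.norm_le (by positivity)).2 fun x => ?_
    refine (hf.norm_sub_le (by omega) (uniqueDiffOn_slab hT) (convex_slab T)
      (hmem s hs _) (hmem t ht _)).trans ?_
    gcongr
    have h1 : |ψ x - χ x| ≤ ‖ψ - χ‖ := (ψ - χ).norm_coe_le_norm x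
    have h2 : 0 ≤ |s - t| := abs_nonneg _
    have h3 : 0 ≤ ‖ψ - χ‖ := norm_nonneg _
    simp only [Prod.mk_sub_mk, sub_self, Prod.norm_def, norm_zero, Real.norm_eq_abs]
    refine max_le (by linarith) (max_le (by linarith) (by linarith))
  · have hm : (1 - θ) * s + θ * t ∈ Icc 0 T :=
      convex_Icc 0 T hs ht (by linarith [hθ.2]) hθ.1 (by ring)
    rw [dif_pos hs, dif_pos ht, dif_pos hm]
    refine (BoundedContinuousFunction.norm_le (by positivity)).2 fun x => ?_
    have h := norm_sub_lineMap_le_of_lipschitz_fderivWithin hB (convex_slab T)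
      (fun z hz => hf.hasFDerivWithinAt (by omega) hz)
      (fun z hz w hw => hf.norm_fderivWithin_sub_le hk (uniqueDiffOn_slab hT) (convex_slab T) hz hw)
      (hmem s hs (x, ψ x)) (hmem t ht (x, χ x)) hθ
    have e : (1 - θ) • (s, x, ψ x) + θ • (t, x, χ x)
        = ((1 - θ) * s + θ * t, x, ((1 - θ) • ψ + θ • χ) x) := by
      ext
      · simp
      · simp; ring
      · simp
    rw [e] at h
    refine h.trans ?_
    gcongr
    have h1 : |χ x - ψ x| ≤ ‖χ - ψ‖ := (χ - ψ).norm_coe_le_norm x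
    have h2 : 0 ≤ |t - s| := abs_nonneg _
    have h3 : 0 ≤ ‖χ - ψ‖ := norm_nonneg _
    simp only [Prod.mk_sub_mk, sub_self, Prod.norm_def, norm_zero, Real.norm_eq_abs]
    refine max_le (by linarith) (max_le (by linarith) (by linarith))

/-! ### Derivatives of composite functions -/

/-- The form `D ^ i` is the one required by the Faà di Bruno estimate
`norm_iteratedFDerivWithin_comp_le`. The condition `1 ≤ D` accommodates the derivative of the
identity component, and order zero is excluded because that component is unbounded. -/
lemma norm_iteratedFDeriv_graph_le {t D : ℝ} (hD : 1 ≤ D) {v : ℝ → ℝ} {m i : ℕ}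
    (hv : ContDiff ℝ m v) (hi : 1 ≤ i) (him : i ≤ m) {x : ℝ} (hx : |iteratedDeriv i v x| ≤ D) :
    ‖iteratedFDeriv ℝ i (fun x => (t, x, v x)) x‖ ≤ D ^ i := by
  have hvi : ContDiffAt ℝ i v x := (hv.of_le (by exact_mod_cast him)).contDiffAt
  rw [iteratedFDeriv_prodMk contDiffAt_const (contDiffAt_fun_id.prodMk hvi) le_rfl,
    ContinuousMultilinearMap.opNorm_prod, iteratedFDeriv_prodMk contDiffAt_fun_id hvi le_rfl,
    ContinuousMultilinearMap.opNorm_prod]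
  have h0 : D ≤ D ^ i := le_self_pow₀ hD (by omega)
  refine max_le ?_ (max_le ?_ ?_)
  · rw [norm_iteratedFDeriv_eq_norm_iteratedDeriv, iteratedDeriv_const, if_neg (by omega)]
    simp only [norm_zero]; positivity
  · rw [norm_iteratedFDeriv_eq_norm_iteratedDeriv]
    change ‖iteratedDeriv i id x‖ ≤ _
    rw [iteratedDeriv_id, if_neg (by omega)]
    split_ifs
    · simpa using hD.trans h0
    · simp only [norm_zero]; positivity
  · rw [norm_iteratedFDeriv_eq_norm_iteratedDeriv]
    exact hx.trans h0

section Comp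

variable {T B : ℝ} {k : ℕ} {f : ℝ × ℝ × ℝ → ℝ}

lemma IsCb.contDiff_comp_graph (hf : IsCb k B (Icc 0 T ×ˢ univ) f) {t : ℝ} (ht : t ∈ Icc 0 T)
    {v : ℝ → ℝ} (hv : ContDiff ℝ k v) : ContDiff ℝ k fun x => f (t, x, v x) := by
  rw [← contDiffOn_univ]
  exact hf.1.comp (t := Icc 0 T ×ˢ univ) (f := fun x => (t, x, v x)) (s := univ)
    (by rw [contDiffOn_univ]; exact contDiff_const.prodMk (contDiff_id.prodMk hv))
    fun x _ => ⟨ht, mem_univ _⟩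

lemma IsCb.abs_iteratedDeriv_comp_graph_le (hT : 0 < T) (hf : IsCb k B (Icc 0 T ×ˢ univ) f)
    {t : ℝ} (ht : t ∈ Icc 0 T) {v : ℝ → ℝ} (hv : ContDiff ℝ k v) {D : ℝ} (hD : 1 ≤ D)
    {n : ℕ} (hn : n ≤ k) {x : ℝ} (hx : ∀ i, 1 ≤ i → i ≤ n → |iteratedDeriv i v x| ≤ D) :
    |iteratedDeriv n (fun x => f (t, x, v x)) x| ≤ n.factorial * B * D ^ n := by
  rw [← Real.norm_eq_abs, ← norm_iteratedFDeriv_eq_norm_iteratedDeriv, ← iteratedFDerivWithin_univ]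
  refine norm_iteratedFDerivWithin_comp_le (f := fun x => (t, x, v x)) (t := Icc 0 T ×ˢ univ) hf.1
    (contDiffOn_univ.2 (contDiff_const.prodMk (contDiff_id.prodMk hv)))
    (by exact_mod_cast hn) (uniqueDiffOn_slab hT) uniqueDiffOn_univ
    (fun x _ => ⟨ht, mem_univ _⟩) (mem_univ x)
    (fun i hi => hf.2 i (hi.trans hn) _ ⟨ht, mem_univ _⟩) fun i hi hin => ?_
  rw [iteratedFDerivWithin_univ]
  exact norm_iteratedFDeriv_graph_le hD hv hi (hin.trans hn) (hx i hi hin)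

/-- The top order derivative of `v` enters that of `f(t, ·, v(·))` linearly. -/
lemma IsCb.abs_iteratedDeriv_succ_comp_graph_le (hT : 0 < T)
    (hf : IsCb k B (Icc 0 T ×ˢ univ) f)
    {t : ℝ} (ht : t ∈ Icc 0 T) {v : ℝ → ℝ} (hv : ContDiff ℝ k v) {D : ℝ} (hD : 1 ≤ D)
    {n : ℕ} (hn : n + 1 ≤ k) {x : ℝ} (hx : ∀ i, 1 ≤ i → i ≤ n → |iteratedDeriv i v x| ≤ D) :
    |iteratedDeriv (n + 1) (fun x => f (t, x, v x)) x| ≤ B * |iteratedDeriv (n + 1) v x|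
      + (n.factorial * B * D ^ n
        + ∑ i ∈ Finset.range n, (n.choose (i + 1)) * ((i + 1).factorial * B * D ^ (i + 1)) * D) := by
  obtain ⟨l, rfl⟩ : ∃ l, k = l + 1 := ⟨k - 1, by omega⟩
  have hnl : n ≤ l := by omega
  have hu := uniqueDiffOn_slab hT
  set S : Set (ℝ × ℝ × ℝ) := Icc 0 T ×ˢ univ with hS
  have hmem : ∀ x, (t, x, v x) ∈ S := fun x => ⟨ht, mem_univ _⟩
  have hfx := hf.fderivWithin_apply hu (c := ((0 : ℝ), (1 : ℝ), (0 : ℝ))) (by simp [Prod.norm_def])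
  have hfy := hf.fderivWithin_apply hu (c := ((0 : ℝ), (0 : ℝ), (1 : ℝ))) (by simp [Prod.norm_def])
  have hvl : ContDiff ℝ l v := hv.of_le (by exact_mod_cast (by omega : l ≤ l + 1))
  have hv' : ContDiff ℝ l (deriv v) :=
    ((contDiff_succ_iff_deriv (n := l)).1 (by exact_mod_cast hv)).2.2
  have hd : deriv (fun x => f (t, x, v x)) = (fun x => fderivWithin ℝ f S (t, x, v x) (0, 1, 0))
      + fun x => fderivWithin ℝ f S (t, x, v x) (0, 0, 1) * deriv v x := by
    ext x
    have h1 : HasDerivAt v (deriv v x) x :=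
      (hv.differentiable (by exact_mod_cast l.succ_ne_zero) x).hasDerivAt
    have h2 : HasDerivWithinAt (fun x => (t, x, v x)) (0, 1, deriv v x) univ x :=
      ((hasDerivAt_const x t).prodMk ((hasDerivAt_id x).prodMk h1)).hasDerivWithinAt
    have h3 := (hf.hasFDerivWithinAt (by omega) (hmem x)).comp_hasDerivWithinAt x h2
      (fun x _ => hmem x)
    rw [hasDerivWithinAt_univ] at h3
    have h4 : (deriv v x • ((0 : ℝ), (0 : ℝ), (1 : ℝ)) + ((0 : ℝ), (1 : ℝ), (0 : ℝ)))
      = (0, 1, deriv v x) := by simp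
    rw [← h4, map_add, map_smul] at h3
    rw [Pi.add_apply, add_comm, mul_comm]
    exact h3.deriv
  have hA : ContDiff ℝ l fun x => fderivWithin ℝ f S (t, x, v x) (0, 1, 0) :=
    hfx.contDiff_comp_graph ht hvl
  have hC : ContDiff ℝ l fun x => fderivWithin ℝ f S (t, x, v x) (0, 0, 1) :=
    hfy.contDiff_comp_graph ht hvl
  have hle : (n : WithTop ℕ∞) ≤ l := by exact_mod_cast hnl
  rw [iteratedDeriv_succ', hd, iteratedDeriv_add (hA.of_le hle).contDiffAt
    ((hC.mul hv').of_le hle).contDiffAt, iteratedDeriv_fun_mul (hC.of_le hle).contDiffAt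
      (hv'.of_le hle).contDiffAt, Finset.sum_range_succ']
  have hA' := hfx.abs_iteratedDeriv_comp_graph_le hT ht hvl hD hnl hx
  have hC' : ∀ i ≤ n, |iteratedDeriv i (fun x => fderivWithin ℝ f S (t, x, v x) (0, 0, 1)) x|
      ≤ i.factorial * B * D ^ i := fun i hi =>
    hfy.abs_iteratedDeriv_comp_graph_le hT ht hvl hD (hi.trans hnl)
      fun j hj hji => hx j hj (hji.trans hi)
  have hB : 0 ≤ B := (abs_nonneg _).trans (hf.abs_le (hmem x))
  -- Of all Leibniz terms for `∂_y f · v'`, only the one with `i = 0` contains the derivative of `v`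
  -- of order `n + 1`, with coefficient `∂_y f`, bounded by `B`.
  have h0 : |(n.choose 0 : ℝ) * iteratedDeriv 0 (fun x => fderivWithin ℝ f S (t, x, v x) (0, 0, 1)) x
      * iteratedDeriv (n - 0) (deriv v) x| ≤ B * |iteratedDeriv (n + 1) v x| := by
    rw [Nat.choose_zero_right, Nat.cast_one, one_mul, Nat.sub_zero, abs_mul, ← iteratedDeriv_succ']
    gcongr
    simpa using hC' 0 (Nat.zero_le _)
  have hs : |∑ i ∈ Finset.range n, (n.choose (i + 1) : ℝ)
      * iteratedDeriv (i + 1) (fun x => fderivWithin ℝ f S (t, x, v x) (0, 0, 1)) x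
      * iteratedDeriv (n - (i + 1)) (deriv v) x|
      ≤ ∑ i ∈ Finset.range n, (n.choose (i + 1)) * ((i + 1).factorial * B * D ^ (i + 1)) * D := by
    refine (Finset.abs_sum_le_sum_abs _ _).trans (Finset.sum_le_sum fun i hi => ?_)
    have hi' : i + 1 ≤ n := Finset.mem_range.1 hi
    rw [abs_mul, abs_mul, Nat.abs_cast, ← iteratedDeriv_succ']
    gcongr
    · exact hC' _ hi'
    · exact hx _ (by omega) (by omega)
  calc _ ≤ _ := abs_add_le _ _
    _ ≤ n.factorial * B * D ^ n + (_ + _) := add_le_add hA' ((abs_add_le _ _).trans (add_le_add hs h0))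
    _ = _ := by ring

end Comp

lemma IsCb.contDiff {k : ℕ} {B : ℝ} {φ : ℝ → ℝ} (hφ : IsCb k B univ φ) : ContDiff ℝ k φ :=
  contDiffOn_univ.1 hφ.1

lemma IsCb.abs_iteratedDeriv_le {k : ℕ} {B : ℝ} {φ : ℝ → ℝ} (hφ : IsCb k B univ φ) {j : ℕ}
    (hj : j ≤ k) (x : ℝ) : |iteratedDeriv j φ x| ≤ B := by
  rw [← Real.norm_eq_abs, ← norm_iteratedFDeriv_eq_norm_iteratedDeriv, ← iteratedFDerivWithin_univ]
  exact hφ.2 j hj x (mem_univ x)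

/-! ### Differentiation under the jump integral -/

section ShiftDeriv

variable (η : Measure ℝ) [IsFiniteMeasure η] {m : ℕ} {v : ℝ → ℝ}

lemma hasDerivAt_integral_comp_add {g g' : ℝ → ℝ} (hg : ∀ x, HasDerivAt g (g' x) x)
    (hg' : Continuous g') {D D' : ℝ} (hD : ∀ x, |g x| ≤ D) (hD' : ∀ x, |g' x| ≤ D') (x : ℝ) :
    HasDerivAt (fun x => ∫ e, g (x + e) ∂η) (∫ e, g' (x + e) ∂η) x := by
  have hgc : Continuous g := continuous_iff_continuousAt.2 fun x => (hg x).continuousAt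
  refine (hasDerivAt_integral_of_dominated_loc_of_deriv_le (F := fun x e => g (x + e))
    (F' := fun x e => g' (x + e)) (bound := fun _ => D') (s := univ) univ_mem
    (.of_forall fun _ => by fun_prop) ?_ (by fun_prop) ?_ (integrable_const _) ?_).2
  · exact Integrable.of_bound (by fun_prop) D (.of_forall fun _ => hD _)
  · exact .of_forall fun e x _ => hD' _
  · refine .of_forall fun e x _ => ?_
    simpa using (hg (x + e)).comp_add_const x e

lemma iteratedDeriv_integral_comp_add (hv : ContDiff ℝ m v)
    (hb : ∀ j ≤ m, ∃ D, ∀ x, |iteratedDeriv j v x| ≤ D) :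
    ∀ j ≤ m, iteratedDeriv j (fun x => ∫ e, v (x + e) ∂η)
      = fun x => ∫ e, iteratedDeriv j v (x + e) ∂η := by
  intro j
  induction j with
  | zero => intro _; simp
  | succ j ih =>
    intro hj
    obtain ⟨D, hD⟩ := hb j (by omega)
    obtain ⟨D', hD'⟩ := hb (j + 1) hj
    rw [iteratedDeriv_succ, ih (by omega)]
    ext x
    refine (hasDerivAt_integral_comp_add η (g' := iteratedDeriv (j + 1) v) (fun x => ?_)
      (hv.continuous_iteratedDeriv _ (by exact_mod_cast hj)) hD hD' x).deriv
    rw [iteratedDeriv_succ]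
    exact (hv.differentiable_iteratedDeriv j (by exact_mod_cast (by omega : j < m)) x).hasDerivAt

lemma contDiff_integral_comp_add (hv : ContDiff ℝ m v)
    (hb : ∀ j ≤ m, ∃ D, ∀ x, |iteratedDeriv j v x| ≤ D) :
    ContDiff ℝ m fun x => ∫ e, v (x + e) ∂η := by
  refine contDiff_nat_iff_iteratedDeriv.2 ⟨fun j hj => ?_, fun j hj => ?_⟩
  · rw [iteratedDeriv_integral_comp_add η hv hb j hj]
    obtain ⟨D, hD⟩ := hb j hj
    have hc : Continuous (iteratedDeriv j v) :=
      hv.continuous_iteratedDeriv _ (by exact_mod_cast hj)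
    exact continuous_integral_comp_add η
      (BoundedContinuousFunction.ofNormedAddCommGroup (iteratedDeriv j v) hc D hD)
  · rw [iteratedDeriv_integral_comp_add η hv hb j hj.le]
    obtain ⟨D, hD⟩ := hb j hj.le
    obtain ⟨D', hD'⟩ := hb (j + 1) hj
    intro x
    refine (hasDerivAt_integral_comp_add η (g' := iteratedDeriv (j + 1) v) (fun x => ?_)
      (hv.continuous_iteratedDeriv _ (by exact_mod_cast hj)) hD hD' x).differentiableAt
    rw [iteratedDeriv_succ]
    exact (hv.differentiable_iteratedDeriv j (by exact_mod_cast hj) x).hasDerivAt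

end ShiftDeriv

/-! ### Regularity of the Euler iterates -/

section Euler

variable {T B lam : ℝ} {k : ℕ} {f : ℝ × ℝ × ℝ → ℝ} {F : ℝ → (ℝ →ᵇ ℝ) → (ℝ →ᵇ ℝ)}
  {η : Measure ℝ} [IsFiniteMeasure η]

lemma eulerStep_apply {t h : ℝ} (hF : ∀ t ∈ Icc 0 T, ∀ ψ x, F t ψ x = f (t, x, ψ x))
    (ht : t ∈ Icc 0 T) (ψ : ℝ →ᵇ ℝ) :
    ⇑(ψ + h • (gen η ψ + F t ψ)) = (fun x => (1 - η.real univ * h) * ψ x)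
      + ((fun x => h * ∫ e, ψ (x + e) ∂η) + fun x => h * f (t, x, ψ x)) := by
  ext x
  have : gen η ψ x = ∫ e, ψ (x + e) ∂η - η.real univ * ψ x := rfl
  simp only [BoundedContinuousFunction.coe_add, BoundedContinuousFunction.coe_smul, Pi.add_apply,
    this, hF t ht, smul_eq_mul]
  ring

/-- Averaging over shifts commutes with differentiation, so the linear part of an Euler step acts on
every derivative as it does on the function itself. The bound `b` for the nonlinear part is left
free, to serve both the crude and the uniform estimates below. -/
lemma abs_iteratedDeriv_eulerStep_le (hf : IsCb k B (Icc 0 T ×ˢ univ) f)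
    (hF : ∀ t ∈ Icc 0 T, ∀ ψ x, F t ψ x = f (t, x, ψ x)) {t h : ℝ} (hh : 0 ≤ h)
    (ht : t ∈ Icc 0 T) {ψ : ℝ →ᵇ ℝ} (hψ : ContDiff ℝ k ψ)
    (hb : ∀ j ≤ k, ∃ D, ∀ x, |iteratedDeriv j ψ x| ≤ D) :
    ContDiff ℝ k ⇑(ψ + h • (gen η ψ + F t ψ)) ∧ ∀ j ≤ k, ∀ a b x,
      (∀ x, |iteratedDeriv j ψ x| ≤ a) → |iteratedDeriv j (fun x => f (t, x, ψ x)) x| ≤ b →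
      |iteratedDeriv j ⇑(ψ + h • (gen η ψ + F t ψ)) x| ≤ (1 + 2 * η.real univ * h) * a + h * b := by
  have h1 : ContDiff ℝ k fun x => (1 - η.real univ * h) * ψ x := contDiff_const.mul hψ
  have hA := contDiff_integral_comp_add η hψ hb
  have h2 : ContDiff ℝ k fun x => h * ∫ e, ψ (x + e) ∂η := contDiff_const.mul hA
  have hC := hf.contDiff_comp_graph ht hψ
  have h3 : ContDiff ℝ k fun x => h * f (t, x, ψ x) := contDiff_const.mul hC
  have h23 : ContDiff ℝ k ((fun x => h * ∫ e, ψ (x + e) ∂η) + fun x => h * f (t, x, ψ x)) :=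
    h2.add h3
  rw [eulerStep_apply hF ht]
  refine ⟨h1.add h23, fun j hj a b x ha hb' => ?_⟩
  have hle : (j : WithTop ℕ∞) ≤ k := by exact_mod_cast hj
  rw [iteratedDeriv_add (h1.of_le hle).contDiffAt (h23.of_le hle).contDiffAt,
    iteratedDeriv_add (h2.of_le hle).contDiffAt (h3.of_le hle).contDiffAt,
    iteratedDeriv_const_mul_field, iteratedDeriv_const_mul_field, iteratedDeriv_const_mul_field,
    iteratedDeriv_integral_comp_add η hψ hb j hj]
  have hη : 0 ≤ η.real univ := measureReal_nonneg
  have hc : |1 - η.real univ * h| ≤ 1 + η.real univ * h := by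
    rw [abs_le]; constructor <;> nlinarith
  have hi : |∫ e, iteratedDeriv j ψ (x + e) ∂η| ≤ a * η.real univ := by
    rw [← Real.norm_eq_abs]
    exact norm_integral_le_of_norm_le_const (.of_forall fun _ => ha _)
  have ha0 : 0 ≤ a := (abs_nonneg _).trans (ha x)
  calc _ ≤ |(1 - η.real univ * h) * iteratedDeriv j ψ x|
        + (|h * ∫ e, iteratedDeriv j ψ (x + e) ∂η|
          + |h * iteratedDeriv j (fun x => f (t, x, ψ x)) x|) :=
        (abs_add_le _ _).trans (by gcongr; exact abs_add_le _ _)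
    _ ≤ (1 + η.real univ * h) * a + (h * (a * η.real univ) + h * b) := by
        rw [abs_mul, abs_mul, abs_mul, abs_of_nonneg hh]
        gcongr
        exact ha x
    _ = _ := by ring

/-- The bounds obtained here may depend on the iterate and the step size; they only justify
differentiating under the integral. -/
lemma contDiff_eulerIter (hT : 0 < T) (hf : IsCb k B (Icc 0 T ×ˢ univ) f)
    (hF : ∀ t ∈ Icc 0 T, ∀ ψ x, F t ψ x = f (t, x, ψ x)) {φ : ℝ →ᵇ ℝ} (hφ : IsCb k B univ φ)
    {h : ℝ} (hh : 0 ≤ h) {n : ℕ} (hn : n * h ≤ T) :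
    ∀ i ≤ n, ContDiff ℝ k ⇑(eulerIter (gen η) F T h φ i) ∧
      ∀ j ≤ k, ∃ D, ∀ x, |iteratedDeriv j ⇑(eulerIter (gen η) F T h φ i) x| ≤ D := by
  intro i
  induction i with
  | zero => exact fun _ => ⟨hφ.contDiff, fun j hj => ⟨B, fun x => hφ.abs_iteratedDeriv_le hj x⟩⟩
  | succ i ih =>
    intro hi
    obtain ⟨h1, h2⟩ := ih (by omega)
    have ht : T - i * h ∈ Icc 0 T := by
      have : (i : ℝ) * h ≤ n * h := by gcongr; omega
      exact ⟨by linarith, by have : 0 ≤ i * h := by positivity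
                             linarith⟩
    obtain ⟨h3, h4⟩ := abs_iteratedDeriv_eulerStep_le (η := η) hf hF hh ht h1 h2
    refine ⟨h3, fun j hj => ?_⟩
    choose! D hD using h2
    obtain ⟨D', hD'1, hD'⟩ : ∃ D', 1 ≤ D' ∧ ∀ i ≤ j, D i ≤ D' := by
      refine ⟨1 + ∑ i ∈ Finset.range (j + 1), |D i|,
        le_add_of_nonneg_right (Finset.sum_nonneg fun _ _ => abs_nonneg _), fun i hi => ?_⟩
      have := Finset.single_le_sum (f := fun i => |D i|) (fun _ _ => abs_nonneg _)
        (Finset.mem_range.2 (by omega : i < j + 1))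
      linarith [le_abs_self (D i)]
    exact ⟨_, fun x => h4 j hj (D j) _ x (hD j hj)
      (hf.abs_iteratedDeriv_comp_graph_le hT ht h1 hD'1 hj
        fun i _ hij => (hD i (hij.trans hj) x).trans (hD' i hij))⟩

/-- Induction on the order of the derivative. Once the lower orders are bounded, the top order
enters `f(t, ·, u(·))` linearly, so the discrete Gronwall inequality bounds it uniformly in the step
size and the number of steps. The constant is chosen before the jump measure, the data and the step.
-/
lemma exists_bound_iteratedDeriv_eulerIter (hT : 0 < T) (hlam : 0 ≤ lam) (B : ℝ) (k : ℕ) :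
    ∀ m ≤ k, ∃ D : ℝ, 1 ≤ D ∧ ∀ (η : Measure ℝ) [IsFiniteMeasure η] (f : ℝ × ℝ × ℝ → ℝ)
      (F : ℝ → (ℝ →ᵇ ℝ) → (ℝ →ᵇ ℝ)) (φ : ℝ →ᵇ ℝ) (h : ℝ) (n : ℕ), η.real univ = lam →
      IsCb k B (Icc 0 T ×ˢ univ) f → (∀ t ∈ Icc 0 T, ∀ ψ x, F t ψ x = f (t, x, ψ x)) →
      IsCb k B univ φ → 0 ≤ h → n * h ≤ T →
      ∀ i ≤ n, ∀ j ≤ m, ∀ x, |iteratedDeriv j ⇑(eulerIter (gen η) F T h φ i) x| ≤ D := by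
  have key : ∀ m ≤ k, ∀ c ≥ (0 : ℝ), ∀ K ≥ (0 : ℝ), ∀ (η : Measure ℝ) [IsFiniteMeasure η]
      (f : ℝ × ℝ × ℝ → ℝ) (F : ℝ → (ℝ →ᵇ ℝ) → (ℝ →ᵇ ℝ)) (φ : ℝ →ᵇ ℝ) (h : ℝ) (n : ℕ),
      η.real univ = lam →
      IsCb k B (Icc 0 T ×ˢ univ) f → (∀ t ∈ Icc 0 T, ∀ ψ x, F t ψ x = f (t, x, ψ x)) →
      IsCb k B univ φ → 0 ≤ h → n * h ≤ T →
      (∀ i ≤ n, ∀ t ∈ Icc 0 T, ∀ x, |iteratedDeriv m (fun x => f (t, x, eulerIter (gen η) F T h φ i x)) x|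
        ≤ c * |iteratedDeriv m ⇑(eulerIter (gen η) F T h φ i) x| + K) →
      ∀ i ≤ n, ∀ x, |iteratedDeriv m ⇑(eulerIter (gen η) F T h φ i) x|
        ≤ Real.exp ((2 * lam + c) * T) * (B + T * K) := by
    intro m hm c hc K hK η _ f F φ h n hη hf hF hφ hh hn hstep
    have hB : 0 ≤ B := (abs_nonneg _).trans (hφ.abs_le (mem_univ 0))
    -- The sequence `b` solves the recursion for the bound with equality and dominates the
    -- derivative of order `m` at every point.
    set b : ℕ → ℝ := fun i => Nat.rec B (fun _ a => (1 + (2 * lam + c) * h) * a + h * K) i with hb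
    have hb1 : ∀ i, b (i + 1) = (1 + (2 * lam + c) * h) * b i + h * K := fun i => rfl
    have h1 : ∀ i ≤ n, ∀ x, |iteratedDeriv m ⇑(eulerIter (gen η) F T h φ i) x| ≤ b i := by
      intro i
      induction i with
      | zero => exact fun _ x => hφ.abs_iteratedDeriv_le hm x
      | succ i ih =>
        intro hi x
        have hi' := ih (by omega)
        obtain ⟨hs1, hs2⟩ := contDiff_eulerIter (η := η) hT hf hF hφ hh hn i (by omega)
        have ht : T - i * h ∈ Icc 0 T := by
          have : (i : ℝ) * h ≤ n * h := by gcongr; omega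
          exact ⟨by linarith, by have : 0 ≤ i * h := by positivity
                                 linarith⟩
        have := (abs_iteratedDeriv_eulerStep_le (η := η) hf hF hh ht hs1 hs2).2 m hm (b i)
          (c * b i + K) x hi' ((hstep i (by omega) _ ht x).trans (by gcongr; exact hi' x))
        rw [hη] at this
        refine this.trans_eq ?_
        rw [hb1]; ring
    intro i hi x
    refine (h1 i hi x).trans ?_
    have h2 := discrete_gronwall (a := b) (c := 2 * lam + c) (h := h) (b := K) (n := n)
      (by positivity) hh hK hB (fun i _ => (hb1 i).le) i hi
    have h3 : (i : ℝ) * h ≤ T := le_trans (by gcongr) hn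
    have hb0 : b 0 = B := rfl
    rw [hb0] at h2
    exact h2.trans (by gcongr)
  intro m
  induction m with
  | zero =>
    intro hm
    refine ⟨1 + |Real.exp ((2 * lam + 0) * T) * (B + T * |B|)|,
      le_add_of_nonneg_right (abs_nonneg _), ?_⟩
    intro η _ f F φ h n hη hf hF hφ hh hn i hi j hj x
    obtain rfl : j = 0 := by omega
    -- For order zero `f` is simply bounded, so there is no linear contribution and `c = 0`.
    have := key 0 hm 0 le_rfl |B| (abs_nonneg _) η f F φ h n hη hf hF hφ hh hn
      (fun i _ t ht x => by
        rw [zero_mul, zero_add, iteratedDeriv_zero]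
        exact (hf.abs_le ⟨ht, mem_univ _⟩).trans (le_abs_self B)) i hi x
    linarith [le_abs_self (Real.exp ((2 * lam + 0) * T) * (B + T * |B|))]
  | succ m ih =>
    intro hm
    obtain ⟨D, hD1, hD⟩ := ih (by omega)
    set K := m.factorial * B * D ^ m
        + ∑ i ∈ Finset.range m, (m.choose (i + 1)) * ((i + 1).factorial * B * D ^ (i + 1)) * D
      with hK
    set D' := Real.exp ((2 * lam + |B|) * T) * (B + T * |K|)
    refine ⟨D + |D'|, by linarith [abs_nonneg D'], ?_⟩
    intro η _ f F φ h n hη hf hF hφ hh hn i hi j hj x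
    have hB : 0 ≤ B := (abs_nonneg _).trans (hφ.abs_le (mem_univ 0))
    rcases hj.lt_or_eq with hj | rfl
    · linarith [hD η f F φ h n hη hf hF hφ hh hn i hi j (by omega) x, abs_nonneg D']
    · have := key (m + 1) hm |B| (abs_nonneg _) |K| (abs_nonneg _) η f F φ h n hη hf hF hφ hh hn
        (fun i hi t ht x => by
          rw [abs_of_nonneg hB]
          refine (hf.abs_iteratedDeriv_succ_comp_graph_le hT ht
            (contDiff_eulerIter (η := η) hT hf hF hφ hh hn i hi).1 hD1 hm
            fun j _ hj => hD η f F φ h n hη hf hF hφ hh hn i hi j hj x).trans ?_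
          gcongr
          exact le_abs_self K) i hi x
      linarith [le_abs_self D']

end Euler

/-! ### Piecewise Lagrange interpolation -/

section Interp

variable {x₀ dx : ℝ} {p : ℕ} {S : ℝ → Finset ℤ}

lemma xgrid_sub_xgrid (x₀ dx : ℝ) (i j : ℤ) :
    xgrid x₀ dx i - xgrid x₀ dx j = ((i - j : ℤ) : ℝ) * dx := by
  simp only [xgrid]; push_cast; ring

lemma xgrid_injective (x₀ : ℝ) (hdx : 0 < dx) : Function.Injective (xgrid x₀ dx) := by
  intro i j h
  have h1 := xgrid_sub_xgrid x₀ dx i j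
  rw [h, sub_self, eq_comm, mul_eq_zero, or_iff_left hdx.ne', Int.cast_eq_zero] at h1
  omega

lemma le_abs_xgrid_sub_xgrid (x₀ : ℝ) (hdx : 0 < dx) {i j : ℤ} (hij : i ≠ j) :
    dx ≤ |xgrid x₀ dx i - xgrid x₀ dx j| := by
  rw [xgrid_sub_xgrid, abs_mul, abs_of_pos hdx]
  refine le_mul_of_one_le_left hdx.le ?_
  rw [← Int.cast_abs]
  exact_mod_cast Int.one_le_abs (sub_ne_zero.2 hij)

/-- Among `p + 2` consecutive mesh points starting just left of `x`, one is not in the stencil. It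
lies within `(p + 1) * dx` of `x`, and stencil points are no farther away. -/
lemma IsNearestStencil.abs_sub_le (hS : IsNearestStencil x₀ dx p S) (hdx : 0 < dx) {x : ℝ} {j : ℤ}
    (hj : j ∈ S x) : |x - xgrid x₀ dx j| ≤ (p + 1) * dx := by
  set i := ⌊(x - x₀) / dx⌋ with hi
  have hcard : (S x).card < (Finset.Icc i (i + (p + 1))).card := by
    rw [(hS x).1, Int.card_Icc]; omega
  obtain ⟨l, hl, hlS⟩ := Finset.exists_mem_notMem_of_card_lt_card hcard
  refine ((hS x).2 j hj l hlS).trans ?_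
  rw [Finset.mem_Icc] at hl
  have h1 : (i : ℝ) ≤ (x - x₀) / dx := Int.floor_le _
  have h2 : (x - x₀) / dx < i + 1 := Int.lt_floor_add_one _
  have h3 : (i : ℝ) ≤ l := by exact_mod_cast hl.1
  have h4 : (l : ℝ) ≤ i + (p + 1) := by exact_mod_cast hl.2
  have e : x - xgrid x₀ dx l = ((x - x₀) / dx - l) * dx := by
    rw [xgrid]; field_simp; ring
  rw [e, abs_mul, abs_of_pos hdx]
  gcongr
  have : (0 : ℝ) ≤ p := Nat.cast_nonneg p
  rw [abs_le]
  constructor <;> linarith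

lemma IsNearestStencil.mem_xgrid (hS : IsNearestStencil x₀ dx p S) (hdx : 0 < dx) (i : ℤ) :
    i ∈ S (xgrid x₀ dx i) := by
  by_contra hi
  obtain ⟨j, hj⟩ : (S (xgrid x₀ dx i)).Nonempty := by
    rw [← Finset.card_pos, (hS _).1]; omega
  have h1 := (hS _).2 j hj i hi
  rw [sub_self, abs_zero, abs_nonpos_iff, sub_eq_zero] at h1
  exact hi (xgrid_injective x₀ hdx h1 ▸ hj)

/-- A mesh point has distance zero to itself and so belongs to its own stencil. This exactness keeps
the Lebesgue constant out of the zero-jump term, where it would be amplified from step to step. -/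
lemma interp_xgrid (hS : IsNearestStencil x₀ dx p S) (hdx : 0 < dx) (v : ℤ → ℝ) (i : ℤ) :
    interp x₀ dx S v (xgrid x₀ dx i) = v i :=
  Lagrange.eval_interpolate_at_node _ (xgrid_injective x₀ hdx).injOn (hS.mem_xgrid hdx i)

lemma interp_apply (v : ℤ → ℝ) (x : ℝ) : interp x₀ dx S v x
    = ∑ i ∈ S x, v i * (Lagrange.basis (S x) (xgrid x₀ dx) i).eval x := by
  simp [interp, Lagrange.interpolate_apply, Polynomial.eval_finsetSum]

/-- Each of the `p` factors is a quotient with numerator at most `(p + 1) * dx` and denominator at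
least `dx`. -/
lemma IsNearestStencil.abs_eval_basis_le (hS : IsNearestStencil x₀ dx p S) (hdx : 0 < dx) {x : ℝ}
    {i : ℤ} (hi : i ∈ S x) :
    |(Lagrange.basis (S x) (xgrid x₀ dx) i).eval x| ≤ (p + 1 : ℝ) ^ p := by
  have hc : ((S x).erase i).card = p := by rw [Finset.card_erase_of_mem hi, (hS x).1]; omega
  rw [Lagrange.basis, Polynomial.eval_prod, Finset.abs_prod]
  calc _ ≤ ∏ _j ∈ (S x).erase i, (p + 1 : ℝ) := by
        refine Finset.prod_le_prod (fun _ _ => abs_nonneg _) fun j hj => ?_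
        rw [Finset.mem_erase] at hj
        simp only [Lagrange.basisDivisor, Polynomial.eval_mul, Polynomial.eval_C,
          Polynomial.eval_sub, Polynomial.eval_X, abs_mul, abs_inv]
        rw [inv_mul_le_iff₀ (hdx.trans_le (le_abs_xgrid_sub_xgrid x₀ hdx hj.1.symm)), mul_comm]
        refine (hS.abs_sub_le hdx hj.2).trans ?_
        gcongr
        exact le_abs_xgrid_sub_xgrid x₀ hdx hj.1.symm
    _ = _ := by rw [Finset.prod_const, hc]

/-- Stability of piecewise Lagrange interpolation. -/
lemma IsNearestStencil.abs_interp_le (hS : IsNearestStencil x₀ dx p S) (hdx : 0 < dx) {x : ℝ}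
    {v : ℤ → ℝ} {M : ℝ} (hv : ∀ i ∈ S x, |v i| ≤ M) :
    |interp x₀ dx S v x| ≤ (p + 1 : ℝ) ^ (p + 1) * M := by
  rw [interp_apply]
  calc _ ≤ ∑ i ∈ S x, |v i * (Lagrange.basis (S x) (xgrid x₀ dx) i).eval x| :=
        Finset.abs_sum_le_sum_abs _ _
    _ ≤ ∑ _i ∈ S x, M * (p + 1 : ℝ) ^ p := by
        refine Finset.sum_le_sum fun i hi => ?_
        rw [abs_mul]
        have := hv i hi
        have := hS.abs_eval_basis_le hdx hi
        gcongr
        exact (abs_nonneg _).trans (hv i hi)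
    _ = _ := by rw [Finset.sum_const, (hS x).1, nsmul_eq_mul]; push_cast; ring

lemma interp_sub (v w : ℤ → ℝ) (x : ℝ) :
    interp x₀ dx S (fun i => v i - w i) x = interp x₀ dx S v x - interp x₀ dx S w x := by
  simp only [interp_apply, sub_mul, Finset.sum_sub_distrib]

/-- The Taylor polynomial of `v` at `x`. -/
def taylorPoly (v : ℝ → ℝ) (p : ℕ) (x : ℝ) : Polynomial ℝ :=
  ∑ k ∈ Finset.range (p + 1), Polynomial.C ((k.factorial : ℝ)⁻¹ * iteratedDeriv k v x)
    * (Polynomial.X - Polynomial.C x) ^ k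

lemma degree_taylorPoly_lt (v : ℝ → ℝ) (p : ℕ) (x : ℝ) :
    (taylorPoly v p x).degree < (p + 1 : ℕ) := by
  rw [taylorPoly]
  refine (Polynomial.degree_sum_le _ _).trans_lt
    ((Finset.sup_lt_iff (WithBot.bot_lt_coe _)).2 fun k hk => ?_)
  rw [Polynomial.C_mul']
  refine (Polynomial.degree_smul_le _ _).trans_lt ?_
  rw [Polynomial.degree_pow, Polynomial.degree_X_sub_C, nsmul_one]
  exact_mod_cast Finset.mem_range.1 hk

lemma abs_sub_taylorPoly_le {v : ℝ → ℝ} {D : ℝ} (hv : ContDiff ℝ (p + 1 : ℕ) v)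
    (hD : ∀ x, |iteratedDeriv (p + 1) v x| ≤ D) (x y : ℝ) :
    |v y - (taylorPoly v p x).eval y| ≤ D * |y - x| ^ (p + 1) := by
  have e0 : (taylorPoly v p x).eval y
      = ∑ k ∈ Finset.range (p + 1), ((k.factorial : ℝ)⁻¹ * (y - x) ^ k) • iteratedDeriv k v x := by
    simp only [taylorPoly, Polynomial.eval_finsetSum, Polynomial.eval_mul, Polynomial.eval_C,
      Polynomial.eval_pow, Polynomial.eval_sub, Polynomial.eval_X, smul_eq_mul]
    exact Finset.sum_congr rfl fun k _ => by ring
  rcases eq_or_ne x y with rfl | hxy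
  · rw [e0, Finset.sum_range_succ']
    simp
  · obtain ⟨z, -, hz⟩ := taylor_mean_remainder_lagrange_iteratedDeriv (n := p) hxy
      (by exact_mod_cast hv.contDiffOn)
    have e1 : taylorWithinEval v p (uIcc x y) x y = (taylorPoly v p x).eval y := by
      rw [taylor_within_apply, e0]
      refine Finset.sum_congr rfl fun k hk => ?_
      rw [iteratedDerivWithin_eq_iteratedDeriv (uniqueDiffOn_uIcc hxy)
        (hv.of_le (by exact_mod_cast (Finset.mem_range.1 hk).le)).contDiffAt left_mem_uIcc]
    rw [← e1, hz, abs_div, abs_mul, abs_pow, Nat.abs_cast]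
    have hD0 : 0 ≤ D := (abs_nonneg _).trans (hD x)
    refine (div_le_self (by positivity) (by exact_mod_cast Nat.factorial_pos _)).trans ?_
    gcongr
    exact hD z

/-- The error of piecewise Lagrange interpolation. -/
lemma IsNearestStencil.abs_sub_interp_le (hS : IsNearestStencil x₀ dx p S) (hdx : 0 < dx)
    {v : ℝ → ℝ} {D : ℝ} (hv : ContDiff ℝ (p + 1 : ℕ) v)
    (hD : ∀ x, |iteratedDeriv (p + 1) v x| ≤ D) (x : ℝ) :
    |v x - interp x₀ dx S (fun i => v (xgrid x₀ dx i)) x|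
      ≤ (p + 1 : ℝ) ^ (p + 1) * (D * (p + 1) ^ (p + 1)) * dx ^ (p + 1) := by
  have hD0 : 0 ≤ D := (abs_nonneg _).trans (hD x)
  set P := taylorPoly v p x
  have hPdeg : P.degree < (S x).card := by
    rw [(hS x).1]; exact degree_taylorPoly_lt v p x
  -- Interpolation reproduces the Taylor polynomial `P` at `x`, and `P` agrees with `v` at `x`. The
  -- error is thus minus the interpolant of `v - P`, to which the stability bound applies.
  have h1 : interp x₀ dx S (fun i => P.eval (xgrid x₀ dx i)) x = P.eval x := by
    rw [interp, ← Lagrange.eq_interpolate (xgrid_injective x₀ hdx).injOn hPdeg]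
  have h2 : P.eval x = v x := by
    have := abs_sub_taylorPoly_le hv hD x x
    rw [sub_self, abs_zero, zero_pow (by omega), mul_zero, abs_nonpos_iff, sub_eq_zero] at this
    exact this.symm
  have h3 : v x - interp x₀ dx S (fun i => v (xgrid x₀ dx i)) x
      = -interp x₀ dx S (fun i => v (xgrid x₀ dx i) - P.eval (xgrid x₀ dx i)) x := by
    rw [interp_sub, h1, h2]; ring
  rw [h3, abs_neg]
  calc _ ≤ (p + 1 : ℝ) ^ (p + 1) * (D * ((p + 1) * dx) ^ (p + 1)) := by
        refine hS.abs_interp_le hdx fun i hi => (abs_sub_taylorPoly_le hv hD x _).trans ?_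
        gcongr
        rw [abs_sub_comm]
        exact hS.abs_sub_le hdx hi
    _ = _ := by rw [mul_pow]; ring

lemma tendsto_interp {ι : Type*} {l : Filter ι} {w : ι → ℤ → ℝ} {v : ℤ → ℝ}
    (h : ∀ i, Tendsto (fun n => w n i) l (𝓝 (v i))) (x : ℝ) :
    Tendsto (fun n => interp x₀ dx S (w n) x) l (𝓝 (interp x₀ dx S v x)) := by
  simp only [interp_apply]
  exact tendsto_finsetSum _ fun i _ => (h i).mul_const _

end Interp

/-- The interpolation error of the solution of the backward equation. -/
lemma exists_interp_error_bound {T lam : ℝ} (hT : 0 < T) (hlam : 0 ≤ lam) (B R : ℝ) (p : ℕ) :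
    ∃ C : ℝ, 0 ≤ C ∧ ∀ (η : Measure ℝ) [IsFiniteMeasure η] (f : ℝ × ℝ × ℝ → ℝ)
      (F : ℝ → (ℝ →ᵇ ℝ) → (ℝ →ᵇ ℝ)) (φ : ℝ →ᵇ ℝ) (v : ℝ → ℝ →ᵇ ℝ), η.real univ = lam →
      IsCb (max 2 (p + 1)) B (Icc 0 T ×ˢ univ) f → IsNonlinearity T B F →
      (∀ t ∈ Icc 0 T, ∀ ψ x, F t ψ x = f (t, x, ψ x)) → IsCb (max 2 (p + 1)) B univ φ →
      IsBackwardSolution T (gen η) F φ R v →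
      ∀ (x₀ dx : ℝ) (S : ℝ → Finset ℤ), 0 < dx → IsNearestStencil x₀ dx p S →
      ∀ t ∈ Icc 0 T, ∀ x,
        |v t x - interp x₀ dx S (fun i => v t (xgrid x₀ dx i)) x| ≤ C * dx ^ (p + 1) := by
  obtain ⟨D, hD1, hD⟩ := exists_bound_iteratedDeriv_eulerIter hT hlam B (max 2 (p + 1)) (p + 1)
    (le_max_right _ _)
  refine ⟨(p + 1 : ℝ) ^ (p + 1) * (D * (p + 1) ^ (p + 1)), by positivity, ?_⟩
  intro η _ f F φ v hη hf hFn hF hφ hv x₀ dx S hdx hS t ht x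
  have hB : 0 ≤ B := (abs_nonneg _).trans (hφ.abs_le (mem_univ 0))
  have hR : 0 ≤ R := (norm_nonneg _).trans (hv.norm_le t ht)
  -- With this step, `n + 1` Euler steps lead from `T` exactly to `t`.
  set h : ℕ → ℝ := fun n => (T - t) / (n + 1) with hh
  have hh0 : ∀ n, 0 ≤ h n := fun n => div_nonneg (by linarith [ht.2]) (by positivity)
  have hnh : ∀ n : ℕ, ((n + 1 : ℕ) : ℝ) * h n = T - t := fun n => by
    rw [hh]; push_cast; field_simp
  have hnT : ∀ n : ℕ, ((n + 1 : ℕ) : ℝ) * h n ≤ T := fun n => by rw [hnh]; linarith [ht.1]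
  set w : ℕ → ℝ →ᵇ ℝ := fun n => eulerIter (gen η) F T (h n) φ (n + 1) with hw
  have herr : ∀ n x, |w n x - interp x₀ dx S (fun i => w n (xgrid x₀ dx i)) x|
      ≤ (p + 1 : ℝ) ^ (p + 1) * (D * (p + 1) ^ (p + 1)) * dx ^ (p + 1) := fun n x => by
    refine hS.abs_sub_interp_le hdx ?_ (fun x => ?_) x
    · exact (contDiff_eulerIter (η := η) hT hf hF hφ (hh0 n) (hnT n) (n + 1) le_rfl).1.of_le
        (by exact_mod_cast le_max_right _ _)
    · exact hD η f F φ (h n) (n + 1) hη hf hF hφ (hh0 n) (hnT n) (n + 1) le_rfl _ le_rfl x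
  have hlim : Tendsto w atTop (𝓝 (v t)) := by
    rw [tendsto_iff_norm_sub_tendsto_zero]
    have h1 : Tendsto h atTop (𝓝 0) := tendsto_const_div_atTop_nhds_zero_nat (T - t) |>.comp
      (tendsto_add_atTop_nat 1) |>.congr fun n => by simp [hh]
    set Λ := 2 * η.real univ
    have h2 := h1.const_mul (Real.exp ((Λ + B) * T) * T
      * (Λ * (Λ * R + B) + B * (1 + (Λ * R + B))))
    rw [mul_zero] at h2
    refine squeeze_zero (fun _ => norm_nonneg _) (fun n => ?_) h2
    have := hv.norm_eulerIter_sub_le (norm_gen_le η) hFn hB hR (hh0 n) (hnT n) (n + 1) le_rfl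
    rw [hnh, sub_sub_cancel] at this
    exact this
  have hpt : ∀ x, Tendsto (fun n => w n x) atTop (𝓝 (v t x)) := fun x =>
    ((BoundedContinuousFunction.evalCLM ℝ x).continuous.tendsto _).comp hlim
  -- The interpolation estimate involves only finitely many point values, so it passes to the limit
  -- without any differentiability of `v t`.
  exact le_of_tendsto ((hpt x).sub (tendsto_interp (fun i => hpt _) x)).abs
    (.of_forall fun n => herr n x)

/-! ### The approximate expectation -/

section ApproxExp

variable {Q : ℕ} {w a : Fin Q → ℝ}

lemma abs_tensorQuad_sub_le {W : ℝ} (hW : ∑ j, |w j| ≤ W) {ψ χ : ℝ → ℝ} {ε : ℝ}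
    (h : ∀ z, |ψ z - χ z| ≤ ε) (m : ℕ) (x : ℝ) :
    |tensorQuad w a ψ m x - tensorQuad w a χ m x| ≤ W ^ m * ε := by
  have hε : 0 ≤ ε := (abs_nonneg _).trans (h 0)
  rw [tensorQuad, tensorQuad, ← Finset.sum_sub_distrib]
  calc _ ≤ ∑ q : Fin m → Fin Q, |(∏ k, w (q k)) * ψ (x + ∑ k, a (q k))
          - (∏ k, w (q k)) * χ (x + ∑ k, a (q k))| := Finset.abs_sum_le_sum_abs _ _
    _ ≤ ∑ q : Fin m → Fin Q, (∏ k, |w (q k)|) * ε := by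
        refine Finset.sum_le_sum fun q _ => ?_
        rw [← mul_sub, abs_mul, Finset.abs_prod]
        gcongr
        exact h _
    _ = (∑ j, |w j|) ^ m * ε := by
        rw [← Finset.sum_mul, Fintype.sum_pow]
    _ ≤ _ := by gcongr

lemma tensorQuad_zero (ψ : ℝ → ℝ) (x : ℝ) : tensorQuad w a ψ 0 x = ψ x := by
  simp [tensorQuad]

/-- All terms with at least one jump together carry a factor `s`. With `s` proportional to the time
step, this makes their contribution to the recursion harmless. -/
lemma sum_range_succ_pow_div_factorial_le {s : ℝ} (hs : 0 ≤ s) (M : ℕ) :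
    ∑ m ∈ Finset.range M, s ^ (m + 1) / ((m + 1).factorial : ℝ) ≤ s * Real.exp s := by
  calc _ ≤ ∑ m ∈ Finset.range M, s * (s ^ m / (m.factorial : ℝ)) := by
        refine Finset.sum_le_sum fun m _ => ?_
        rw [← mul_div_assoc, ← pow_succ']
        gcongr
        exact Nat.le_succ m
    _ ≤ _ := by
        rw [← Finset.mul_sum]
        gcongr
        exact Real.sum_le_exp_of_nonneg hs M

/-- The error of the approximate expectation at a mesh point: truncation, interpolation,
and quadrature. -/
lemma abs_evol_gen_sub_approxExp_le {γ : ℝ → ℝ} (hγ : ∀ e, 0 ≤ γ e) (hγi : Integrable γ)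
    [IsFiniteMeasure (jumpMeasure γ)] {lam : ℝ} (hlam : 0 < lam)
    (hη : (jumpMeasure γ).real univ = lam) {W : ℝ} (hW : ∑ j, |w j| ≤ W) {dt : ℝ} (hdt : 0 ≤ dt)
    {ψ : ℝ →ᵇ ℝ} {χ : ℝ → ℝ} {x ε ε₀ q : ℝ} {M : ℕ} (hε : ∀ z, |ψ z - χ z| ≤ ε)
    (hε₀ : |ψ x - χ x| ≤ ε₀) (hq0 : 0 ≤ q)
    (hq : ∀ m ∈ Finset.Icc 1 M, |jumpIntegral lam γ ψ m x - tensorQuad w a ψ m x| ≤ q) :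
    |evol (gen (jumpMeasure γ)) dt ψ x - approxExp lam dt w a M χ x|
      ≤ (lam * dt) ^ (M + 1) * ‖ψ‖ + ε₀ + lam * dt * q
        + lam * dt * W * Real.exp (lam * dt * W) * ε := by
  have hW0 : 0 ≤ W := (Finset.sum_nonneg fun _ _ => abs_nonneg _).trans hW
  have hε0 : 0 ≤ ε := (abs_nonneg _).trans (hε 0)
  have h1 := abs_evol_gen_sub_sum_le (jumpMeasure γ) hdt ψ x (M + 1)
  rw [hη] at h1
  set s := lam * dt with hs
  have hs0 : 0 ≤ s := by positivity
  have hexp : Real.exp (-s) ≤ 1 := Real.exp_le_one_iff.2 (by linarith)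
  have h2 : ∀ m, Real.exp (-s) * ((m.factorial : ℝ)⁻¹ * dt ^ m
      * (shiftAvg (jumpMeasure γ) ^ m) ψ x)
      = Real.exp (-s) * s ^ m / (m.factorial : ℝ) * jumpIntegral lam γ ψ m x := fun m => by
    rw [pow_mul_jumpIntegral hγ hγi hlam, hs, mul_pow]; ring
  simp only [h2] at h1
  have h3 : |∑ m ∈ Finset.range (M + 1), Real.exp (-s) * s ^ m / (m.factorial : ℝ)
        * jumpIntegral lam γ ψ m x - approxExp lam dt w a M χ x|
      ≤ ε₀ + s * q + s * W * Real.exp (s * W) * ε := by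
    rw [approxExp, ← Finset.sum_sub_distrib, Finset.sum_range_succ']
    -- Without jumps only the value at `x` itself is used, so the smaller nodal error `ε₀` appears
    -- in place of the global error `ε`.
    have h0 : |Real.exp (-s) * s ^ 0 / ((0 : ℕ).factorial : ℝ) * jumpIntegral lam γ ψ 0 x
        - Real.exp (-s) * s ^ 0 / ((0 : ℕ).factorial : ℝ) * tensorQuad w a χ 0 x| ≤ ε₀ := by
      have hj : jumpIntegral lam γ ψ 0 x = ψ x := by
        have := pow_mul_jumpIntegral hγ hγi hlam ψ 0 x
        simpa using this.symm
      rw [hj, tensorQuad_zero, ← mul_sub, abs_mul]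
      simp only [pow_zero, mul_one, Nat.factorial_zero, Nat.cast_one, div_one, Real.abs_exp]
      exact (mul_le_of_le_one_left (abs_nonneg _) hexp).trans hε₀
    have hm : ∀ m ∈ Finset.range M,
        |Real.exp (-s) * s ^ (m + 1) / ((m + 1).factorial : ℝ) * jumpIntegral lam γ ψ (m + 1) x
          - Real.exp (-s) * s ^ (m + 1) / ((m + 1).factorial : ℝ) * tensorQuad w a χ (m + 1) x|
        ≤ Real.exp (-s) * (s ^ (m + 1) / ((m + 1).factorial : ℝ)) * q
          + (s * W) ^ (m + 1) / ((m + 1).factorial : ℝ) * ε := fun m hm => by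
      rw [← mul_sub, abs_mul, abs_of_nonneg (by positivity)]
      have hqm := hq (m + 1) (by rw [Finset.mem_Icc, ← Nat.lt_iff_add_one_le];
                                 rw [Finset.mem_range] at hm; omega)
      have htm := abs_tensorQuad_sub_le (a := a) hW hε (m + 1) x
      -- The quadrature error is assumed only for the exact function `ψ`; replacing `ψ` by `χ`
      -- inside the rule costs the absolute sum of the product weights, at most `W ^ (m + 1)`.
      have htri : |jumpIntegral lam γ ψ (m + 1) x - tensorQuad w a χ (m + 1) x|
          ≤ q + W ^ (m + 1) * ε := by
        refine (abs_sub_le _ (tensorQuad w a ψ (m + 1) x) _).trans (add_le_add hqm htm)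
      calc _ ≤ Real.exp (-s) * s ^ (m + 1) / ((m + 1).factorial : ℝ) * (q + W ^ (m + 1) * ε) := by
            gcongr
        _ = Real.exp (-s) * (s ^ (m + 1) / ((m + 1).factorial : ℝ)) * q
            + Real.exp (-s) * ((s * W) ^ (m + 1) / ((m + 1).factorial : ℝ) * ε) := by
            rw [mul_pow]; ring
        _ ≤ _ := by
            exact add_le_add le_rfl (mul_le_of_le_one_left (by positivity) hexp)
    have hsum : ∑ m ∈ Finset.range M, (Real.exp (-s) * (s ^ (m + 1) / ((m + 1).factorial : ℝ)) * q
          + (s * W) ^ (m + 1) / ((m + 1).factorial : ℝ) * ε)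
        ≤ s * q + s * W * Real.exp (s * W) * ε := by
      rw [Finset.sum_add_distrib, ← Finset.sum_mul, ← Finset.mul_sum, ← Finset.sum_mul]
      have hA := sum_range_succ_pow_div_factorial_le hs0 M
      have hB := sum_range_succ_pow_div_factorial_le (mul_nonneg hs0 hW0) M
      gcongr
      calc _ ≤ Real.exp (-s) * (s * Real.exp s) := by gcongr
        _ = s := by rw [mul_left_comm, ← Real.exp_add, neg_add_cancel, Real.exp_zero, mul_one]
    refine (abs_add_le _ _).trans ?_
    have := (Finset.abs_sum_le_sum_abs (fun m =>
      Real.exp (-s) * s ^ (m + 1) / ((m + 1).factorial : ℝ) * jumpIntegral lam γ ψ (m + 1) x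
          - Real.exp (-s) * s ^ (m + 1) / ((m + 1).factorial : ℝ) * tensorQuad w a χ (m + 1) x)
      (Finset.range M)).trans ((Finset.sum_le_sum hm).trans hsum)
    linarith
  refine (abs_sub_le _ _ _).trans ((add_le_add h1 h3).trans_eq ?_)
  ring

end ApproxExp

/-! ### The global error of the scheme -/

/-- One step of the error recursion. -/
lemma error_step_le {e ε dt T lam B a₁ a₂ q d R Λ CI Cτ η c C X : ℝ} (hdt : 0 < dt) (hdtT : dt ≤ T)
    (hBdt : B * dt ≤ 1) (hlam : 0 ≤ lam) (hB : 0 ≤ B) (ha₁ : 0 ≤ a₁) (ha₂ : 0 ≤ a₂) (hq : 0 ≤ q)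
    (hd : 0 ≤ d) (hR : 0 ≤ R) (hΛ : 0 ≤ Λ) (hCI : 0 ≤ CI) (hCτ : 0 ≤ Cτ) (hη : 0 ≤ η)
    (hε : 0 ≤ ε) (he0 : 0 ≤ e)
    (hc : c = lam * η * Λ + B / 2 + T * lam * η * B * Λ / 2)
    (hC : C = Cτ + lam * R + (lam + T * lam / 2) + (lam * η + T * lam * η * B / 2) * CI + B / 2)
    (hX : X = dt ^ 2 + a₁ + a₂ + q + d)
    (he : e ≤ Cτ * dt ^ 3 + (lam * dt * a₁ * R + ε + lam * dt * q + lam * dt * η * (CI * d + Λ * ε))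
      + dt / 2 * (a₂ * B + B * ε + lam * dt * q + lam * dt * η * (B * (CI * d + Λ * ε)))
      + dt / 2 * (B * e)) :
    e ≤ (1 + (B + c + B * T * c) * dt) * ε + dt * (2 * C * X) := by
  have hT : 0 ≤ T := hdt.le.trans hdtT
  have hc0 : 0 ≤ c := by rw [hc]; positivity
  have hX1 : dt ^ 2 ≤ X := by rw [hX]; linarith only [ha₁, ha₂, hq, hd]
  have hX2 : a₁ ≤ X := by rw [hX]; linarith only [sq_nonneg dt, ha₁, ha₂, hq, hd]
  have hX3 : a₂ ≤ X := by rw [hX]; linarith only [sq_nonneg dt, ha₁, ha₂, hq, hd]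
  have hX4 : q ≤ X := by rw [hX]; linarith only [sq_nonneg dt, ha₁, ha₂, hq, hd]
  have hX5 : d ≤ X := by rw [hX]; linarith only [sq_nonneg dt, ha₁, ha₂, hq, hd]
  have hX0 : 0 ≤ X := ha₁.trans hX2
  have hC0 : 0 ≤ C := by rw [hC]; positivity
  -- The implicit term is moved to the left. Where a term has two factors `dt`, one of them is
  -- bounded by `T`.
  have h1 : (1 - B * dt / 2) * e ≤ (1 + c * dt) * ε + dt * (C * X) := by
    have t1 : dt / 2 * (lam * dt * q) ≤ dt * (T * lam / 2 * q) := by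
      have : dt * (dt * (lam * q / 2)) ≤ dt * (T * (lam * q / 2)) := by gcongr
      linarith only [this]
    have t2 : dt / 2 * (lam * dt * η * (B * (CI * d + Λ * ε)))
        ≤ dt * (T * lam * η * B / 2 * (CI * d + Λ * ε)) := by
      have : dt * (dt * (lam * η * B / 2 * (CI * d + Λ * ε)))
          ≤ dt * (T * (lam * η * B / 2 * (CI * d + Λ * ε))) := by gcongr
      linarith only [this]
    have t3 : Cτ * dt ^ 2 + lam * R * a₁ + (lam + T * lam / 2) * q
        + (lam * η + T * lam * η * B / 2) * CI * d + B / 2 * a₂ ≤ C * X := by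
      calc _ ≤ Cτ * X + lam * R * X + (lam + T * lam / 2) * X
            + (lam * η + T * lam * η * B / 2) * CI * X + B / 2 * X := by gcongr
        _ = C * X := by rw [hC]; ring
    have t4 := mul_le_mul_of_nonneg_left t3 hdt.le
    have t5 : (1 + c * dt) * ε = ε + dt * (lam * η * (Λ * ε)) + dt / 2 * (B * ε)
        + dt * (T * lam * η * B / 2 * (Λ * ε)) := by rw [hc]; ring
    rw [t5]
    linarith only [he, t1, t2, t4]
  have h2 : 0 < 1 - B * dt / 2 := by linarith only [hBdt]
  -- For `B * dt ≤ 1` the factor `1 + B * dt` bounds the inverse of `1 - B * dt / 2`, so the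
  -- implicit term can be absorbed.
  have h3 : 1 ≤ (1 + B * dt) * (1 - B * dt / 2) := by
    have : 0 ≤ B * dt * (1 - B * dt) :=
      mul_nonneg (mul_nonneg hB hdt.le) (sub_nonneg.2 hBdt)
    linarith only [this]
  have h4 : e ≤ (1 + B * dt) * ((1 + c * dt) * ε + dt * (C * X)) := by
    calc e ≤ ((1 + B * dt) * (1 - B * dt / 2)) * e := le_mul_of_one_le_left he0 h3
      _ = (1 + B * dt) * ((1 - B * dt / 2) * e) := by ring
      _ ≤ _ := by gcongr
  refine h4.trans ?_
  have h5 : (1 + B * dt) * (dt * (C * X)) ≤ 2 * (dt * (C * X)) := by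
    gcongr; linarith only [hBdt]
  have h6 : (1 + B * dt) * (1 + c * dt) ≤ 1 + (B + c + B * T * c) * dt := by
    have : B * c * dt * dt ≤ B * c * dt * T := by gcongr
    linarith only [this]
  calc _ = (1 + B * dt) * (1 + c * dt) * ε + (1 + B * dt) * (dt * (C * X)) := by ring
    _ ≤ (1 + (B + c + B * T * c) * dt) * ε + 2 * (dt * (C * X)) := by gcongr
    _ = _ := by ring

/-- The error of the scheme with respect to the solution of the backward equation. -/
lemma exists_scheme_error_bound {T lam : ℝ} (hT : 0 < T) (hlam : 0 < lam) (p : ℕ)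
    (B W K R : ℝ) :
    ∃ C > 0, ∃ δ > 0, ∀ γ : ℝ → ℝ, (∀ e, 0 ≤ γ e) → Integrable γ →
      ∀ [IsFiniteMeasure (jumpMeasure γ)], (jumpMeasure γ).real univ = lam →
      ∀ (f : ℝ × ℝ × ℝ → ℝ) (F : ℝ → (ℝ →ᵇ ℝ) → (ℝ →ᵇ ℝ)) (φ : ℝ →ᵇ ℝ) (v : ℝ → ℝ →ᵇ ℝ),
      IsCb (max 2 (p + 1)) B univ φ → IsCb (max 2 (p + 1)) B (Icc 0 T ×ˢ univ) f →
      IsNonlinearity T B F → (∀ t ∈ Icc 0 T, ∀ ψ x, F t ψ x = f (t, x, ψ x)) →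
      IsBackwardSolution T (gen (jumpMeasure γ)) F φ R v →
      ∀ (N : ℕ) (dt : ℝ), 0 < N → dt = T / N → dt < δ → ∀ (x₀ dx : ℝ), 0 < dx →
      ∀ S : ℝ → Finset ℤ, IsNearestStencil x₀ dx p S →
      ∀ (My Mf Q : ℕ) (w a : Fin Q → ℝ) (r : ℝ), ∑ j, |w j| ≤ W →
      QuadratureError lam γ N x₀ dx w a K r My (fun n x => v (tgrid dt n) x) →
      QuadratureError lam γ N x₀ dx w a K r Mf
        (fun n x => f (tgrid dt n, x, v (tgrid dt n) x)) →
      ∀ y : ℕ → ℤ → ℝ, IsFullyDiscreteSolution (1 / 2) lam φ f N dt x₀ dx S w a My Mf y →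
      ∀ n ≤ N, ∀ i : ℤ, |v (tgrid dt n) (xgrid x₀ dx i) - y n i|
        ≤ C * (dt ^ 2 + (lam * dt) ^ My + (lam * dt) ^ (Mf + 1) + (Q : ℝ) ^ (-r) + dx ^ (p + 1)) := by
  obtain ⟨CI, hCI0, hCI⟩ := exists_interp_error_bound hT hlam.le B R p
  obtain ⟨Λ₀, hΛ₀⟩ : ∃ Λ₀, Λ₀ = 2 * lam := ⟨_, rfl⟩
  have hΛ₀0 : 0 < Λ₀ := by rw [hΛ₀]; positivity
  -- The constants must be fixed before the data, whose existence is what makes `B`, `W` and `R`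
  -- nonnegative; absolute values are used meanwhile.
  obtain ⟨Cτ, hCτ⟩ : ∃ Cτ, Cτ = Real.exp (T * Λ₀) * (|B| * (Λ₀ * (Λ₀ * |R| + |B|)
      + |B| * (1 + (Λ₀ * |R| + |B|))) + |B| * (1 + (Λ₀ * |R| + |B|)) ^ 2)
      + Real.exp (T * Λ₀) * Λ₀ * Λ₀ * |B|
      + Real.exp (T * Λ₀) * Λ₀ * (|B| * (1 + (Λ₀ * |R| + |B|))) := ⟨_, rfl⟩
  obtain ⟨η, hη⟩ : ∃ η, η = |W| * Real.exp (lam * T * |W|) := ⟨_, rfl⟩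
  obtain ⟨Λ, hΛ⟩ : ∃ Λ, Λ = (p + 1 : ℝ) ^ (p + 1) := ⟨_, rfl⟩
  obtain ⟨c₁, hc₁⟩ : ∃ c, c = lam * η * Λ + |B| / 2 + T * lam * η * |B| * Λ / 2 := ⟨_, rfl⟩
  obtain ⟨c, hc⟩ : ∃ c, c = |B| + c₁ + |B| * T * c₁ := ⟨_, rfl⟩
  obtain ⟨C₁, hC₁⟩ : ∃ C, C = Cτ + lam * |R| + (lam + T * lam / 2)
    + (lam * η + T * lam * η * |B| / 2) * CI + |B| / 2 := ⟨_, rfl⟩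
  have hΛ0 : 0 ≤ Λ := by rw [hΛ]; positivity
  have hCτ0 : 0 ≤ Cτ := by rw [hCτ]; positivity
  have hη0 : 0 ≤ η := by rw [hη]; positivity
  have hc₁0 : 0 ≤ c₁ := by rw [hc₁]; positivity
  have hc0 : 0 ≤ c := by rw [hc]; positivity
  have hC₁0 : 0 ≤ C₁ := by rw [hC₁]; positivity
  -- The choice `δ = 1 / (|B| + 1)` ensures `|B| * dt ≤ 1`, as needed for the implicit term. The
  -- final `+ 1` only makes the constant positive, and `1 + |K|` bounds `K` by a nonnegative number.
  refine ⟨Real.exp (c * T) * (T * (2 * C₁)) * (1 + |K|) + 1,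
    add_pos_of_nonneg_of_pos (by positivity) one_pos, 1 / (|B| + 1), by positivity, ?_⟩
  intro γ hγ hγi _ hmass f F φ v hφ hf hFn hF hv N dt hN hdtN hdtδ x₀ dx hdx S hS My Mf Q w a r hw
    hqy hqf y hy
  have hB : 0 ≤ B := (abs_nonneg _).trans (hφ.abs_le (mem_univ 0))
  have hR : 0 ≤ R := (norm_nonneg _).trans (hv.norm_le T ⟨hT.le, le_rfl⟩)
  have hW : 0 ≤ W := (Finset.sum_nonneg fun _ _ => abs_nonneg _).trans hw
  have hN' : (0 : ℝ) < N := by exact_mod_cast hN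
  have hdt : 0 < dt := by rw [hdtN]; positivity
  have hNdt : N * dt = T := by rw [hdtN]; field_simp
  have hdtT : dt ≤ T := by rw [← hNdt]; exact le_mul_of_one_le_left hdt.le (by exact_mod_cast hN)
  have hBdt : |B| * dt ≤ 1 := by
    rw [lt_div_iff₀ (by positivity)] at hdtδ
    nlinarith
  have hgrid : ∀ n ≤ N, tgrid dt n ∈ Icc 0 T := fun n hn =>
    ⟨by rw [tgrid]; positivity, by rw [tgrid, ← hNdt]; gcongr⟩
  have hQ : (0 : ℝ) ≤ (Q : ℝ) ^ (-r) := Real.rpow_nonneg (Nat.cast_nonneg _) _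
  obtain ⟨X, hX⟩ : ∃ X, X = dt ^ 2 + (lam * dt) ^ My + (lam * dt) ^ (Mf + 1)
    + (1 + |K|) * (Q : ℝ) ^ (-r) + dx ^ (p + 1) := ⟨_, rfl⟩
  have hX0 : 0 ≤ X := by rw [hX]; positivity
  -- A scalar majorant of the error, indexed by the number of steps back from `T`. Comparing
  -- pointwise with `β` avoids suprema over the infinite mesh, whose finiteness is not known
  -- beforehand.
  obtain ⟨β, hβ00, hβs⟩ : ∃ β : ℕ → ℝ, β 0 = 0 ∧
      ∀ k, β (k + 1) = (1 + c * dt) * β k + dt * (2 * C₁ * X) :=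
    ⟨fun k => Nat.rec 0 (fun _ b => (1 + c * dt) * b + dt * (2 * C₁ * X)) k, rfl, fun _ => rfl⟩
  have hβ0 : ∀ k, 0 ≤ β k := by
    intro k
    induction k with
    | zero => exact hβ00.ge
    | succ k ih => rw [hβs]; positivity
  have hmain : ∀ k ≤ N, ∀ i, |v (tgrid dt (N - k)) (xgrid x₀ dx i) - y (N - k) i| ≤ β k := by
    intro k
    induction k with
    | zero =>
      intro _ i
      have : tgrid dt (N - 0) = T := by rw [Nat.sub_zero, tgrid, hNdt]
      rw [this, Nat.sub_zero, hy.terminal, hv.terminal, sub_self, abs_zero, hβ00]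
    | succ k ih =>
      intro hk i
      have ih := ih (by omega)
      obtain ⟨n, hn⟩ : ∃ n, n = N - (k + 1) := ⟨_, rfl⟩
      have hn1 : N - k = n + 1 := by omega
      have hnN : n < N := by omega
      rw [hn1] at ih
      rw [← hn, hβs]
      set x := xgrid x₀ dx i
      set t := tgrid dt n with ht
      have htI : t ∈ Icc 0 T := hgrid n hnN.le
      have ht1 : tgrid dt (n + 1) = t + dt := by rw [ht, tgrid, tgrid]; push_cast; ring
      have htI1 : t + dt ∈ Icc 0 T := by rw [← ht1]; exact hgrid (n + 1) hnN
      set ψ := v (t + dt) with hψ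
      set χ := interp x₀ dx S (y (n + 1)) with hχ
      have hqy := hqy n hnN i
      have hqf := hqf n hnN i
      simp only [ht1] at hqy hqf ih
      have hψχ : ∀ z, |ψ z - χ z| ≤ CI * dx ^ (p + 1) + Λ * β k := fun z => by
        have h1 := hCI (jumpMeasure γ) f F φ v hmass hf hFn hF hφ hv x₀ dx S hdx hS (t + dt) htI1 z
        have h2 : |interp x₀ dx S (fun i => ψ (xgrid x₀ dx i)) z - χ z| ≤ Λ * β k := by
          rw [hχ, ← interp_sub, hΛ]
          exact hS.abs_interp_le hdx fun i _ => ih i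
        exact (abs_sub_le _ _ _).trans (add_le_add h1 h2)
      have hnode : |ψ x - χ x| ≤ β k := by
        rw [hχ, interp_xgrid hS hdx]; exact ih i
      have hlipf : ∀ s ∈ Icc 0 T, ∀ z b b' : ℝ, |f (s, z, b) - f (s, z, b')| ≤ |B| * |b - b'| := by
        intro s hs z b b'
        rw [abs_of_nonneg hB]
        refine (hf.norm_sub_le (by omega) (uniqueDiffOn_slab hT) (convex_slab T)
          ⟨hs, mem_univ _⟩ ⟨hs, mem_univ _⟩).trans_eq ?_
        simp [Prod.norm_def]
      have hq0 : K * (Q : ℝ) ^ (-r) ≤ (1 + |K|) * (Q : ℝ) ^ (-r) := by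
        gcongr; linarith [le_abs_self K]
      have hexpW : W * Real.exp (lam * dt * W) ≤ η := by
        rw [hη, abs_of_nonneg hW]; gcongr
      have hε'0 : 0 ≤ CI * dx ^ (p + 1) + Λ * β k := (abs_nonneg _).trans (hψχ 0)
      have hY := abs_evol_gen_sub_approxExp_le hγ hγi hlam hmass hw hdt.le hψχ hnode
        (by positivity) fun m hm => (hqy m hm).trans hq0
      have hG := abs_evol_gen_sub_approxExp_le hγ hγi hlam hmass hw hdt.le (ψ := F (t + dt) ψ)
        (χ := fun z => f (t + dt, z, χ z)) (x := x) (ε := |B| * (CI * dx ^ (p + 1) + Λ * β k))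
        (ε₀ := |B| * β k) (M := Mf) (a := a) (q := (1 + |K|) * (Q : ℝ) ^ (-r))
        (fun z => by
          rw [hF _ htI1]
          exact (hlipf _ htI1 _ _ _).trans (by gcongr; exact hψχ z))
        (by rw [hF _ htI1]; exact (hlipf _ htI1 _ _ _).trans (by gcongr))
        (by positivity) fun m hm => by
          have e : ⇑(F (t + dt) ψ) = fun x => f (t + dt, x, ψ x) := funext (hF _ htI1 ψ)
          rw [e]
          exact (hqf m hm).trans hq0
      have hτ := hv.norm_trapezoid_sub_le (Λ := Λ₀) (by rw [hΛ₀, ← hmass]; exact norm_gen_le _) hFn hB hR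
        hdt htI htI1
      have hτx := (BoundedContinuousFunction.norm_coe_le_norm _ x).trans hτ
      have hstep := hy.step n hnN i
      rw [ht1] at hstep
      have hfn := hlipf t htI x (v t x) (y n i)
      rw [hc]
      refine error_step_le (R := |R|) hdt hdtT hBdt hlam.le (abs_nonneg B)
        (a₁ := (lam * dt) ^ My) (a₂ := (lam * dt) ^ (Mf + 1)) (q := (1 + |K|) * (Q : ℝ) ^ (-r))
        (d := dx ^ (p + 1)) (Λ := Λ) (CI := CI) (Cτ := Cτ) (η := η) (by positivity) (by positivity)
        (by positivity) (by positivity) (abs_nonneg _) (by positivity) hCI0 hCτ0 hη0 (hβ0 k)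
        (abs_nonneg _) hc₁ hC₁ hX ?_
      -- The truncation error `(λ dt)^(My + 1)` is written as `λ dt` times `(λ dt)^My`, because one
      -- factor `dt` is used up when the local errors are summed.
      have hYb := hY.trans (b := _) (c := lam * dt * (lam * dt) ^ My * |R| + β k
          + lam * dt * ((1 + |K|) * (Q : ℝ) ^ (-r))
          + lam * dt * η * (CI * dx ^ (p + 1) + Λ * β k)) (by
        rw [pow_succ', mul_assoc (lam * dt) W]
        gcongr
        exact (hv.norm_le _ htI1).trans (le_abs_self R))
      -- Here all `Mf + 1` powers remain, since this term is later multiplied by `dt / 2`.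
      have hGb := hG.trans (b := _) (c := (lam * dt) ^ (Mf + 1) * |B| + |B| * β k
          + lam * dt * ((1 + |K|) * (Q : ℝ) ^ (-r))
          + lam * dt * η * (|B| * (CI * dx ^ (p + 1) + Λ * β k))) (by
        rw [mul_assoc (lam * dt) W]
        gcongr
        exact (hFn.norm_le _ htI1 _).trans (le_abs_self B))
      have hτb : |v t x - (evol (gen (jumpMeasure γ)) dt ψ x
          + dt / 2 * evol (gen (jumpMeasure γ)) dt (F (t + dt) ψ) x + dt / 2 * f (t, x, v t x))|
          ≤ Cτ * dt ^ 3 := by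
        rw [hCτ, abs_of_nonneg hB, abs_of_nonneg hR]
        refine Eq.trans_le ?_ hτx
        rw [← hF t htI]
        rfl
      -- The error splits into the trapezoidal error, the errors of the two approximate
      -- expectations, and the implicit term.
      have e : v t x - y n i = (v t x - (evol (gen (jumpMeasure γ)) dt ψ x
          + dt / 2 * evol (gen (jumpMeasure γ)) dt (F (t + dt) ψ) x + dt / 2 * f (t, x, v t x)))
          + (evol (gen (jumpMeasure γ)) dt ψ x - approxExp lam dt w a My χ x)
          + dt / 2 * (evol (gen (jumpMeasure γ)) dt (F (t + dt) ψ) x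
            - approxExp lam dt w a Mf (fun z => f (t + dt, z, χ z)) x)
          + dt / 2 * (f (t, x, v t x) - f (t, x, y n i)) := by
        have hstep : y n i = approxExp lam dt w a My χ x + (1 - 1 / 2) * dt * approxExp lam dt w a Mf
          (fun z => f (t + dt, z, χ z)) x + 1 / 2 * dt * f (t, x, y n i) := hstep
        linear_combination -hstep
      rw [e]
      refine (abs_add_le _ _).trans (add_le_add ((abs_add_le _ _).trans (add_le_add
        ((abs_add_le _ _).trans (add_le_add hτb hYb)) ?_)) ?_)
      · rw [abs_mul, abs_of_pos (by positivity : 0 < dt / 2)]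
        gcongr
      · rw [abs_mul, abs_of_pos (by positivity : 0 < dt / 2), ← e]
        gcongr
  intro n hn i
  have h1 := hmain (N - n) (by omega) i
  rw [Nat.sub_sub_self hn] at h1
  have h2 := discrete_gronwall (a := β) (c := c) (h := dt) (b := 2 * C₁ * X) (n := N) hc0 hdt.le
    (by positivity) (hβ0 0) (fun k _ => (hβs k).le) (N - n) (by omega)
  have h3 : ((N - n : ℕ) : ℝ) * dt ≤ T := by
    rw [← hNdt]; gcongr; omega
  rw [hβ00, zero_add] at h2
  obtain ⟨Z, hZ⟩ : ∃ Z, Z = dt ^ 2 + (lam * dt) ^ My + (lam * dt) ^ (Mf + 1) + (Q : ℝ) ^ (-r)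
    + dx ^ (p + 1) := ⟨_, rfl⟩
  rw [← hZ]
  have hZ0 : 0 ≤ Z := by rw [hZ]; positivity
  have hXZ : X ≤ (1 + |K|) * Z := by
    have : 0 ≤ |K| * (dt ^ 2 + (lam * dt) ^ My + (lam * dt) ^ (Mf + 1) + dx ^ (p + 1)) := by
      positivity
    rw [hX, hZ]; linarith
  calc _ ≤ _ := h1.trans h2
    _ ≤ Real.exp (c * T) * (T * ((2 * C₁) * ((1 + |K|) * Z))) := by gcongr
    _ = Real.exp (c * T) * (T * (2 * C₁)) * (1 + |K|) * Z := by ring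
    _ ≤ _ := by gcongr; linarith

/-! ### Poisson random measures with finite intensity -/

lemma lintegral_natCast_poissonMeasure (r : ℝ≥0) : ∫⁻ k, (k : ℝ≥0∞) ∂poissonMeasure r = r := by
  have h1 : ∀ n : ℕ, ENNReal.ofReal (Real.exp (-r) * r ^ (n + 1) / (n + 1).factorial)
      * ((n + 1 : ℕ) : ℝ≥0∞) = r * ENNReal.ofReal (Real.exp (-r) * r ^ n / n.factorial) := by
    intro n
    rw [← ENNReal.ofReal_natCast, ← ENNReal.ofReal_mul (by positivity),
      ← ENNReal.ofReal_coe_nnreal, ← ENNReal.ofReal_mul (by positivity), Nat.factorial_succ]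
    congr 1
    push_cast
    field_simp
    ring
  have h2 : ∑' n : ℕ, ENNReal.ofReal (Real.exp (-r) * r ^ n / n.factorial) = 1 := by
    rw [← ENNReal.ofReal_tsum_of_nonneg (fun n => by positivity)
      (hasSum_one_poissonMeasure r).summable, (hasSum_one_poissonMeasure r).tsum_eq,
      ENNReal.ofReal_one]
  rw [poissonMeasure, lintegral_sum_measure]
  simp only [lintegral_smul_measure, lintegral_dirac, smul_eq_mul]
  rw [tsum_eq_zero_add' ENNReal.summable]
  simp only [h1, ENNReal.tsum_mul_left, h2, Nat.cast_zero, mul_zero, zero_add, mul_one]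

/-- The integral is zero by convention when `g` is not integrable. Integrability is a measurable
condition on the measure, and where it holds the integral is a difference of two measurable
functions. -/
lemma measurable_integral_measure {S : Type*} [MeasurableSpace S] {g : S → ℝ} (hg : Measurable g) :
    Measurable fun m : Measure S => ∫ z, g z ∂m := by
  classical
  have h1 : (fun m : Measure S => ∫ z, g z ∂m) = fun m => if ∫⁻ z, ‖g z‖ₑ ∂m < ∞ then
      (∫⁻ z, ENNReal.ofReal (g z) ∂m).toReal - (∫⁻ z, ENNReal.ofReal (-g z) ∂m).toReal else 0 := by
    ext m
    split_ifs with h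
    · exact integral_eq_lintegral_pos_part_sub_lintegral_neg_part ⟨hg.aestronglyMeasurable, h⟩
    · exact integral_undef fun h' => h h'.2
  rw [h1]
  refine Measurable.ite (measurableSet_lt (Measure.measurable_lintegral hg.enorm)
    measurable_const) ?_ measurable_const
  exact (Measure.measurable_lintegral hg.ennreal_ofReal).ennreal_toReal.sub
    (Measure.measurable_lintegral hg.neg.ennreal_ofReal).ennreal_toReal

namespace IsPoissonRandomMeasure

variable {Ω S : Type*} [MeasurableSpace Ω] [MeasurableSpace S] {P : Measure Ω} {ν : Measure S}
  {μ : Ω → Measure S}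

lemma measurable_apply (hμ : IsPoissonRandomMeasure P ν μ) {A : Set S} (hA : MeasurableSet A) :
    Measurable fun ω => μ ω A :=
  (Measure.measurable_coe hA).comp hμ.measurable

lemma lintegral_apply (hμ : IsPoissonRandomMeasure P ν μ) {A : Set S} (hA : MeasurableSet A)
    (hνA : ν A ≠ ∞) : ∫⁻ ω, μ ω A ∂P = ν A := by
  rw [← lintegral_map (f := fun a => a) measurable_id' (hμ.measurable_apply hA),
    hμ.poisson A hA hνA, lintegral_map measurable_id' .of_discrete,
    lintegral_natCast_poissonMeasure, ENNReal.coe_toNNReal hνA]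

/-- Markov's inequality for a variable with values in the natural numbers. -/
lemma measure_apply_ne_zero_le (hμ : IsPoissonRandomMeasure P ν μ) {A : Set S}
    (hA : MeasurableSet A) (hνA : ν A ≠ ∞) : P {ω | μ ω A ≠ 0} ≤ ν A := by
  have h0 : MeasurableSet ({0}ᶜ : Set ℝ≥0∞) := (measurableSet_singleton 0).compl
  have h1 : P {ω | μ ω A ≠ 0} = P.map (fun ω => μ ω A) {0}ᶜ := by
    rw [Measure.map_apply (hμ.measurable_apply hA) h0]; rfl
  rw [h1, hμ.poisson A hA hνA, Measure.map_apply .of_discrete h0]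
  calc _ = ∫⁻ k, ((fun k : ℕ => (k : ℝ≥0∞)) ⁻¹' {0}ᶜ).indicator 1 k
        ∂poissonMeasure (ν A).toNNReal := by
        rw [lintegral_indicator_one .of_discrete]
    _ ≤ ∫⁻ k, (k : ℝ≥0∞) ∂poissonMeasure (ν A).toNNReal := by
        refine lintegral_mono fun k => ?_
        rcases k.eq_zero_or_pos with rfl | hk
        · simp
        · refine (indicator_le_self' (fun _ _ => zero_le) k).trans ?_
          simpa using Nat.one_le_iff_ne_zero.2 hk.ne'
    _ = ν A := by rw [lintegral_natCast_poissonMeasure, ENNReal.coe_toNNReal hνA]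

lemma ae_lt_top (hμ : IsPoissonRandomMeasure P ν μ) [IsFiniteMeasure ν] :
    ∀ᵐ ω ∂P, μ ω univ < ∞ :=
  MeasureTheory.ae_lt_top (hμ.measurable_apply .univ)
    (by rw [hμ.lintegral_apply .univ (measure_ne_top _ _)]; exact measure_ne_top _ _)

/-- A real function is almost surely bounded on the finitely many atoms of the measure. -/
lemma ae_integrable (hμ : IsPoissonRandomMeasure P ν μ) [IsFiniteMeasure ν] {g : S → ℝ}
    (hg : Measurable g) : ∀ᵐ ω ∂P, Integrable g (μ ω) := by
  have hA : ∀ n : ℕ, MeasurableSet {z | (n : ℝ) < |g z|} := fun n =>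
    measurableSet_lt measurable_const hg.abs
  have h1 : Tendsto (fun n : ℕ => ν {z | (n : ℝ) < |g z|}) atTop (𝓝 0) := by
    have h2 : ⋂ n : ℕ, {z | (n : ℝ) < |g z|} = ∅ := by
      refine eq_empty_of_forall_notMem fun z hz => ?_
      obtain ⟨n, hn⟩ := exists_nat_ge |g z|
      exact (mem_iInter.1 hz n).not_ge hn
    rw [← measure_empty (μ := ν), ← h2]
    refine tendsto_measure_iInter_atTop (fun n => (hA n).nullMeasurableSet) (fun m n hmn z hz => ?_)
      ⟨0, measure_ne_top _ _⟩
    have hz' : (n : ℝ) < |g z| := hz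
    exact lt_of_le_of_lt (Nat.cast_le.2 hmn) hz'
  -- The event that every set `{n < |g|}` is charged has probability at most `ν {n < |g|}` for each
  -- `n`, hence zero.
  have h3 : ∀ᵐ ω ∂P, ∃ n : ℕ, μ ω {z | (n : ℝ) < |g z|} = 0 := by
    rw [ae_iff, ← nonpos_iff_eq_zero]
    refine ge_of_tendsto' h1 fun n => ?_
    refine (measure_mono fun ω hω => ?_).trans
      (hμ.measure_apply_ne_zero_le (hA n) (measure_ne_top _ _))
    exact not_exists.1 hω n
  filter_upwards [h3, hμ.ae_lt_top] with ω ⟨n, hn⟩ hfin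
  have : IsFiniteMeasure (μ ω) := ⟨hfin⟩
  refine Integrable.of_bound hg.aestronglyMeasurable n ?_
  rw [ae_iff]
  simpa using hn

lemma charFun_map_real (hμ : IsPoissonRandomMeasure P ν μ) {A : Set S} (hA : MeasurableSet A)
    (hνA : ν A ≠ ∞) (u : ℝ) :
    charFun (P.map fun ω => (μ ω).real A) u
      = Complex.exp ((ν.real A : ℂ) * (Complex.exp (u * Complex.I) - 1)) := by
  have h1 : P.map (fun ω => (μ ω).real A)
      = (poissonMeasure (ν A).toNNReal).map (fun k : ℕ => (k : ℝ)) := by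
    have e : (fun ω => (μ ω).real A) = ENNReal.toReal ∘ fun ω => μ ω A := rfl
    rw [e, ← Measure.map_map ENNReal.measurable_toReal (hμ.measurable_apply hA),
      hμ.poisson A hA hνA, Measure.map_map ENNReal.measurable_toReal .of_discrete]
    congr 1
  rw [h1, charFun_map_cast_poissonMeasure]
  rfl

/-- The level sets of `g` are disjoint, so the integral is a sum of independent scaled Poisson
variables and the characteristic function factorises. -/
lemma integral_cexp_integral_simpleFunc (hμ : IsPoissonRandomMeasure P ν μ)
    [IsFiniteMeasure ν] [IsProbabilityMeasure P] (g : SimpleFunc S ℝ) :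
    ∫ ω, Complex.exp ((∫ z, g z ∂μ ω : ℝ) * Complex.I) ∂P
      = Complex.exp (∫ z, (Complex.exp (g z * Complex.I) - 1) ∂ν) := by
  obtain ⟨m, ⟨e⟩⟩ : ∃ m, Nonempty (Fin m ≃ g.range) := ⟨_, ⟨g.range.equivFin.symm⟩⟩
  have hind := hμ.indep m (fun k => g ⁻¹' {(e k : ℝ)}) (fun k => g.measurableSet_preimage _)
    fun k l hkl => Disjoint.preimage _ (by
      rw [disjoint_singleton]; exact fun h => hkl (e.injective (Subtype.ext h)))
  have hsum : ∀ h : ℝ → ℂ, ∑ c ∈ g.range, h c = ∑ k, h (e k) := fun h => by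
    rw [← Finset.sum_coe_sort, ← e.sum_comp]
  have hmeas' : ∀ k, Measurable fun ω => (μ ω).real (g ⁻¹' {(e k : ℝ)}) := fun k =>
    (hμ.measurable_apply (g.measurableSet_preimage _)).ennreal_toReal
  have hmeas : ∀ k, Measurable fun ω => (e k : ℝ) * (μ ω).real (g ⁻¹' {(e k : ℝ)}) := fun k => (hmeas' k).const_mul _
  have hind2 : iIndepFun (fun k ω => (e k : ℝ) * (μ ω).real (g ⁻¹' {(e k : ℝ)})) P :=
    hind.comp (fun k a => (e k : ℝ) * a.toReal) fun k => by fun_prop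
  have h1 : ∀ᵐ ω ∂P, ∫ z, g z ∂μ ω = ∑ k, (e k : ℝ) * (μ ω).real (g ⁻¹' {(e k : ℝ)}) := by
    filter_upwards [hμ.ae_lt_top] with ω hω
    have : IsFiniteMeasure (μ ω) := ⟨hω⟩
    rw [SimpleFunc.integral_eq_sum _ (SimpleFunc.integrable_of_isFiniteMeasure g),
      ← Finset.sum_coe_sort, ← e.sum_comp]
    simp [mul_comm]
  have h2 : ∫ ω, Complex.exp ((∫ z, g z ∂μ ω : ℝ) * Complex.I) ∂P
      = charFun (P.map fun ω => ∑ k, (e k : ℝ) * (μ ω).real (g ⁻¹' {(e k : ℝ)})) 1 := by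
    rw [charFun_apply_real, integral_map
      (Finset.measurable_sum _ fun k _ => hmeas k).aemeasurable (by fun_prop)]
    refine integral_congr_ae ?_
    filter_upwards [h1] with ω hω
    rw [hω]; simp
  rw [h2, hind2.charFun_map_fun_sum_eq_prod (fun k => (hmeas k).aemeasurable)]
  simp only [Finset.prod_apply]
  have h3 : ∀ k, charFun (P.map fun ω => (e k : ℝ) * (μ ω).real (g ⁻¹' {(e k : ℝ)})) 1
      = Complex.exp (ν.real (g ⁻¹' {(e k : ℝ)}) * (Complex.exp ((e k : ℝ) * Complex.I) - 1)) := by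
    intro k
    rw [← hμ.charFun_map_real (g.measurableSet_preimage _) (measure_ne_top _ _), charFun_apply_real,
      charFun_apply_real, integral_map (hmeas k).aemeasurable (by fun_prop), integral_map (hmeas' k).aemeasurable
        (by fun_prop)]
    simp
  simp only [h3]
  rw [← Complex.exp_sum, ← hsum fun c => ν.real (g ⁻¹' {c}) * (Complex.exp (c * Complex.I) - 1)]
  congr 1
  have h4 := SimpleFunc.map_integral g (fun c : ℝ => Complex.exp (c * Complex.I) - 1)
    (SimpleFunc.integrable_of_isFiniteMeasure (μ := ν) g) (by simp)
  rw [SimpleFunc.integral_eq_integral _ (SimpleFunc.integrable_of_isFiniteMeasure _)] at h4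
  simpa using h4.symm

/-- The characteristic function of an integral with respect to a Poisson random measure. -/
lemma integral_cexp_integral (hμ : IsPoissonRandomMeasure P ν μ)
    [IsFiniteMeasure ν] [IsProbabilityMeasure P] {g : S → ℝ} (hg : Measurable g) :
    ∫ ω, Complex.exp ((∫ z, g z ∂μ ω : ℝ) * Complex.I) ∂P
      = Complex.exp (∫ z, (Complex.exp (g z * Complex.I) - 1) ∂ν) := by
  set G : ℕ → SimpleFunc S ℝ := fun n => SimpleFunc.approxOn g hg univ 0 (mem_univ 0) n with hG
  have hlim : ∀ z, Tendsto (fun n => G n z) atTop (𝓝 (g z)) := fun z =>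
    SimpleFunc.tendsto_approxOn hg (mem_univ 0) (by simp)
  have hGm : ∀ n, AEStronglyMeasurable
      (fun ω => Complex.exp ((∫ z, G n z ∂μ ω : ℝ) * Complex.I)) P := by
    refine fun n => Measurable.aestronglyMeasurable ?_
    have := (measurable_integral_measure (G n).measurable).comp hμ.measurable
    fun_prop
  -- Both sides pass to the limit by dominated convergence; on the left the inner integrals converge
  -- for almost every `ω`, since `g` is almost surely integrable.
  refine tendsto_nhds_unique (f := fun n : ℕ => ∫ ω, Complex.exp ((∫ z, G n z ∂μ ω : ℝ) * Complex.I) ∂P) (l := atTop) ?_ ?_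
  · refine tendsto_integral_of_dominated_convergence (fun _ => 1) hGm (integrable_const _)
      (fun n => .of_forall fun ω => (Complex.norm_exp_ofReal_mul_I _).le) ?_
    filter_upwards [hμ.ae_integrable hg] with ω hω
    have h1 : Tendsto (fun n => ∫ z, G n z ∂μ ω) atTop (𝓝 (∫ z, g z ∂μ ω)) :=
      tendsto_integral_of_dominated_convergence (fun z => ‖g z‖ + ‖g z‖)
        (fun n => (G n).aestronglyMeasurable) (hω.norm.add hω.norm)
        (fun n => .of_forall fun z => SimpleFunc.norm_approxOn_zero_le hg (mem_univ 0) z n)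
        (.of_forall hlim)
    exact ((Complex.continuous_exp.comp (by fun_prop : Continuous fun u : ℝ => (u : ℂ) * Complex.I)).tendsto _).comp h1
  · simp only [hμ.integral_cexp_integral_simpleFunc]
    refine (Complex.continuous_exp.tendsto _).comp ?_
    refine tendsto_integral_of_dominated_convergence (fun _ => 2) (fun n => ?_) (integrable_const _)
      (fun n => .of_forall fun z => ?_) (.of_forall fun z => ?_)
    · exact (by fun_prop : Continuous fun u : ℝ => Complex.exp (u * Complex.I) - 1).comp_aestronglyMeasurable (G n).aestronglyMeasurable
    · refine (norm_sub_le _ _).trans ?_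
      rw [Complex.norm_exp_ofReal_mul_I]; norm_num
    · exact ((by fun_prop : Continuous fun u : ℝ => Complex.exp (u * Complex.I) - 1).tendsto _).comp (hlim z)

end IsPoissonRandomMeasure

/-! ### Compound Poisson distributions -/

/-- The convolution power of a measure on the line. -/
def convPow (η : Measure ℝ) : ℕ → Measure ℝ
  | 0 => Measure.dirac 0
  | m + 1 => η.conv (convPow η m)

/-- The law of a compound Poisson process with jump measure `η` at time `h`. -/
def compoundPoisson (η : Measure ℝ) (h : ℝ) : Measure ℝ :=
  Measure.sum fun m : ℕ => ENNReal.ofReal (Real.exp (-(η.real univ * h)) *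
      ((m.factorial : ℝ)⁻¹ * h ^ m)) • convPow η m

section CompoundPoisson

variable (η : Measure ℝ) [IsFiniteMeasure η]

instance isFiniteMeasure_convPow (m : ℕ) : IsFiniteMeasure (convPow η m) := by
  induction m with
  | zero => exact inferInstanceAs (IsFiniteMeasure (Measure.dirac 0))
  | succ m ih => exact inferInstanceAs (IsFiniteMeasure (η.conv (convPow η m)))

lemma integral_convPow (ψ : ℝ →ᵇ ℝ) (m : ℕ) (x : ℝ) :
    ∫ y, ψ (x + y) ∂convPow η m = (shiftAvg η ^ m) ψ x := by
  induction m generalizing x with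
  | zero => simp [convPow]
  | succ m ih =>
    rw [convPow, integral_conv (integrable_comp_add _ ψ x), pow_succ']
    change _ = ∫ e, (shiftAvg η ^ m) ψ (x + e) ∂η
    simp only [← ih, add_assoc]

lemma charFun_convPow (m : ℕ) (u : ℝ) : charFun (convPow η m) u = charFun η u ^ m := by
  induction m with
  | zero => simp [convPow, charFun_apply_real]
  | succ m ih => rw [convPow, charFun_conv, ih, pow_succ']

lemma convPow_real_univ (m : ℕ) : (convPow η m).real univ = η.real univ ^ m := by
  have := charFun_convPow η m 0
  simp only [charFun_zero] at this
  exact_mod_cast this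

lemma isProbabilityMeasure_compoundPoisson {h : ℝ} (hh : 0 ≤ h) :
    IsProbabilityMeasure (compoundPoisson η h) := by
  have h1 := (hasSum_real_exp (η.real univ * h)).mul_left (Real.exp (-(η.real univ * h)))
  rw [← Real.exp_add, neg_add_cancel, Real.exp_zero] at h1
  refine ⟨?_⟩
  rw [compoundPoisson, Measure.sum_apply _ .univ]
  have h2 : ∀ m : ℕ, (ENNReal.ofReal (Real.exp (-(η.real univ * h)) *
      ((m.factorial : ℝ)⁻¹ * h ^ m)) • convPow η m) univ
      = ENNReal.ofReal (Real.exp (-(η.real univ * h)) *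
        ((m.factorial : ℝ)⁻¹ * (η.real univ * h) ^ m)) := fun m => by
    rw [Measure.smul_apply, smul_eq_mul, ← ofReal_measureReal, convPow_real_univ,
      ← ENNReal.ofReal_mul (by positivity), mul_pow]
    congr 1; ring
  simp only [h2]
  rw [← ENNReal.ofReal_tsum_of_nonneg (fun m => by positivity) h1.summable, h1.tsum_eq,
    ENNReal.ofReal_one]

lemma hasSum_integral_compoundPoisson (η : Measure ℝ) {E : Type*} [NormedAddCommGroup E] [NormedSpace ℝ E]
    {h : ℝ} (hh : 0 ≤ h) {g : ℝ → E}
    (hg : Integrable g (compoundPoisson η h)) :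
    HasSum (fun m : ℕ => (Real.exp (-(η.real univ * h)) * ((m.factorial : ℝ)⁻¹ * h ^ m)) •
      ∫ y, g y ∂convPow η m) (∫ y, g y ∂compoundPoisson η h) := by
  have h1 := hasSum_integral_measure hg
  refine h1.congr_fun fun m => ?_
  rw [integral_smul_measure, ENNReal.toReal_ofReal (by positivity)]

/-- Identifies the analytic group, at nonnegative times, with the transition semigroup of the
compound Poisson process, by comparing both series jump by jump. -/
lemma integral_compoundPoisson {h : ℝ} (hh : 0 ≤ h) (ψ : ℝ →ᵇ ℝ) (x : ℝ) :
    ∫ y, ψ (x + y) ∂compoundPoisson η h = evol (gen η) h ψ x := by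
  have := isProbabilityMeasure_compoundPoisson η hh
  have h1 := hasSum_integral_compoundPoisson η hh (integrable_comp_add (compoundPoisson η h) ψ x)
  refine h1.unique ((hasSum_evol_gen_apply η h ψ x).congr_fun fun m => ?_)
  rw [integral_convPow, smul_eq_mul]; ring

lemma charFun_compoundPoisson {h : ℝ} (hh : 0 ≤ h) (u : ℝ) :
    charFun (compoundPoisson η h) u = Complex.exp (h * (charFun η u - η.real univ)) := by
  have := isProbabilityMeasure_compoundPoisson η hh
  have hi : Integrable (fun y : ℝ => Complex.exp (u * y * Complex.I)) (compoundPoisson η h) :=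
    Integrable.of_bound (by fun_prop) 1 (.of_forall fun y => by
      rw [← Complex.ofReal_mul, Complex.norm_exp_ofReal_mul_I])
  have h1 := hasSum_integral_compoundPoisson η hh hi
  simp only [← charFun_apply_real, charFun_convPow] at h1
  refine h1.unique ?_
  have h2 := (NormedSpace.expSeries_div_hasSum_exp (h * charFun η u)).mul_left
    (Complex.exp (-(η.real univ * h)))
  rw [← Complex.exp_eq_exp_ℂ, ← Complex.exp_add] at h2
  have e : (h : ℂ) * (charFun η u - η.real univ) = -(η.real univ * h) + h * charFun η u := by ring
  rw [e]
  refine h2.congr_fun fun m => ?_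
  rw [Complex.real_smul, mul_pow]
  push_cast
  ring

end CompoundPoisson

/-! ### The law of the forward process -/

section Forward

variable {Ω : Type*} [mΩ : MeasurableSpace Ω] {P : Measure Ω} {ℱ : Filtration ℝ≥0 mΩ}
  {μ : Ω → Measure (ℝ × ℝ)} {γ : ℝ → ℝ} {T : ℝ}

lemma measurable_restrict {S : Type*} [MeasurableSpace S] {D : Set S} (hD : MeasurableSet D) :
    Measurable fun m : Measure S => m.restrict D :=
  Measure.measurable_of_measurable_coe _ fun B hB => by
    simp only [Measure.restrict_apply hB]
    exact Measure.measurable_coe (hB.inter hD)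

lemma measurable_integral_restrict {α : Type*} {m : MeasurableSpace α} {κ : α → Measure (ℝ × ℝ)}
    {D D' : Set (ℝ × ℝ)} (hκ : Measurable fun ω => (κ ω).restrict D') (hD : MeasurableSet D)
    (hDD' : D ⊆ D') {g : ℝ × ℝ → ℝ} (hg : Measurable g) :
    Measurable fun ω => ∫ z in D, g z ∂κ ω := by
  have h1 : ∀ ω, (κ ω).restrict D = ((κ ω).restrict D').restrict D := fun ω => by
    rw [Measure.restrict_restrict hD, inter_eq_left.2 hDD']
  simp only [h1]
  exact (measurable_integral_measure hg).comp ((measurable_restrict hD).comp hκ)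

lemma IsCompatible.measurable_forward (hc : IsCompatible P ℱ μ) (t x : ℝ) (s : ℝ≥0) :
    Measurable[ℱ s] (forward μ t x s) :=
  Measurable.const_add (measurable_integral_restrict (hc.adapted s)
    (measurableSet_Ioc.prod .univ) (prod_mono Ioc_subset_Iic_self le_rfl) measurable_snd) x

lemma compensator_restrict {s r : ℝ} (hs : 0 ≤ s) (hr : r ≤ T) [SFinite (jumpMeasure γ)] :
    (compensator γ T).restrict (Ioc s r ×ˢ univ)
      = ((volume : Measure ℝ).restrict (Ioc s r)).prod (jumpMeasure γ) := by
  rw [compensator, ← Measure.prod_restrict, Measure.restrict_univ,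
    Measure.restrict_restrict measurableSet_Ioc, inter_eq_left.2 (Ioc_subset_Ioc hs hr)]

/-- Increments of the forward process have a compound Poisson law. -/
lemma IsPoissonRandomMeasure.map_increment [IsProbabilityMeasure P] [IsFiniteMeasure (jumpMeasure γ)]
    (hμ : IsPoissonRandomMeasure P (compensator γ T) μ) {s r : ℝ} (hs : 0 ≤ s) (hsr : s ≤ r)
    (hr : r ≤ T) :
    P.map (fun ω => ∫ z in Ioc s r ×ˢ univ, z.2 ∂μ ω) = compoundPoisson (jumpMeasure γ) (r - s) := by
  have := isProbabilityMeasure_compoundPoisson (jumpMeasure γ) (sub_nonneg.2 hsr)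
  have : IsFiniteMeasure (compensator γ T) := by rw [compensator]; infer_instance
  have hD : MeasurableSet (Ioc s r ×ˢ (univ : Set ℝ)) := measurableSet_Ioc.prod .univ
  have hm : Measurable fun ω => ∫ z in Ioc s r ×ˢ univ, z.2 ∂μ ω :=
    (measurable_integral_measure measurable_snd).comp
      ((measurable_restrict hD).comp hμ.measurable)
  refine Measure.ext_of_charFun ?_
  ext u
  rw [charFun_compoundPoisson _ (sub_nonneg.2 hsr), charFun_apply_real,
    integral_map hm.aemeasurable (by fun_prop)]
  -- The indicator moves the restriction to `(s, r]` into the integrand, where the exponential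
  -- formula for the whole of `μ` applies.
  have h1 := hμ.integral_cexp_integral
    (g := (Ioc s r ×ˢ (univ : Set ℝ)).indicator fun z => u * z.2) (by fun_prop)
  simp only [integral_indicator hD, integral_const_mul] at h1
  push_cast at h1
  rw [h1]
  congr 1
  have h2 : (fun z : ℝ × ℝ => Complex.exp (((Ioc s r ×ˢ (univ : Set ℝ)).indicator
      (fun z => u * z.2) z : ℝ) * Complex.I) - 1) = (Ioc s r ×ˢ (univ : Set ℝ)).indicator
      fun z => (Complex.exp (u * z.2 * Complex.I) - 1) := by
    ext z
    by_cases hz : z ∈ Ioc s r ×ˢ (univ : Set ℝ) <;> simp [hz]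
  rw [h2, integral_indicator hD, compensator_restrict hs hr,
    integral_fun_snd (fun e : ℝ => Complex.exp (u * e * Complex.I) - 1), integral_sub
      (Integrable.of_bound (by fun_prop) 1 (.of_forall fun y => by
        rw [← Complex.ofReal_mul, Complex.norm_exp_ofReal_mul_I])) (integrable_const _),
    ← charFun_apply_real]
  simp [hsr]

/-- The Markov property of the forward process. -/
lemma setIntegral_comp_forward [IsProbabilityMeasure P] [IsFiniteMeasure (jumpMeasure γ)]
    (hμ : IsPoissonRandomMeasure P (compensator γ T) μ) (hc : IsCompatible P ℱ μ) {t : ℝ} (x : ℝ)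
    {s : ℝ≥0} {r : ℝ} (hts : t ≤ s) (hsr : s ≤ r) (hr : r ≤ T) {A : Set Ω}
    (hA : MeasurableSet[ℱ s] A) (ψ : ℝ →ᵇ ℝ) :
    ∫ ω in A, ψ (forward μ t x r ω) ∂P
      = ∫ ω in A, evol (gen (jumpMeasure γ)) (r - s) ψ (forward μ t x s ω) ∂P := by
  have : IsFiniteMeasure (compensator γ T) := by rw [compensator]; infer_instance
  have hA' : MeasurableSet A := ℱ.le s _ hA
  set Z : Ω → ℝ := fun ω => ∫ z in Ioc (s : ℝ) r ×ˢ univ, z.2 ∂μ ω with hZ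
  -- The indicator of the event `A` is carried along with `X_s`, so that one independence statement,
  -- between `V` and the increment `Z`, suffices.
  set V : Ω → ℝ × ℝ := fun ω => (forward μ t x s ω, A.indicator 1 ω) with hV
  have hVm : Measurable[ℱ s] V := (hc.measurable_forward t x s).prodMk
    (measurable_const.indicator hA)
  have hVm' : Measurable V := hVm.mono (ℱ.le s) le_rfl
  have hZm : Measurable Z := (measurable_integral_measure measurable_snd).comp
      ((measurable_restrict (measurableSet_Ioc.prod .univ)).comp hμ.measurable)
  have hind : IndepFun V Z P := by
    rw [IndepFun_iff_Indep]
    refine indep_of_indep_of_le_left (indep_of_indep_of_le_right (hc.indep s) ?_) hVm.comap_le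
    refine Measurable.comap_le ?_
    exact measurable_integral_restrict (D' := Ioi (s : ℝ) ×ˢ univ) (comap_measurable _)
      (measurableSet_Ioc.prod .univ) (prod_mono Ioc_subset_Ioi_self le_rfl) measurable_snd
  have hlaw : P.map (fun ω => (V ω, Z ω))
      = (P.map V).prod (compoundPoisson (jumpMeasure γ) (r - s)) := by
    rw [hind.map_prod_eq_prod_map_map hVm'.aemeasurable hZm.aemeasurable,
      hZ, hμ.map_increment s.coe_nonneg hsr hr]
  -- Additivity over adjacent time intervals needs integrable jump sizes, hence holds only almost
  -- surely.
  have hsplit : ∀ᵐ ω ∂P, forward μ t x r ω = (V ω).1 + Z ω := by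
    filter_upwards [hμ.ae_integrable measurable_snd] with ω hω
    rw [hV, hZ]
    simp only [forward]
    rw [add_assoc, ← setIntegral_union _ (measurableSet_Ioc.prod .univ) hω.integrableOn
      hω.integrableOn, ← union_prod, Ioc_union_Ioc_eq_Ioc hts hsr]
    exact Disjoint.set_prod_left (Ioc_disjoint_Ioc_of_le le_rfl) _ _
  have := isProbabilityMeasure_compoundPoisson (jumpMeasure γ) (sub_nonneg.2 hsr)
  have hVp : IsProbabilityMeasure (P.map V) := Measure.isProbabilityMeasure_map hVm'.aemeasurable
  calc _ = ∫ ω, (V ω).2 * ψ ((V ω).1 + Z ω) ∂P := by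
        rw [← integral_indicator hA']
        refine integral_congr_ae ?_
        filter_upwards [hsplit] with ω hω
        by_cases h : ω ∈ A <;> simp [hV, h]
        rw [hω]
    _ = ∫ q, q.1.2 * ψ (q.1.1 + q.2) ∂P.map (fun ω => (V ω, Z ω)) := by
        rw [integral_map (hVm'.prodMk hZm).aemeasurable]
        exact Measurable.aestronglyMeasurable (by fun_prop)
    _ = ∫ q, q.2 * evol (gen (jumpMeasure γ)) (r - s) ψ q.1 ∂P.map V := by
        rw [hlaw, integral_prod]
        · simp only [integral_const_mul, integral_compoundPoisson _ (sub_nonneg.2 hsr)]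
        · rw [← hlaw, integrable_map_measure (Measurable.aestronglyMeasurable (by fun_prop))
            (hVm'.prodMk hZm).aemeasurable]
          refine Integrable.of_bound (Measurable.aestronglyMeasurable ?_) ‖ψ‖ (.of_forall fun ω => ?_)
          · fun_prop
          · by_cases h : ω ∈ A
            · simpa [hV, h] using ψ.norm_coe_le_norm (forward μ t x s ω + Z ω)
            · simp [hV, h]
    _ = _ := by
        rw [integral_map hVm'.aemeasurable (Measurable.aestronglyMeasurable (by fun_prop)),
          ← integral_indicator hA']
        refine integral_congr_ae (.of_forall fun ω => ?_)
        by_cases h : ω ∈ A <;> simp [hV, h]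

end Forward

/-! ### Random measures as kernels -/

section Kernel

variable {Ω S : Type*} [MeasurableSpace Ω] [MeasurableSpace S] {μ : Ω → Measure S}

lemma measurableSet_floor_mass (hm : Measurable μ) (n : ℕ) :
    MeasurableSet {ω | μ ω univ < ∞ ∧ ⌊(μ ω univ).toReal⌋₊ = n} := by
  have h1 : Measurable fun ω => μ ω univ := (Measure.measurable_coe .univ).comp hm
  exact (measurableSet_lt h1 measurable_const).inter
    (measurableSet_eq_fun (Nat.measurable_floor.comp h1.ennreal_toReal) measurable_const)

/-- A random measure as an s-finite kernel, set to zero where the measure is infinite. -/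
def finiteKernel (μ : Ω → Measure S) (hm : Measurable μ) : ProbabilityTheory.Kernel Ω S :=
  Kernel.sum fun n : ℕ => Kernel.piecewise (measurableSet_floor_mass hm n) ⟨μ, hm⟩ 0

instance isSFiniteKernel_finiteKernel (hm : Measurable μ) : IsSFiniteKernel (finiteKernel μ hm) := by
  have h1 : ∀ n, IsFiniteKernel
      (Kernel.piecewise (measurableSet_floor_mass hm n) ⟨μ, hm⟩ (0 : ProbabilityTheory.Kernel Ω S)) := fun n => by
    refine ⟨⟨ENNReal.ofReal (n + 1), ENNReal.ofReal_lt_top, fun ω => ?_⟩⟩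
    rw [Kernel.piecewise_apply']
    split_ifs with h
    · change μ ω univ ≤ _
      rw [← ENNReal.ofReal_toReal h.1.ne]
      refine ENNReal.ofReal_le_ofReal ?_
      rw [← h.2]
      exact (Nat.lt_floor_add_one _).le
    · simp
  rw [finiteKernel]
  infer_instance

lemma finiteKernel_apply (hm : Measurable μ) {ω : Ω} (hω : μ ω univ < ∞) :
    finiteKernel μ hm ω = μ ω := by
  ext s hs
  rw [finiteKernel, Kernel.sum_apply' _ _ hs, tsum_eq_single ⌊(μ ω univ).toReal⌋₊]
  · rw [Kernel.piecewise_apply', if_pos ⟨hω, rfl⟩]; rfl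
  · intro n hn
    rw [Kernel.piecewise_apply', if_neg fun h => hn h.2.symm]; rfl

end Kernel

/-! ### The predictable compensator -/

section Predictable

variable {Ω : Type*} [mΩ : MeasurableSpace Ω] {P : Measure Ω} {ℱ : Filtration ℝ≥0 mΩ}
  {μ : Ω → Measure (ℝ × ℝ)} {γ : ℝ → ℝ} {T : ℝ}

/-- The σ-algebra of predictable functions of time, scenario and mark. -/
abbrev markedPredictable (ℱ : Filtration ℝ≥0 mΩ) : MeasurableSpace ((ℝ≥0 × Ω) × ℝ) :=
  MeasurableSpace.prod ℱ.predictable (borel ℝ)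

lemma predictable_le (ℱ : Filtration ℝ≥0 mΩ) : ℱ.predictable ≤ Prod.instMeasurableSpace :=
  measurableSpace_le_predictable_of_measurableSet
    (fun _ hA => (measurableSet_singleton _).prod (ℱ.le _ _ hA))
    (fun i _ hA => measurableSet_Ioi.prod (ℱ.le i _ hA))

lemma markedPredictable_le (ℱ : Filtration ℝ≥0 mΩ) :
    markedPredictable ℱ ≤ Prod.instMeasurableSpace :=
  sup_le_sup (MeasurableSpace.comap_mono (predictable_le ℱ)) le_rfl

/-- The generators of the predictable σ-algebra. -/
def predictableRect (ℱ : Filtration ℝ≥0 mΩ) : Set (Set (ℝ≥0 × Ω)) :=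
  {s | ∃ A, MeasurableSet[ℱ ⊥] A ∧ s = {⊥} ×ˢ A} ∪
    {s | ∃ i A, MeasurableSet[ℱ i] A ∧ s = Ioi i ×ˢ A}

lemma isCountablySpanning_predictableRect : IsCountablySpanning (predictableRect ℱ) := by
  refine ⟨fun n => if n = 0 then {⊥} ×ˢ univ else Ioi ⊥ ×ˢ univ, fun n => ?_, ?_⟩
  · by_cases hn : n = 0
    · exact .inl ⟨univ, .univ, by simp [hn]⟩
    · exact .inr ⟨⊥, univ, .univ, by simp [hn]⟩
  · refine eq_univ_of_forall fun q => ?_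
    rcases eq_bot_or_bot_lt q.1 with h | h
    · exact mem_iUnion.2 ⟨0, by simp [h]⟩
    · exact mem_iUnion.2 ⟨1, by simpa using h⟩

lemma isPiSystem_predictableRect : IsPiSystem (predictableRect ℱ) := by
  rintro _ (⟨A, hA, rfl⟩ | ⟨i, A, hA, rfl⟩) _ (⟨B, hB, rfl⟩ | ⟨j, B, hB, rfl⟩) hne
  · exact .inl ⟨A ∩ B, hA.inter hB, by rw [prod_inter_prod, inter_self]⟩
  · obtain ⟨q, hq⟩ := hne
    have h1 : q.1 = ⊥ := hq.1.1
    exact absurd (h1 ▸ hq.2.1 : (⊥ : ℝ≥0) ∈ Ioi j) (notMem_Ioi.2 bot_le)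
  · obtain ⟨q, hq⟩ := hne
    have h1 : q.1 = ⊥ := hq.2.1
    exact absurd (h1 ▸ hq.1.1 : (⊥ : ℝ≥0) ∈ Ioi i) (notMem_Ioi.2 bot_le)
  · refine .inr ⟨i ⊔ j, A ∩ B, (ℱ.mono le_sup_left _ hA).inter (ℱ.mono le_sup_right _ hB), ?_⟩
    rw [prod_inter_prod, Ioi_inter_Ioi]

lemma markedPredictable_eq_generateFrom : markedPredictable ℱ
    = MeasurableSpace.generateFrom (image2 (· ×ˢ ·) (predictableRect ℱ) {B | MeasurableSet B}) := by
  rw [← generateFrom_prod_eq isCountablySpanning_predictableRect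
    isCountablySpanning_measurableSet, MeasurableSpace.generateFrom_measurableSet]
  rfl

/-- The change of variables from scenario and time-mark pairs. -/
def markedPoint (q : Ω × (ℝ × ℝ)) : (ℝ≥0 × Ω) × ℝ := ((q.2.1.toNNReal, q.1), q.2.2)

lemma measurable_markedPoint : Measurable (markedPoint (Ω := Ω)) := by
  unfold markedPoint
  fun_prop

lemma preimage_markedPoint_Ioi {Ω : Type*} (i : ℝ≥0) (A : Set Ω) (B : Set ℝ) :
    markedPoint ⁻¹' ((Ioi i ×ˢ A) ×ˢ B) = A ×ˢ (Ioi (i : ℝ) ×ˢ B) := by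
  ext q
  simp only [markedPoint, mem_preimage, mem_prod, mem_Ioi, Real.lt_toNNReal_iff_coe_lt]
  tauto

/-- Negative times are also sent to zero by `Real.toNNReal`, so the preimage may contain them. The
whole region of nonpositive times is null for the compensator, hence for the random measure. -/
lemma preimage_markedPoint_bot_subset {Ω : Type*} (A : Set Ω) (B : Set ℝ) :
    markedPoint ⁻¹' (({⊥} ×ˢ A) ×ˢ B) ⊆ univ ×ˢ (Iic 0 ×ˢ univ) := by
  rintro q ⟨⟨h, -⟩, -⟩
  refine ⟨mem_univ _, ?_, mem_univ _⟩
  exact Real.toNNReal_eq_zero.1 h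

lemma compensator_Iic_zero [SFinite (jumpMeasure γ)] :
    compensator γ T (Iic 0 ×ˢ univ) = 0 := by
  rw [compensator, Measure.prod_prod, Measure.restrict_apply measurableSet_Iic,
    disjoint_iff_inter_eq_empty.1 (Iic_disjoint_Ioc le_rfl), measure_empty, zero_mul]

lemma compProd_finiteKernel_prod [IsProbabilityMeasure P] [IsFiniteMeasure (compensator γ T)]
    (hμ : IsPoissonRandomMeasure P (compensator γ T) μ) {A : Set Ω} {D : Set (ℝ × ℝ)}
    (hA : MeasurableSet A) (hD : MeasurableSet D) :
    (P ⊗ₘ finiteKernel μ hμ.measurable) (A ×ˢ D) = ∫⁻ ω in A, μ ω D ∂P := by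
  rw [Measure.compProd_apply_prod hA hD]
  refine lintegral_congr_ae (ae_restrict_of_ae ?_)
  filter_upwards [hμ.ae_lt_top] with ω hω
  rw [finiteKernel_apply _ hω]

lemma setLIntegral_apply_Ioi [IsProbabilityMeasure P] [IsFiniteMeasure (compensator γ T)]
    (hμ : IsPoissonRandomMeasure P (compensator γ T) μ) (hc : IsCompatible P ℱ μ) {i : ℝ≥0}
    {A : Set Ω} {B : Set ℝ} (hA : MeasurableSet[ℱ i] A) (hB : MeasurableSet B) :
    ∫⁻ ω in A, μ ω (Ioi (i : ℝ) ×ˢ B) ∂P = P A * compensator γ T (Ioi (i : ℝ) ×ˢ B) := by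
  have hD : MeasurableSet (Ioi (i : ℝ) ×ˢ B) := measurableSet_Ioi.prod hB
  have hm : Measurable fun ω => (μ ω).restrict (Ioi (i : ℝ) ×ˢ univ) :=
    (measurable_restrict (measurableSet_Ioi.prod .univ)).comp hμ.measurable
  have h1 := lintegral_mul_eq_lintegral_mul_lintegral_of_independent_measurableSpace (ℱ.le i)
    hm.comap_le (hc.indep i) (f := A.indicator 1) (g := fun ω => μ ω (Ioi (i : ℝ) ×ˢ B))
    (measurable_const.indicator hA) (by
      have : (fun ω => μ ω (Ioi (i : ℝ) ×ˢ B))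
          = fun ω => (μ ω).restrict (Ioi (i : ℝ) ×ˢ univ) (Ioi (i : ℝ) ×ˢ B) := by
        ext ω
        rw [Measure.restrict_apply hD, inter_eq_left.2 (prod_mono le_rfl (subset_univ _))]
      rw [this]
      exact (Measure.measurable_coe hD).comp (comap_measurable _))
  rw [lintegral_indicator_one (ℱ.le i _ hA), hμ.lintegral_apply hD (measure_ne_top _ _)] at h1
  rw [← h1, ← lintegral_indicator (ℱ.le i _ hA)]
  refine lintegral_congr fun ω => ?_
  by_cases h : ω ∈ A <;> simp [h]

/-- On predictable sets, the random measure and its compensator have the same expectation. -/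
lemma map_markedPoint_trim_eq [IsProbabilityMeasure P] [IsFiniteMeasure (jumpMeasure γ)]
    (hμ : IsPoissonRandomMeasure P (compensator γ T) μ) (hc : IsCompatible P ℱ μ) :
    ((P ⊗ₘ finiteKernel μ hμ.measurable).map markedPoint).trim (markedPredictable_le ℱ)
      = ((P.prod (compensator γ T)).map markedPoint).trim (markedPredictable_le ℱ) := by
  have : IsFiniteMeasure (compensator γ T) := by rw [compensator]; infer_instance
  have hle := markedPredictable_le ℱ
  have huniv : ((P ⊗ₘ finiteKernel μ hμ.measurable).map markedPoint) univ
      = ((P.prod (compensator γ T)).map markedPoint) univ := by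
    rw [Measure.map_apply measurable_markedPoint .univ, Measure.map_apply measurable_markedPoint .univ,
      preimage_univ, ← univ_prod_univ, compProd_finiteKernel_prod hμ .univ .univ, setLIntegral_univ,
      hμ.lintegral_apply .univ (measure_ne_top _ _), Measure.prod_prod, measure_univ (μ := P), one_mul]
  have : IsFiniteMeasure ((P ⊗ₘ finiteKernel μ hμ.measurable).map markedPoint) :=
    ⟨by rw [huniv]; exact measure_lt_top _ _⟩
  have := isFiniteMeasure_trim (μ := (P ⊗ₘ finiteKernel μ hμ.measurable).map markedPoint) hle
  have hZ0 : MeasurableSet (Iic (0 : ℝ) ×ˢ (univ : Set ℝ)) := measurableSet_Iic.prod .univ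
  -- Uniqueness of finite measures on the π-system of predictable rectangles. The measures are
  -- trimmed because they agree only on predictable sets: the independence of the jumps after time
  -- `i` from `ℱ i` enters through the rectangles `Ioi i ×ˢ A`.
  refine @ext_of_generate_finite _ (markedPredictable ℱ) _ _ _ markedPredictable_eq_generateFrom
    (isPiSystem_predictableRect.prod MeasurableSpace.isPiSystem_measurableSet) _ ?_ ?_
  · intro s hs
    have hs' : MeasurableSet[markedPredictable ℱ] s := by
      rw [markedPredictable_eq_generateFrom]
      exact MeasurableSpace.measurableSet_generateFrom hs
    rw [trim_measurableSet_eq hle hs', trim_measurableSet_eq hle hs',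
      Measure.map_apply measurable_markedPoint (hle _ hs'),
      Measure.map_apply measurable_markedPoint (hle _ hs')]
    obtain ⟨_, ⟨A, hA, rfl⟩ | ⟨i, A, hA, rfl⟩, B, hB, rfl⟩ := hs
    · rw [measure_mono_null (preimage_markedPoint_bot_subset A B),
        measure_mono_null (preimage_markedPoint_bot_subset A B)]
      · rw [Measure.prod_prod, compensator_Iic_zero, mul_zero]
      · rw [compProd_finiteKernel_prod hμ .univ hZ0, setLIntegral_univ,
          hμ.lintegral_apply hZ0 (measure_ne_top _ _), compensator_Iic_zero]
    · simp only [preimage_markedPoint_Ioi]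
      rw [compProd_finiteKernel_prod hμ (ℱ.le i _ hA) (measurableSet_Ioi.prod hB),
        setLIntegral_apply_Ioi hμ hc hA hB, Measure.prod_prod]
  · rw [trim_measurableSet_eq hle .univ, trim_measurableSet_eq hle .univ, huniv]

/-- The compensation formula. -/
lemma integral_markedPoint_eq [IsProbabilityMeasure P] [IsFiniteMeasure (jumpMeasure γ)]
    (hμ : IsPoissonRandomMeasure P (compensator γ T) μ) (hc : IsCompatible P ℱ μ)
    {H : (ℝ≥0 × Ω) × ℝ → ℝ} (hH : Measurable[markedPredictable ℱ] H)
    (hi : Integrable (fun q => H (markedPoint q)) (P.prod (compensator γ T))) :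
    Integrable (fun q => H (markedPoint q)) (P ⊗ₘ finiteKernel μ hμ.measurable) ∧
      ∫ q, H (markedPoint q) ∂(P ⊗ₘ finiteKernel μ hμ.measurable)
        = ∫ q, H (markedPoint q) ∂(P.prod (compensator γ T)) := by
  have hle := markedPredictable_le ℱ
  have hHs : StronglyMeasurable[markedPredictable ℱ] H := hH.stronglyMeasurable
  have hHm : Measurable H := hH.mono hle le_rfl
  have heq := map_markedPoint_trim_eq hμ hc
  have h1 : Integrable H ((P.prod (compensator γ T)).map markedPoint) :=
    (integrable_map_measure hHm.aestronglyMeasurable measurable_markedPoint.aemeasurable).2 hi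
  have h2 : Integrable H ((P ⊗ₘ finiteKernel μ hμ.measurable).map markedPoint) := by
    refine integrable_of_integrable_trim hle ?_
    rw [heq]
    exact h1.trim hle hHs
  refine ⟨(integrable_map_measure hHm.aestronglyMeasurable
    measurable_markedPoint.aemeasurable).1 h2, ?_⟩
  rw [← integral_map measurable_markedPoint.aemeasurable hHm.aestronglyMeasurable,
    ← integral_map measurable_markedPoint.aemeasurable hHm.aestronglyMeasurable,
    integral_trim hle hHs, heq, ← integral_trim hle hHs]

end Predictable

/-! ### Compensated integrals are orthogonal to the past -/

section Martingale

variable {Ω : Type*} [mΩ : MeasurableSpace Ω] {P : Measure Ω} {ℱ : Filtration ℝ≥0 mΩ}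
  {μ : Ω → Measure (ℝ × ℝ)} {γ : ℝ → ℝ} {T : ℝ}

/-- The integrand `U` localised to the event `A` and to the times in `(s, T]`. -/
def localised {Ω : Type*} (U : ℝ → Ω → ℝ → ℝ) (A : Set Ω) (s T : ℝ≥0) : (ℝ≥0 × Ω) × ℝ → ℝ :=
  ((Ioc s T ×ˢ A) ×ˢ univ).indicator fun q => U q.1.1 q.1.2 q.2

lemma measurable_localised {U : ℝ → Ω → ℝ → ℝ}
    (hU : Measurable[markedPredictable ℱ] fun q : (ℝ≥0 × Ω) × ℝ => U q.1.1 q.1.2 q.2)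
    {A : Set Ω} {s : ℝ≥0} (hA : MeasurableSet[ℱ s] A) (T : ℝ≥0) :
    Measurable[markedPredictable ℱ] (localised U A s T) := by
  refine hU.indicator ?_
  exact @MeasurableSet.prod _ _ ℱ.predictable (borel ℝ) _ _
    (measurableSet_predictable_Ioc_prod s T hA) MeasurableSet.univ

lemma localised_markedPoint {Ω : Type*} (U : ℝ → Ω → ℝ → ℝ) (A : Set Ω) (s T : ℝ≥0) (ω : Ω) (z : ℝ × ℝ) :
    localised U A s T (markedPoint (ω, z))
      = A.indicator (fun ω => (Ioc (s : ℝ) T ×ˢ univ).indicator (fun z => U z.1 ω z.2) z) ω := by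
  have h1 : z.1.toNNReal ∈ Ioc s T ↔ z.1 ∈ Ioc (s : ℝ) T := by
    rw [mem_Ioc, mem_Ioc, Real.lt_toNNReal_iff_coe_lt, Real.toNNReal_le_iff_le_coe]
  by_cases hω : ω ∈ A
  · by_cases hz : z.1 ∈ Ioc (s : ℝ) T
    · have hz0 : ((z.1.toNNReal : ℝ≥0) : ℝ) = z.1 :=
        Real.coe_toNNReal _ (s.coe_nonneg.trans hz.1.le)
      rw [localised, indicator_of_mem, indicator_of_mem hω, indicator_of_mem]
      · simp only [markedPoint, hz0]
      · exact ⟨hz, mem_univ _⟩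
      · exact ⟨⟨h1.2 hz, hω⟩, mem_univ _⟩
    · rw [localised, indicator_of_notMem, indicator_of_mem hω, indicator_of_notMem]
      · exact fun h => hz h.1
      · exact fun h => hz (h1.1 h.1.1)
  · rw [localised, indicator_of_notMem, indicator_of_notMem hω]
    exact fun h => hω h.1.2

lemma integral_localised_markedPoint {Ω : Type*} (U : ℝ → Ω → ℝ → ℝ) (A : Set Ω) (s T : ℝ≥0) (ω : Ω)
    (m : Measure (ℝ × ℝ)) : ∫ z, localised U A s T (markedPoint (ω, z)) ∂m
      = A.indicator (fun ω => ∫ z in Ioc (s : ℝ) T ×ˢ univ, U z.1 ω z.2 ∂m) ω := by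
  simp only [localised_markedPoint]
  by_cases hω : ω ∈ A
  · simp only [indicator_of_mem hω]
    rw [integral_indicator (measurableSet_Ioc.prod .univ)]
  · simp [indicator_of_notMem hω]

/-- The product of `P` with the compensator is finite, so `a ≤ 1 + a ^ 2` turns square integrability
into integrability. -/
lemma integrable_localised [IsProbabilityMeasure P] [IsFiniteMeasure (jumpMeasure γ)]
    {U : ℝ → Ω → ℝ → ℝ}
    (hU : Measurable[markedPredictable ℱ] fun q : (ℝ≥0 × Ω) × ℝ => U q.1.1 q.1.2 q.2)
    {A : Set Ω} {t : ℝ} {s T : ℝ≥0} (hA : MeasurableSet[ℱ s] A) (hts : t ≤ s)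
    (hfin : ∫⁻ ω, ∫⁻ r in Ioc t T, ∫⁻ e, ‖U r ω e‖ₑ ^ 2 ∂(jumpMeasure γ) ∂volume ∂P < ∞) :
    Integrable (fun q => localised U A s T (markedPoint q)) (P.prod (compensator γ T)) := by
  have hm : Measurable fun q => localised U A s T (markedPoint (Ω := Ω) q) :=
    ((measurable_localised hU hA T).mono (markedPredictable_le ℱ) le_rfl).comp
      measurable_markedPoint
  have : IsFiniteMeasure (compensator γ T) := by rw [compensator]; infer_instance
  refine ⟨hm.aestronglyMeasurable, ?_⟩
  have h1 : ∀ a : ℝ≥0∞, a ≤ 1 + a ^ 2 := fun a => by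
    rcases le_total a 1 with h | h
    · exact h.trans le_self_add
    · exact (le_self_pow₀ h two_ne_zero).trans le_add_self
  have h2 : ∫⁻ q, ‖localised U A s T (markedPoint q)‖ₑ ^ 2 ∂(P.prod (compensator γ T))
      ≤ ∫⁻ ω, ∫⁻ r in Ioc t T, ∫⁻ e, ‖U r ω e‖ₑ ^ 2 ∂(jumpMeasure γ) ∂volume ∂P := by
    rw [lintegral_prod _ (hm.enorm.pow_const 2).aemeasurable]
    refine lintegral_mono fun ω => ?_
    rw [compensator, lintegral_prod _ (by
      exact ((hm.enorm.pow_const 2).comp measurable_prodMk_left).aemeasurable)]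
    refine (lintegral_mono' Measure.restrict_le_self le_rfl).trans ?_
    rw [← lintegral_indicator measurableSet_Ioc]
    refine lintegral_mono fun r => ?_
    simp only [localised_markedPoint]
    by_cases hr : r ∈ Ioc t (T : ℝ)
    · rw [indicator_of_mem hr]
      refine lintegral_mono fun e => ?_
      gcongr
      by_cases hω : ω ∈ A
      · rw [indicator_of_mem hω]
        exact enorm_indicator_le_enorm_self _ _
      · simp [indicator_of_notMem hω]
    · have h3 : ∀ e, (r, e) ∉ Ioc (s : ℝ) T ×ˢ (univ : Set ℝ) := fun e h =>
        hr ⟨hts.trans_lt h.1.1, h.1.2⟩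
      simp [hr, h3]
  calc _ ≤ ∫⁻ q, (1 + ‖localised U A s T (markedPoint q)‖ₑ ^ 2) ∂(P.prod (compensator γ T)) :=
        lintegral_mono fun q => h1 _
    _ = (P.prod (compensator γ T)) univ
        + ∫⁻ q, ‖localised U A s T (markedPoint q)‖ₑ ^ 2 ∂(P.prod (compensator γ T)) := by
        rw [lintegral_add_left measurable_const, lintegral_one]
    _ < ∞ := ENNReal.add_lt_top.2 ⟨measure_lt_top _ _, h2.trans_lt hfin⟩

/-- The compensated integral of a square integrable predictable integrand is integrable, and
orthogonal to the past. -/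
lemma setIntegral_compensatedIntegral [IsProbabilityMeasure P] [IsFiniteMeasure (jumpMeasure γ)]
    {T : ℝ≥0} (hμ : IsPoissonRandomMeasure P (compensator γ T) μ) (hc : IsCompatible P ℱ μ)
    {U : ℝ → Ω → ℝ → ℝ}
    (hU : Measurable[markedPredictable ℱ] fun q : (ℝ≥0 × Ω) × ℝ => U q.1.1 q.1.2 q.2)
    {t : ℝ} {s : ℝ≥0} (hts : t ≤ s)
    (hfin : ∫⁻ ω, ∫⁻ r in Ioc t T, ∫⁻ e, ‖U r ω e‖ₑ ^ 2 ∂(jumpMeasure γ) ∂volume ∂P < ∞)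
    {A : Set Ω} (hA : MeasurableSet[ℱ s] A) :
    IntegrableOn (compensatedIntegral γ T μ U s) A P ∧
      ∫ ω in A, compensatedIntegral γ T μ U s ω ∂P = 0 := by
  have hA' : MeasurableSet A := ℱ.le s _ hA
  have : IsFiniteMeasure (compensator γ T) := by rw [compensator]; infer_instance
  have hi := integrable_localised hU hA hts hfin
  obtain ⟨hi', heq⟩ := integral_markedPoint_eq hμ hc (measurable_localised hU hA T) hi
  have e1 : (fun ω => ∫ z, localised U A s T (markedPoint (ω, z)) ∂finiteKernel μ hμ.measurable ω)
      =ᵐ[P] A.indicator fun ω => ∫ z in Ioc (s : ℝ) T ×ˢ univ, U z.1 ω z.2 ∂μ ω := by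
    filter_upwards [hμ.ae_lt_top] with ω hω
    rw [integral_localised_markedPoint, finiteKernel_apply _ hω]
    by_cases h : ω ∈ A <;> simp [h]
  have e2 : (fun ω => ∫ z, localised U A s T (markedPoint (ω, z)) ∂compensator γ T)
      =ᵐ[P] A.indicator fun ω => ∫ r in Ioc (s : ℝ) T, ∫ e, U r ω e ∂jumpMeasure γ := by
    filter_upwards [hi.prod_right_ae] with ω hω
    rw [integral_localised_markedPoint]
    by_cases h : ω ∈ A
    · rw [indicator_of_mem h, indicator_of_mem h, compensator_restrict s.coe_nonneg le_rfl,
        integral_prod]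
      simp only [localised_markedPoint, indicator_of_mem h] at hω
      rw [integrable_indicator_iff (measurableSet_Ioc.prod .univ), IntegrableOn,
        compensator_restrict s.coe_nonneg le_rfl] at hω
      exact hω
    · simp [h]
  have i0 : Integrable
      (fun ω => ∫ z, localised U A s T (markedPoint (ω, z)) ∂finiteKernel μ hμ.measurable ω) P := by
    have := hi'
    rw [Measure.compProd] at this
    simpa using this.integral_compProd
  have i1 := i0.congr e1
  have i2 := hi.integral_prod_left.congr e2
  rw [Measure.integral_compProd hi', integral_congr_ae e1, integral_prod _ hi,
    integral_congr_ae e2] at heq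
  rw [integrable_indicator_iff hA'] at i1 i2
  rw [integral_indicator hA', integral_indicator hA'] at heq
  refine ⟨i1.sub i2, ?_⟩
  have := integral_sub i1 i2
  rw [heq, sub_self] at this
  exact this

end Martingale

/-! ### The mild form of the backward equation -/

section Mild

variable {E : Type*} [NormedAddCommGroup E] [NormedSpace ℝ E] [CompleteSpace E]
  {T B Λ R : ℝ} {L : E →L[ℝ] E} {F : ℝ → E → E} {φ : E} {v : ℝ → E}

lemma continuous_evol (L : E →L[ℝ] E) : Continuous (evol L) :=
  continuous_iff_continuousAt.2 fun h => (hasDerivAt_evol L h).continuousAt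

lemma IsBackwardSolution.continuousOn {E : Type*} [NormedAddCommGroup E] [NormedSpace ℝ E] {T R : ℝ}
    {L : E →L[ℝ] E} {F : ℝ → E → E} {φ : E} {v : ℝ → E} (hv : IsBackwardSolution T L F φ R v) :
    ContinuousOn v (Icc 0 T) := fun t ht => (hv.deriv t ht).continuousWithinAt

lemma IsBackwardSolution.continuousOn_nonlinearity (hv : IsBackwardSolution T L F φ R v)
    (hF : IsNonlinearity T B F) (hB : 0 ≤ B) : ContinuousOn (fun t => F t (v t)) (Icc 0 T) := by
  have h1 : LipschitzOnWith (B * (1 + (‖L‖ * R + B))).toNNReal (fun t => F t (v t)) (Icc 0 T) := by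
    refine LipschitzOnWith.of_dist_le_mul fun s hs t ht => ?_
    rw [dist_eq_norm, Real.dist_eq]
    refine (hv.norm_nonlinearity_sub_le le_rfl hF hB hs ht).trans ?_
    gcongr
    exact Real.le_coe_toNNReal _
  exact h1.continuousOn

/-- Duhamel's formula for the backward equation. -/
lemma IsBackwardSolution.eq_evol_add_integral (hv : IsBackwardSolution T L F φ R v)
    (hF : IsNonlinearity T B F) (hB : 0 ≤ B) {s : ℝ} (hs : s ∈ Icc 0 T) :
    v s = evol L (T - s) φ + ∫ r in s..T, evol L (r - s) (F r (v r)) := by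
  have hsub : Icc s T ⊆ Icc 0 T := Icc_subset_Icc_left hs.1
  have hE : Continuous fun r => evol L (r - s) := (continuous_evol L).comp (by fun_prop)
  have h1 := intervalIntegral.integral_eq_sub_of_hasDerivAt_of_le
    (f := fun r => evol L (r - s) (v r)) (f' := fun r => -evol L (r - s) (F r (v r))) hs.2
    (hE.continuousOn.clm_apply (hv.continuousOn.mono hsub)) (fun r hr => ?_) ?_
  · rw [intervalIntegral.integral_neg, sub_self, evol_zero, hv.terminal] at h1
    rw [neg_eq_iff_eq_neg.1 h1, one_apply_eq_self]
    abel
  · have hr' : r ∈ Icc 0 T := hsub (Ioo_subset_Icc_self hr)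
    have d1 : HasDerivAt v (-(L (v r) + F r (v r))) r :=
      (hv.deriv r hr').hasDerivAt (Icc_mem_nhds (hs.1.trans_lt hr.1) hr.2)
    have d2 := ((hasDerivAt_evol L (r - s)).comp_sub_const r s).clm_apply d1
    convert d2 using 1
    rw [mul_apply_eq_comp, map_neg, map_add]
    abel
  · refine ContinuousOn.intervalIntegrable ?_
    rw [uIcc_of_le hs.2]
    exact (hE.continuousOn.clm_apply ((hv.continuousOn_nonlinearity hF hB).mono hsub)).neg

end Mild

/-- A backward Gronwall inequality. -/
lemma eq_zero_of_le_lintegral {a : ℝ → ℝ≥0∞} {t T B C : ℝ} (hB : 0 ≤ B) (hC : 0 ≤ C)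
    (h1 : ∀ s ∈ Icc t T, a s ≤ ENNReal.ofReal C)
    (h2 : ∀ s ∈ Icc t T, a s ≤ ENNReal.ofReal B * ∫⁻ r in Ioc s T, a r) :
    ∀ s ∈ Icc t T, a s = 0 := by
  -- Iterating the integral inequality `n` times produces a term of the exponential series, which
  -- tends to zero. No measurability of `a` is needed.
  have h3 : ∀ n : ℕ, ∀ s ∈ Icc t T,
      a s ≤ ENNReal.ofReal (C * ((B * (T - s)) ^ n / n.factorial)) := by
    intro n
    induction n with
    | zero => simpa using h1
    | succ n ih =>
      intro s hs
      refine (h2 s hs).trans ?_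
      have hcont : Continuous fun r => C * ((B * (T - r)) ^ n / n.factorial) := by fun_prop
      have e : ∫ r in Ioc s T, C * ((B * (T - r)) ^ n / n.factorial)
          = C * (B ^ n * ((T - s) ^ (n + 1) / (n + 1)) / n.factorial) := by
        rw [← intervalIntegral.integral_of_le hs.2]
        simp only [mul_pow, mul_div_assoc]
        rw [intervalIntegral.integral_const_mul, intervalIntegral.integral_const_mul,
          intervalIntegral.integral_div, intervalIntegral.integral_comp_sub_left (fun r => r ^ n),
          integral_pow, sub_self, zero_pow (Nat.succ_ne_zero n), sub_zero]
      calc _ ≤ ENNReal.ofReal B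
            * ∫⁻ r in Ioc s T, ENNReal.ofReal (C * ((B * (T - r)) ^ n / n.factorial)) := by
            refine mul_le_mul_right ?_ _
            exact setLIntegral_mono' measurableSet_Ioc fun r hr => ih r ⟨hs.1.trans hr.1.le, hr.2⟩
        _ = ENNReal.ofReal (C * ((B * (T - s)) ^ (n + 1) / (n + 1).factorial)) := by
            rw [← ofReal_integral_eq_lintegral_ofReal
              ((hcont.integrableOn_Icc).mono_set Ioc_subset_Icc_self), e, ← ENNReal.ofReal_mul hB]
            · congr 1
              rw [Nat.factorial_succ, mul_pow]
              push_cast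
              field_simp
              ring
            · filter_upwards [ae_restrict_mem measurableSet_Ioc] with r hr
              have : 0 ≤ T - r := sub_nonneg.2 hr.2
              positivity
  intro s hs
  rw [← nonpos_iff_eq_zero]
  refine ge_of_tendsto' (x := atTop) ?_ fun n => h3 n s hs
  rw [← ENNReal.ofReal_zero, ← mul_zero C]
  exact ENNReal.tendsto_ofReal ((FloorSemiring.tendsto_pow_div_factorial_atTop _).const_mul C)

/-! ### Joint measurability in scenario and time -/

section Measurability

variable {Ω : Type*} [mΩ : MeasurableSpace Ω] {P : Measure Ω} {ℱ : Filtration ℝ≥0 mΩ}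
  {μ : Ω → Measure (ℝ × ℝ)}

/-- The forward process is jointly measurable. -/
lemma exists_measurable_forward (hm : Measurable μ) (t x : ℝ) :
    ∃ G : Ω × ℝ → ℝ, Measurable G ∧ ∀ ω, μ ω univ < ∞ → ∀ r, forward μ t x r ω = G (ω, r) := by
  have h1 : StronglyMeasurable fun q : (Ω × ℝ) × (ℝ × ℝ) =>
      (Ioc t q.1.2).indicator (fun _ => q.2.2) q.2.1 := by
    refine Measurable.stronglyMeasurable ?_
    have : MeasurableSet {q : (Ω × ℝ) × (ℝ × ℝ) | q.2.1 ∈ Ioc t q.1.2} :=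
      (measurableSet_lt (f := fun _ : (Ω × ℝ) × (ℝ × ℝ) => t) (g := fun q => q.2.1)
        measurable_const (by fun_prop)).inter
        (measurableSet_le (f := fun q : (Ω × ℝ) × (ℝ × ℝ) => q.2.1) (g := fun q => q.1.2)
          (by fun_prop) (by fun_prop))
    exact Measurable.indicator (f := fun q : (Ω × ℝ) × (ℝ × ℝ) => q.2.2) (by fun_prop) this
  have h2 := h1.integral_kernel_prod_right' (κ := (finiteKernel μ hm).comap Prod.fst measurable_fst)
  refine ⟨_, h2.measurable.const_add x, fun ω hω r => ?_⟩
  rw [forward, ← integral_indicator (measurableSet_Ioc.prod .univ)]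
  simp only [Kernel.comap_apply, finiteKernel_apply hm hω]
  congr 1
  refine integral_congr_ae (.of_forall fun z => ?_)
  by_cases hz : z.1 ∈ Ioc t r <;> simp [hz, indicator]

/-- A right-continuous process is jointly measurable. -/
lemma aemeasurable_of_right_continuous [IsProbabilityMeasure P] {t T : ℝ} {Y : ℝ → Ω → ℝ}
    (hY : ∀ s ∈ Icc t T, Measurable (Y s))
    (hr : ∀ᵐ ω ∂P, ∀ s ∈ Ico t T, ContinuousWithinAt (fun r => Y r ω) (Ici s) s) :
    AEMeasurable (fun q : Ω × ℝ => Y q.2 q.1) (P.prod (volume.restrict (Ioc t T))) := by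
  rcases lt_or_ge t T with htT | htT
  swap
  · rw [Ioc_eq_empty htT.not_gt]; simp
  -- Times are rounded up to the grid of width `1 / (n + 1)` and clamped to `[t, T]`, so they are
  -- approached from the right, as right-continuity requires.
  set c : ℕ → ℤ → ℝ := fun n k => max t (min T ((k + 1) / (n + 1))) with hc
  have hcm : ∀ n k, c n k ∈ Icc t T := fun n k =>
    ⟨le_max_left _ _, max_le htT.le (min_le_left _ _)⟩
  refine aemeasurable_of_tendsto_metrizable_ae (u := atTop)
    (f := fun (n : ℕ) (q : Ω × ℝ) => Y (c n ⌊q.2 * (n + 1)⌋) q.1) (fun n => Measurable.aemeasurable ?_) ?_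
  · have h1 : Measurable fun q : ℤ × Ω => Y (c n q.1) q.2 :=
      measurable_from_prod_countable_right fun k => hY _ (hcm n k)
    have h2 : Measurable fun q : Ω × ℝ => (⌊q.2 * (n + 1)⌋, q.1) :=
      (Int.measurable_floor.comp (measurable_snd.mul_const _)).prodMk measurable_fst
    exact h1.comp h2
  · have e1 : ∀ᵐ q ∂P.prod (volume.restrict (Ioc t T)),
        ∀ s ∈ Ico t T, ContinuousWithinAt (fun r => Y r q.1) (Ici s) s :=
      Measure.quasiMeasurePreserving_fst.ae hr
    have e2 : ∀ᵐ q : Ω × ℝ ∂P.prod (volume.restrict (Ioc t T)), q.2 ∈ Ioo t T :=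
      Measure.quasiMeasurePreserving_snd.ae (by
        rw [← restrict_Ioo_eq_restrict_Ioc]; exact ae_restrict_mem measurableSet_Ioo)
    filter_upwards [e1, e2] with q h1 h2
    refine (h1 q.2 ⟨h2.1.le, h2.2⟩).tendsto.comp ?_
    have hlt : ∀ n : ℕ, q.2 < (⌊q.2 * (n + 1)⌋ + 1) / ((n : ℝ) + 1) := fun n => by
      rw [lt_div_iff₀ (by positivity)]; exact Int.lt_floor_add_one _
    refine tendsto_nhdsWithin_iff.2 ⟨?_, .of_forall fun n => ?_⟩
    · have hub : ∀ n : ℕ, c n ⌊q.2 * (n + 1)⌋ ≤ q.2 + 1 / ((n : ℝ) + 1) := fun n => by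
        refine max_le (h2.1.le.trans (le_add_of_nonneg_right (by positivity)))
          ((min_le_right _ _).trans ?_)
        rw [add_div, add_le_add_iff_right, div_le_iff₀ (by positivity)]
        exact Int.floor_le _
      refine tendsto_of_tendsto_of_tendsto_of_le_of_le tendsto_const_nhds
        (h := fun n : ℕ => q.2 + 1 / ((n : ℝ) + 1)) ?_ (fun n => ?_) hub
      · simpa using tendsto_one_div_add_atTop_nhds_zero_nat.const_add q.2
      · exact le_max_of_le_right (le_min h2.2.le (hlt n).le)
    · exact le_max_of_le_right (le_min h2.2.le (hlt n).le)

end Measurability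

/-! ### Identification of the BSDE solution with the backward solution -/

section Verification

variable {Ω : Type*} [mΩ : MeasurableSpace Ω] {P : Measure Ω} {ℱ : Filtration ℝ≥0 mΩ}
  {μ : Ω → Measure (ℝ × ℝ)} {γ : ℝ → ℝ} {T B R : ℝ}

/-- Projecting time onto `[0, T]` makes the evaluation jointly continuous on the whole plane, hence
measurable along any jointly measurable process. -/
lemma continuous_eval_projIcc (hT : 0 ≤ T) {w : ℝ → ℝ →ᵇ ℝ} (hw : ContinuousOn w (Icc 0 T)) :
    Continuous fun q : ℝ × ℝ => w (projIcc 0 T hT q.1) q.2 := by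
  have h1 : Continuous fun r : ℝ => w (projIcc 0 T hT r) :=
    hw.comp_continuous (by fun_prop) fun r => (projIcc 0 T hT r).2
  exact continuous_eval.comp
    ((h1.comp continuous_fst).prodMk continuous_snd)

/-- A continuous curve of bounded functions, evaluated along a jointly measurable process. -/
lemma aestronglyMeasurable_eval (hT : 0 ≤ T) {w : ℝ → ℝ →ᵇ ℝ} (hw : ContinuousOn w (Icc 0 T))
    {s : ℝ} (hs : 0 ≤ s) {X : ℝ → Ω → ℝ} [SFinite P]
    (hX : AEMeasurable (fun q : Ω × ℝ => X q.2 q.1) (P.prod (volume.restrict (Ioc s T)))) :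
    AEStronglyMeasurable (fun q : Ω × ℝ => w q.2 (X q.2 q.1))
      (P.prod (volume.restrict (Ioc s T))) := by
  have h1 := (continuous_eval_projIcc hT hw).measurable.comp_aemeasurable
    (measurable_snd.aemeasurable.prodMk hX)
  refine (h1.congr ?_).aestronglyMeasurable
  have e2 : ∀ᵐ q : Ω × ℝ ∂P.prod (volume.restrict (Ioc s T)), q.2 ∈ Ioc s T :=
    Measure.quasiMeasurePreserving_snd.ae (ae_restrict_mem measurableSet_Ioc)
  filter_upwards [e2] with q hq
  simp only [Function.comp_apply]
  rw [projIcc_of_mem hT ⟨hs.trans hq.1.le, hq.2⟩]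

lemma integrable_eval [IsProbabilityMeasure P] (hT : 0 ≤ T) {w : ℝ → ℝ →ᵇ ℝ}
    (hw : ContinuousOn w (Icc 0 T)) {s C : ℝ} (hs : 0 ≤ s) (hC : ∀ r ∈ Icc 0 T, ‖w r‖ ≤ C)
    {X : ℝ → Ω → ℝ}
    (hX : AEMeasurable (fun q : Ω × ℝ => X q.2 q.1) (P.prod (volume.restrict (Ioc s T)))) :
    Integrable (fun q : Ω × ℝ => w q.2 (X q.2 q.1)) (P.prod (volume.restrict (Ioc s T))) := by
  refine Integrable.of_bound (aestronglyMeasurable_eval hT hw hs hX) C ?_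
  have e2 : ∀ᵐ q : Ω × ℝ ∂P.prod (volume.restrict (Ioc s T)), q.2 ∈ Ioc s T :=
    Measure.quasiMeasurePreserving_snd.ae (ae_restrict_mem measurableSet_Ioc)
  filter_upwards [e2] with q hq
  exact ((w q.2).norm_coe_le_norm _).trans (hC _ ⟨hs.trans hq.1.le, hq.2⟩)

lemma aemeasurable_forward [IsProbabilityMeasure P] [IsFiniteMeasure (compensator γ T)]
    (hμ : IsPoissonRandomMeasure P (compensator γ T) μ) (t x s : ℝ) :
    AEMeasurable (fun q : Ω × ℝ => forward μ t x q.2 q.1)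
      (P.prod (volume.restrict (Ioc s T))) := by
  obtain ⟨G, hG, hGeq⟩ := exists_measurable_forward hμ.measurable t x
  refine hG.aemeasurable.congr ?_
  have e1 : ∀ᵐ q ∂P.prod (volume.restrict (Ioc s T)), μ q.1 univ < ∞ :=
    Measure.quasiMeasurePreserving_fst.ae hμ.ae_lt_top
  filter_upwards [e1] with q hq
  exact (hGeq _ hq _).symm

/-- The solution of the backward equation along the forward process, as a conditional
expectation. -/
lemma setIntegral_backwardSolution_forward [IsProbabilityMeasure P]
    [IsFiniteMeasure (jumpMeasure γ)]
    (hμ : IsPoissonRandomMeasure P (compensator γ T) μ) (hc : IsCompatible P ℱ μ)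
    {F : ℝ → (ℝ →ᵇ ℝ) → ℝ →ᵇ ℝ} {φ : ℝ →ᵇ ℝ} {v : ℝ → ℝ →ᵇ ℝ} (hF : IsNonlinearity T B F)
    (hB : 0 ≤ B) (hv : IsBackwardSolution T (gen (jumpMeasure γ)) F φ R v) {t : ℝ} (x : ℝ)
    {s : ℝ≥0} (hts : t ≤ s) (hsT : s ≤ T) {A : Set Ω} (hA : MeasurableSet[ℱ s] A) :
    ∫ ω in A, v s (forward μ t x s ω) ∂P = ∫ ω in A, φ (forward μ t x T ω) ∂P
      + ∫ ω in A, (∫ r in Ioc (s : ℝ) T, F r (v r) (forward μ t x r ω)) ∂P := by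
  have : IsFiniteMeasure (compensator γ T) := by rw [compensator]; infer_instance
  have hT : 0 ≤ T := s.coe_nonneg.trans hsT
  have hsI : (s : ℝ) ∈ Icc 0 T := ⟨s.coe_nonneg, hsT⟩
  have hw := hv.continuousOn_nonlinearity hF hB
  have hE : ContinuousOn (fun r => evol (gen (jumpMeasure γ)) (r - s) (F r (v r))) (Icc 0 T) :=
    (((continuous_evol _).comp (by fun_prop : Continuous fun r : ℝ => r - s)).continuousOn).clm_apply hw
  have hXm : Measurable (forward μ t x s) := (hc.measurable_forward t x s).mono (ℱ.le s) le_rfl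
  obtain ⟨C, hC⟩ := isCompact_Icc.exists_bound_of_continuousOn hE
  have hi1 := integrable_eval (P := P) hT hE s.coe_nonneg hC (X := fun _ => forward μ t x s)
    (hXm.comp measurable_fst).aemeasurable
  have hi2 := integrable_eval (P := P) hT hw s.coe_nonneg (fun r hr => hF.norm_le r hr _)
    (aemeasurable_forward hμ t x s)
  have hle : (P.restrict A).prod (volume.restrict (Ioc (s : ℝ) T))
      ≤ P.prod (volume.restrict (Ioc (s : ℝ) T)) :=
    Measure.prod_mono Measure.restrict_le_self le_rfl
  have hD : ∀ y, v s y = evol (gen (jumpMeasure γ)) (T - s) φ y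
      + ∫ r in Ioc (s : ℝ) T, evol (gen (jumpMeasure γ)) (r - s) (F r (v r)) y := fun y => by
    have h1 := congrArg (fun ψ : ℝ →ᵇ ℝ => ψ y) (hv.eq_evol_add_integral hF hB hsI)
    have h2 : IntervalIntegrable (fun r => evol (gen (jumpMeasure γ)) (r - s) (F r (v r)))
        volume s T := by
      refine ContinuousOn.intervalIntegrable ?_
      rw [uIcc_of_le hsT]
      exact hE.mono (Icc_subset_Icc_left s.coe_nonneg)
    have h3 := (BoundedContinuousFunction.evalCLM ℝ y).intervalIntegral_comp_comm h2
    rw [← intervalIntegral.integral_of_le hsT]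
    refine h1.trans ?_
    rw [BoundedContinuousFunction.add_apply]
    exact congrArg _ h3.symm
  have hiE : Integrable (fun ω => evol (gen (jumpMeasure γ)) (T - s) φ (forward μ t x s ω))
      (P.restrict A) :=
    Integrable.of_bound ((BoundedContinuousFunction.continuous _).measurable.comp hXm).aestronglyMeasurable
      ‖evol (gen (jumpMeasure γ)) (T - s) φ‖
      (.of_forall fun _ => BoundedContinuousFunction.norm_coe_le_norm _ _)
  simp only [hD]
  rw [integral_add hiE (hi1.mono_measure hle).integral_prod_left,
    ← setIntegral_comp_forward hμ hc x hts hsT le_rfl hA φ]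
  congr 1
  -- After exchanging the integrals over scenarios and time, the Markov property is applied at each
  -- fixed time `r`.
  refine (integral_integral_swap (hi1.mono_measure hle)).trans
    (Eq.trans ?_ (integral_integral_swap (hi2.mono_measure hle)).symm)
  refine setIntegral_congr_fun measurableSet_Ioc fun r hr => ?_
  exact (setIntegral_comp_forward hμ hc x hts hr.1.le hr.2 hA (F r (v r))).symm

/-- The solution of the BSDE is given by the solution of the backward equation. -/
lemma IsBSDESolution.ae_eq [IsProbabilityMeasure P] [IsFiniteMeasure (jumpMeasure γ)]
    (hμ : IsPoissonRandomMeasure P (compensator γ T) μ) (hc : IsCompatible P ℱ μ)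
    {f : ℝ × ℝ × ℝ → ℝ} {F : ℝ → (ℝ →ᵇ ℝ) → ℝ →ᵇ ℝ} {φ : ℝ →ᵇ ℝ} {v : ℝ → ℝ →ᵇ ℝ}
    (hfc : ContinuousOn f (Icc 0 T ×ˢ univ)) (hfB : ∀ z ∈ Icc 0 T ×ˢ univ, |f z| ≤ B)
    (hfL : ∀ r ∈ Icc 0 T, ∀ x y y', |f (r, x, y) - f (r, x, y')| ≤ B * |y - y'|)
    (hF : IsNonlinearity T B F) (hFf : ∀ r ∈ Icc 0 T, ∀ ψ x, F r ψ x = f (r, x, ψ x))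
    (hv : IsBackwardSolution T (gen (jumpMeasure γ)) F φ R v) {t x : ℝ} (ht : t ∈ Icc 0 T)
    {Y : ℝ → Ω → ℝ} {U : ℝ → Ω → ℝ → ℝ} (h : IsBSDESolution P ℱ μ γ T φ f t x Y U) :
    ∀ᵐ ω ∂P, Y t ω = v t x := by
  have : IsFiniteMeasure (compensator γ T) := by rw [compensator]; infer_instance
  have hT : 0 ≤ T := ht.1.trans ht.2
  have hB : 0 ≤ B := (abs_nonneg _).trans (hfB (0, 0, 0) ⟨⟨le_rfl, hT⟩, mem_univ _⟩)
  have hw := hv.continuousOn_nonlinearity hF hB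
  set X : ℝ → Ω → ℝ := forward μ t x with hX
  set δ : ℝ → Ω → ℝ := fun s ω => Y s ω - v s (X s ω) with hδ
  have hYm : AEMeasurable (fun q : Ω × ℝ => Y q.2 q.1) (P.prod (volume.restrict (Ioc t T))) := by
    refine aemeasurable_of_right_continuous (fun s hs => ?_) h.right_continuous
    lift s to ℝ≥0 using ht.1.trans hs.1
    exact (h.adapted s hs).mono (ℱ.le s) le_rfl
  have hmono : ∀ s, t ≤ s → P.prod (volume.restrict (Ioc s T))
      ≤ P.prod (volume.restrict (Ioc t T)) := fun s hs =>
    Measure.prod_mono le_rfl (Measure.restrict_mono (Ioc_subset_Ioc_left hs) le_rfl)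
  have hmem : ∀ s, ∀ᵐ q : Ω × ℝ ∂P.prod (volume.restrict (Ioc s T)), q.2 ∈ Ioc s T := fun s =>
    Measure.quasiMeasurePreserving_snd.ae (ae_restrict_mem measurableSet_Ioc)
  have hΦ : Integrable (fun q : Ω × ℝ => f (q.2, X q.2 q.1, Y q.2 q.1))
      (P.prod (volume.restrict (Ioc t T))) := by
    have hf' : Continuous fun z : ℝ × ℝ × ℝ => f (projIcc 0 T hT z.1, z.2) :=
      hfc.comp_continuous (by fun_prop) fun z => ⟨(projIcc 0 T hT z.1).2, mem_univ _⟩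
    have h1 := hf'.measurable.comp_aemeasurable
      (measurable_snd.aemeasurable.prodMk ((aemeasurable_forward hμ t x t).prodMk hYm))
    refine Integrable.of_bound (h1.congr ?_).aestronglyMeasurable B ?_
    · filter_upwards [hmem t] with q hq
      simp only [Function.comp_apply]
      rw [projIcc_of_mem hT ⟨ht.1.trans hq.1.le, hq.2⟩]
    · filter_upwards [hmem t] with q hq
      exact hfB _ ⟨⟨ht.1.trans hq.1.le, hq.2⟩, mem_univ _⟩
  have hΨ := integrable_eval (P := P) hT hw ht.1 (fun r hr => hF.norm_le r hr _)
    (aemeasurable_forward hμ t x t)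
  have hδm : AEMeasurable (fun q : Ω × ℝ => δ q.2 q.1) (P.prod (volume.restrict (Ioc t T))) :=
    hYm.sub (aestronglyMeasurable_eval hT hv.continuousOn ht.1
      (aemeasurable_forward hμ t x t)).aemeasurable
  set D : ℝ → Ω → ℝ := fun s ω => ∫ r in Ioc s T,
    (f (r, X r ω, Y r ω) - F r (v r) (X r ω)) with hD
  have hDi : ∀ s, t ≤ s → Integrable (D s) P := fun s hs =>
    ((hΦ.sub hΨ).mono_measure (hmono s hs)).integral_prod_left
  have hcond : ∀ s ∈ Icc t T, ∫⁻ ω, ‖δ s ω‖ₑ ∂P ≤ ∫⁻ ω, ‖D s ω‖ₑ ∂P := by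
    intro s hs
    lift s to ℝ≥0 using ht.1.trans hs.1
    have hXs : Measurable[ℱ s] (X s) := hc.measurable_forward t x s
    have hXT : Measurable (X T) := by
      lift T to ℝ≥0 using hT
      exact (hc.measurable_forward t x T).mono (ℱ.le T) le_rfl
    have hδs : Measurable[ℱ s] (δ s) :=
      (h.adapted s hs).sub ((v s).continuous.measurable.comp hXs)
    have hΦs := hΦ.mono_measure (hmono s hs.1)
    have hΨs := hΨ.mono_measure (hmono s hs.1)
    have iφ : Integrable (fun ω => φ (X T ω)) P :=
      Integrable.of_bound (φ.continuous.measurable.comp hXT).aestronglyMeasurable ‖φ‖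
        (.of_forall fun _ => φ.norm_coe_le_norm _)
    have iv : Integrable (fun ω => v s (X s ω)) P :=
      Integrable.of_bound ((v s).continuous.measurable.comp
        (hXs.mono (ℱ.le s) le_rfl)).aestronglyMeasurable ‖v s‖
        (.of_forall fun _ => (v s).norm_coe_le_norm _)
    have hcomp : ∀ A, MeasurableSet[ℱ s] A → IntegrableOn (compensatedIntegral γ T μ U s) A P ∧
        ∫ ω in A, compensatedIntegral γ T μ U s ω ∂P = 0 := by
      intro A hA
      have hU := h.predictable
      have hU2 := h.sq_lt_top
      lift T to ℝ≥0 using hT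
      exact setIntegral_compensatedIntegral hμ hc hU hs.1 hU2 hA
    have iC : Integrable (compensatedIntegral γ T μ U s) P :=
      integrableOn_univ.1 (hcomp univ .univ).1
    have iΦ : Integrable (fun ω => ∫ r in Ioc (s : ℝ) T, f (r, X r ω, Y r ω)) P :=
      hΦs.integral_prod_left
    have iΨ : Integrable (fun ω => ∫ r in Ioc (s : ℝ) T, F r (v r) (X r ω)) P :=
      hΨs.integral_prod_left
    have iφΦ : Integrable (fun ω => φ (X T ω) + ∫ r in Ioc (s : ℝ) T, f (r, X r ω, Y r ω)) P :=
      iφ.add iΦ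
    have hYeq : Y s =ᵐ[P] fun ω => φ (X T ω) + (∫ r in Ioc (s : ℝ) T, f (r, X r ω, Y r ω))
        - compensatedIntegral γ T μ U s ω := by
      filter_upwards [h.equation] with ω hω using hω s hs
    have iY : Integrable (Y s) P := (iφΦ.sub iC).congr hYeq.symm
    have hDeq : D s =ᵐ[P] fun ω => (∫ r in Ioc (s : ℝ) T, f (r, X r ω, Y r ω))
        - ∫ r in Ioc (s : ℝ) T, F r (v r) (X r ω) := by
      filter_upwards [hΦs.prod_right_ae, hΨs.prod_right_ae] with ω h1 h2
      exact integral_sub h1 h2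
    -- Integrated over `A` in `ℱ s`, the compensated integral vanishes and the terminal terms
    -- cancel, leaving only the difference of the generators. The contraction of conditional
    -- expectation in `L¹` then gives the claim.
    have hkey : δ s =ᵐ[P] P[D s | ℱ s] := by
      refine ae_eq_condExp_of_forall_setIntegral_eq (ℱ.le s) (hDi s hs.1)
        (fun A _ _ => (iY.sub iv).integrableOn) (fun A hA _ => ?_)
        hδs.stronglyMeasurable.aestronglyMeasurable
      have e1 : ∫ ω in A, Y s ω ∂P = ∫ ω in A, φ (X T ω) ∂P
          + ∫ ω in A, (∫ r in Ioc (s : ℝ) T, f (r, X r ω, Y r ω)) ∂P := by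
        rw [integral_congr_ae (ae_restrict_of_ae hYeq),
          integral_sub iφΦ.integrableOn iC.integrableOn,
          integral_add iφ.integrableOn iΦ.integrableOn, (hcomp A hA).2, sub_zero]
      rw [integral_congr_ae (ae_restrict_of_ae hDeq),
        integral_sub iΦ.integrableOn iΨ.integrableOn]
      simp only [hδ]
      rw [integral_sub iY.integrableOn iv.integrableOn, e1,
        setIntegral_backwardSolution_forward hμ hc hF hB hv x hs.1 hs.2 hA]
      ring
    have e2 : ∫⁻ ω, ‖δ s ω‖ₑ ∂P = ∫⁻ ω, ‖(P[D s | ℱ s]) ω‖ₑ ∂P :=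
      lintegral_congr_ae (hkey.fun_comp fun a => ‖a‖ₑ)
    rw [e2]
    have h1 := eLpNorm_condExp_le_eLpNorm (m := ℱ s) (μ := P) (D s) le_rfl
    rwa [eLpNorm_one_eq_lintegral_enorm, eLpNorm_one_eq_lintegral_enorm] at h1
  -- The a priori bound `T * (2 * B)` comes from the boundedness of `f`; the integral inequality
  -- comes from its Lipschitz continuity in `y`.
  have hgron : ∀ s ∈ Icc t T, ∫⁻ ω, ‖δ s ω‖ₑ ∂P = 0 := by
    refine eq_zero_of_le_lintegral hB (C := T * (2 * B)) (by positivity) (fun s hs => ?_)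
      fun s hs => ?_
    · refine (hcond s hs).trans ?_
      have hb : ∀ ω, ‖D s ω‖ₑ ≤ ENNReal.ofReal (T * (2 * B)) := fun ω => by
        rw [← ofReal_norm]
        refine ENNReal.ofReal_le_ofReal ?_
        refine (norm_setIntegral_le_of_norm_le_const (C := 2 * B) (by simp) fun r hr => ?_).trans ?_
        · have hr' : r ∈ Icc 0 T := ⟨ht.1.trans (hs.1.trans hr.1.le), hr.2⟩
          refine (norm_sub_le _ _).trans ?_
          rw [two_mul]
          exact add_le_add (hfB _ ⟨hr', mem_univ _⟩)
            (((F r (v r)).norm_coe_le_norm _).trans (hF.norm_le r hr' _))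
        · rw [mul_comm]
          gcongr
          simp only [Real.volume_real_Ioc]
          exact max_le (by linarith [ht.1.trans hs.1]) hT
      refine (lintegral_mono hb).trans ?_
      simp
    · refine (hcond s hs).trans ?_
      have hb : ∀ ω, ‖D s ω‖ₑ ≤ ENNReal.ofReal B * ∫⁻ r in Ioc s T, ‖δ r ω‖ₑ := fun ω => by
        refine (enorm_integral_le_lintegral_enorm _).trans ?_
        rw [← lintegral_const_mul' _ _ ENNReal.ofReal_ne_top]
        refine setLIntegral_mono' measurableSet_Ioc fun r hr => ?_
        have hr' : r ∈ Icc 0 T := ⟨ht.1.trans (hs.1.trans hr.1.le), hr.2⟩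
        rw [hFf r hr', ← ofReal_norm, ← ofReal_norm, ← ENNReal.ofReal_mul hB]
        exact ENNReal.ofReal_le_ofReal (hfL r hr' _ _ _)
      calc _ ≤ ∫⁻ ω, (ENNReal.ofReal B * ∫⁻ r in Ioc s T, ‖δ r ω‖ₑ) ∂P := lintegral_mono hb
        _ = ENNReal.ofReal B * ∫⁻ ω, (∫⁻ r in Ioc s T, ‖δ r ω‖ₑ) ∂P :=
            lintegral_const_mul' _ _ ENNReal.ofReal_ne_top
        _ = _ := by
            rw [lintegral_lintegral_swap]
            exact (hδm.mono_measure (hmono s hs.1)).enorm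
  have h0 := hgron t ⟨le_rfl, ht.2⟩
  have hδt : AEMeasurable (fun ω => ‖δ t ω‖ₑ) P := by
    lift t to ℝ≥0 using ht.1
    have : Measurable[ℱ t] (δ t) := (h.adapted t ⟨le_rfl, ht.2⟩).sub
      ((v t).continuous.measurable.comp (hc.measurable_forward t x t))
    exact (this.mono (ℱ.le t) le_rfl).enorm.aemeasurable
  rw [lintegral_eq_zero_iff' hδt] at h0
  filter_upwards [h0] with ω hω
  have h2 : δ t ω = 0 := by simpa using hω
  have h3 : X t ω = x := by simp [hX, forward]
  rw [hδ] at h2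
  simp only [h3] at h2
  exact sub_eq_zero.1 h2

end Verification

end JumpBSDE

end

/-! ### The error estimate for the fully discrete scheme -/

theorem theorem4p3 (T lam : ℝ) (hT : 0 < T) (hlam : 0 < lam) (p : ℕ) (B W K : ℝ) :
    ∃ C > 0, ∃ δ > 0,
      -- the kernel, with jump intensity `lam`
      ∀ γ : ℝ → ℝ, (∀ e, 0 ≤ γ e) → Integrable γ → ∫ e, γ e = lam →
      -- the terminal condition and the generator
      ∀ (φ : ℝ → ℝ) (f : ℝ × ℝ × ℝ → ℝ),
        JumpBSDE.IsCb (max 2 (p + 1)) B univ φ →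
        JumpBSDE.IsCb (max 2 (p + 1)) B (Icc 0 T ×ˢ univ) f →
      -- the stochastic basis and the exact solutions started at the points `(t, x)`
      ∀ (Ω : Type*) [mΩ : MeasurableSpace Ω] (P : Measure Ω) [IsProbabilityMeasure P]
        (ℱ : Filtration ℝ≥0 mΩ) (μ : Ω → Measure (ℝ × ℝ)),
        JumpBSDE.IsPoissonRandomMeasure P (JumpBSDE.compensator γ T) μ →
        JumpBSDE.IsCompatible P ℱ μ →
      ∀ (Y : ℝ → ℝ → ℝ → Ω → ℝ) (U : ℝ → ℝ → ℝ → Ω → ℝ → ℝ),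
        (∀ t ∈ Icc 0 T, ∀ x : ℝ,
          JumpBSDE.IsBSDESolution P ℱ μ γ T φ f t x (Y t x) (U t x)) →
      -- the meshes, with sufficiently small time step, and the interpolation stencils
      ∀ (N : ℕ) (dt : ℝ), 0 < N → dt = T / N → dt < δ →
      ∀ (x₀ dx : ℝ), 0 < dx →
      ∀ S : ℝ → Finset ℤ, JumpBSDE.IsNearestStencil x₀ dx p S →
      -- the numbers of jumps and the quadrature rule
      ∀ (My Mf Q : ℕ) (w a : Fin Q → ℝ) (r : ℝ), 0 < Q → 0 < r →
        ∑ j, |w j| ≤ W →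
        JumpBSDE.QuadratureError lam γ N x₀ dx w a K r My
          (fun n x => JumpBSDE.value P Y (JumpBSDE.tgrid dt n) x) →
        JumpBSDE.QuadratureError lam γ N x₀ dx w a K r Mf
          (fun n x => f (JumpBSDE.tgrid dt n, x,
            JumpBSDE.value P Y (JumpBSDE.tgrid dt n) x)) →
      -- the fully discrete solution and its error
      ∀ y : ℕ → ℤ → ℝ,
        JumpBSDE.IsFullyDiscreteSolution (1 / 2) lam φ f N dt x₀ dx S w a My Mf y →
      ∀ n ≤ N, ∀ᵐ ω ∂P, ∀ i : ℤ,
        |Y (JumpBSDE.tgrid dt n) (JumpBSDE.xgrid x₀ dx i) (JumpBSDE.tgrid dt n) ω - y n i|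
          ≤ C * (dt ^ 2 + (lam * dt) ^ My + (lam * dt) ^ (Mf + 1) + (Q : ℝ) ^ (-r)
              + dx ^ (p + 1)) := by
  -- The last argument is the a priori bound of `exists_isBackwardSolution` with `Λ = 2 * lam`, the
  -- bound for the norm of the generator.
  obtain ⟨C, hC, δ, hδ, hmain⟩ := JumpBSDE.exists_scheme_error_bound hT hlam p B W K
    (Real.exp (T * (2 * lam)) * (B + T * (Real.exp (T * (2 * lam)) * B)))
  refine ⟨C, hC, δ, hδ, ?_⟩
  intro γ hγ hγi hγlam φ f hφ hf Ω mΩ P _ ℱ μ hμ hc Y U hY N dt hN hdtN hdtδ x₀ dx hdx S hS My Mf Q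
    w a r _ _ hw hqy hqf y hy n hn
  have := JumpBSDE.isFiniteMeasure_jumpMeasure hγi
  have hmass : (JumpBSDE.jumpMeasure γ).real univ = lam := by
    rw [Measure.real, JumpBSDE.jumpMeasure_univ hγ hγi, hγlam, ENNReal.toReal_ofReal hlam.le]
  have hk : 2 ≤ max 2 (p + 1) := le_max_left _ _
  obtain ⟨φ', rfl⟩ : ∃ φ' : BoundedContinuousFunction ℝ ℝ, ⇑φ' = φ :=
    ⟨BoundedContinuousFunction.ofNormedAddCommGroup φ
      (continuousOn_univ.1 hφ.1.continuousOn) B fun x => hφ.abs_le (mem_univ x), rfl⟩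
  have hB : 0 ≤ B := (abs_nonneg _).trans (hφ.abs_le (mem_univ 0))
  obtain ⟨F, hF, hFf⟩ := JumpBSDE.exists_nemytskii hT hk hf
  obtain ⟨v, hv⟩ := JumpBSDE.exists_isBackwardSolution hT.le
    ((JumpBSDE.norm_gen_le (JumpBSDE.jumpMeasure γ)).trans_eq (by rw [hmass])) hF
    ((BoundedContinuousFunction.norm_le hB).2 fun x => hφ.abs_le (mem_univ x))
  have hYv : ∀ t ∈ Icc 0 T, ∀ x, ∀ᵐ ω ∂P, Y t x t ω = v t x := fun t ht x =>
    (hY t ht x).ae_eq hμ hc hf.1.continuousOn (fun z hz => hf.abs_le hz)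
      (fun r hr x y y' => (hf.norm_sub_le (by omega) (JumpBSDE.uniqueDiffOn_slab hT)
        (JumpBSDE.convex_slab T) ⟨hr, mem_univ _⟩ ⟨hr, mem_univ _⟩).trans_eq
          (by simp [Prod.norm_def])) hF hFf hv ht
  have hval : ∀ t ∈ Icc 0 T, ∀ x, JumpBSDE.value P Y t x = v t x := fun t ht x => by
    rw [JumpBSDE.value, integral_congr_ae (hYv t ht x)]
    simp
  have hN' : (0 : ℝ) < N := by exact_mod_cast hN
  have hgrid : ∀ n ≤ N, JumpBSDE.tgrid dt n ∈ Icc 0 T := fun n hn => by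
    rw [JumpBSDE.tgrid, hdtN]
    refine ⟨by positivity, ?_⟩
    rw [mul_div_left_comm]
    exact mul_le_of_le_one_right hT.le ((div_le_one hN').2 (by exact_mod_cast hn))
  have hbound := hmain γ hγ hγi hmass f F φ' v hφ hf hF hFf hv N dt hN hdtN hdtδ x₀ dx hdx S hS My
    Mf Q w a r hw
    (fun n hn i m hm => by
      have e : (fun n x => JumpBSDE.value P Y (JumpBSDE.tgrid dt n) x) (n + 1)
          = (fun n x => v (JumpBSDE.tgrid dt n) x) (n + 1) := funext fun x => hval _ (hgrid _ hn) x
      have := hqy n hn i m hm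
      rwa [e] at this)
    (fun n hn i m hm => by
      have e : (fun n x => f (JumpBSDE.tgrid dt n, x, JumpBSDE.value P Y (JumpBSDE.tgrid dt n) x))
          (n + 1) = (fun n x => f (JumpBSDE.tgrid dt n, x, v (JumpBSDE.tgrid dt n) x)) (n + 1) :=
        funext fun x => by simp only [hval _ (hgrid _ hn) x]
      have := hqf n hn i m hm
      rwa [e] at this)
    y hy n hn
  -- The exceptional null set depends on the starting point; there are only countably many mesh
  -- points.
  filter_upwards [ae_all_iff.2 fun i : ℤ => hYv _ (hgrid n hn) (JumpBSDE.xgrid x₀ dx i)] with ω hω i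
  rw [hω i]
  exact hbound i
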